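/- Let $\mu>0$, $\theta\in(0,1)$ and $k>\max\{1,\mu\}$. Then there is $\delta_0>0$ such that the following holds for every $\delta\in(0,\delta_0)$ and every $b\in C^2([0,\infty)\times\mathbf R)$ with $$|\partial_t^\alpha\partial_x^\beta b(t,x)|\le \frac{\delta}{(1+t)^{k+\alpha}}\qquad(\alpha,\beta\in\{0,1\},\ (t,x)\in[0,\infty)\times\mathbf R).$$ Put $a(t,x)=\frac{\mu}{1+t}+b(t,x)$. (i) There exists $h\in C^2([0,\infty)\times\mathbf R)$ that solves $$h_{tt}-h_{xx}+\Big(\frac{\mu}{1+t}-b\Big)h_t-\Big(\frac{\mu}{1+t}\,b+b_t\Big)(1+h)=0 \quad\text{on } [0,\infty)\times\mathbf R$$ and satisfies $|h(t,x)|\le\theta(1+t)^{-(k-1)}$ and, for some constant $C>0$, $|h_t(t,x)|+|h_x(t,x)|\le C(1+t)^{-k}$ for all $(t,x)\in[0,\infty)\times\mathbf R$. (ii) Let $h$ be any function as in (i), and let $g(t,x)=(1+t)^{\mu}(1+h(t,x))$. Let $1<p\le 1+\frac2\mu$, and let $(u_0,u_1)\in H^1(\mathbf R)\times L^2(\mathbf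 R)$ (real-valued) satisfy $$\liminf_{R\to\infty}\int_{-R}^{R}\Big(\big(-g_t(0,x)+g(0,x)a(0,x)\big)u_0(x)+g(0,x)u_1(x)\Big)\,dx>0 .$$ Then the local solution of $$u_{tt}-u_{xx}+a(t,x)u_t=|u|^p,\qquad (u,u_t)(0,\cdot)=(u_0,u_1)$$ blows up in finite time: there are $T^*\in(0,\infty)$ and a solution $u$ on $[0,T^*)$ such that $$\lim_{t\to T^*-0}\big\|(u,u_t)(t)\big\|_{H^1\times L^2}=+\infty ,$$ and $u$ is the unique maximal solution, i.e. every solution on an interval $[0,T)$, $T\in(0,\infty]$, satisfies $T\le T^*$ and coincides with $u$ on $[0,T)$. Here, for $T\in(0,\infty]$, a solution on $[0,T)$ is a function $u\in C([0,T);H^1(\mathbf R))\cap C^1([0,T);L^2(\mathbf R))$ such that $$\int_{[0,T)\times\mathbf R}u\,\big(\partial_t^2\psi-\partial_x^2\psi-\partial_t(a\psi)\big)\,dx\,dt=\int_{\mathbf R}\Big\{\big(a(0,x)u_0(x)+u_1(x)\big)\psi(0,x)-u_0(x)\,\partial_t\psi(0,x)\Big\}dx+\int_{[0,T)\times\mathbf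 R}|u|^p\psi\,dx\,dt$$ for all $\psi\in C^2_0([0,T)\times\mathbf R)$, i.e. all $C^2$ functions $\psi$ with compact support in $[0,T)\times\mathbf R$ (not necessarily vanishing at $t=0$). -/

import Mathlib

open MeasureTheory Set Filter Topology
open scoped ContDiff

noncomputable section

namespace DampedWave

/-! ### Function spaces -/

/-- The real Lebesgue space `L²(ℝ)`. -/
abbrev L2 : Type := Lp ℝ 2 (volume : Measure ℝ)

/-- `w ∈ L²(ℝ)` is the weak derivative of `f ∈ L²(ℝ)`. -/
def HasWeakDeriv (f w : L2) : Prop :=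
  ∀ φ : ℝ → ℝ, ContDiff ℝ ∞ φ → HasCompactSupport φ →
    ∫ x, f x * deriv φ x = - ∫ x, w x * φ x

theorem integrable_mul_of_compact (f : L2) (φ : ℝ → ℝ) (hφ : Continuous φ)
    (hs : HasCompactSupport φ) : Integrable (fun x => f x * φ x) :=
  (Lp.memLp f).integrable_mul (q := 2) (hφ.memLp_of_hasCompactSupport hs)

theorem HasWeakDeriv.zero : HasWeakDeriv 0 0 := by
  intro φ _ _
  have h : ∀ ψ : ℝ → ℝ, ∫ x, (0 : L2) x * ψ x = 0 := by
    intro ψ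
    rw [← integral_zero ℝ ℝ (μ := volume)]
    apply integral_congr_ae
    filter_upwards [Lp.coeFn_zero ℝ 2 (volume : Measure ℝ)] with x hx
    rw [hx]
    simp
  rw [h, h, neg_zero]

theorem integral_add_mul (f g : L2) (φ : ℝ → ℝ) (hφ : Continuous φ) (hs : HasCompactSupport φ) :
    ∫ x, (f + g) x * φ x = (∫ x, f x * φ x) + ∫ x, g x * φ x := by
  rw [← integral_add (integrable_mul_of_compact f φ hφ hs) (integrable_mul_of_compact g φ hφ hs)]
  apply integral_congr_ae
  filter_upwards [Lp.coeFn_add f g] with x hx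
  rw [hx, Pi.add_apply, add_mul]

theorem integral_smul_mul (c : ℝ) (f : L2) (φ : ℝ → ℝ) :
    ∫ x, (c • f) x * φ x = c * ∫ x, f x * φ x := by
  rw [← integral_const_mul]
  apply integral_congr_ae
  filter_upwards [Lp.coeFn_smul c f] with x hx
  rw [hx, Pi.smul_apply, smul_eq_mul, mul_assoc]

theorem HasWeakDeriv.add {f g v w : L2} (hf : HasWeakDeriv f v) (hg : HasWeakDeriv g w) :
    HasWeakDeriv (f + g) (v + w) := by
  intro φ hφ hs
  rw [integral_add_mul f g _ (hφ.continuous_deriv (by simp)) hs.deriv,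
    integral_add_mul v w φ hφ.continuous hs, hf φ hφ hs, hg φ hφ hs]
  ring

theorem HasWeakDeriv.smul (c : ℝ) {f v : L2} (hf : HasWeakDeriv f v) :
    HasWeakDeriv (c • f) (c • v) := by
  intro φ hφ hs
  rw [integral_smul_mul, integral_smul_mul, hf φ hφ hs]
  ring

/-- The Sobolev space `H¹(ℝ)`, realised as the space of pairs `(f, f')` with `f ∈ L²(ℝ)` and with
weak derivative `f' ∈ L²(ℝ)`; it carries the norm `(‖f‖² + ‖f'‖²)^(1/2)`. -/
def H1 : Submodule ℝ (WithLp 2 (L2 × L2)) where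
  carrier := {z | HasWeakDeriv z.fst z.snd}
  zero_mem' := HasWeakDeriv.zero
  add_mem' := fun ha hb => HasWeakDeriv.add ha hb
  smul_mem' := fun c _ ha => HasWeakDeriv.smul c ha

/-- The inclusion `H¹(ℝ) → L²(ℝ)`. -/
def toL2 (f : H1) : L2 := f.1.fst

/-! ### Classical derivatives on `[0,∞) × ℝ` -/

/-- Time derivative of a function on `[0,∞) × ℝ`, one-sided at `t = 0`. -/
def dt (f : ℝ → ℝ → ℝ) (t x : ℝ) : ℝ := derivWithin (fun s => f s x) (Ici 0) t

/-- Space derivative of a function on `[0,∞) × ℝ`. -/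
def dx (f : ℝ → ℝ → ℝ) (t x : ℝ) : ℝ := deriv (fun y => f t y) x

/-- `f ∈ C²([0,∞) × ℝ)`. -/
def IsC2 (f : ℝ → ℝ → ℝ) : Prop :=
  ContDiffOn ℝ 2 (fun q : ℝ × ℝ => f q.1 q.2) (Ici 0 ×ˢ univ)

/-! ### The damping and the weight -/

/-- The damping coefficient `a(t,x) = μ/(1+t) + b(t,x)`. -/
def damping (μ : ℝ) (b : ℝ → ℝ → ℝ) (t x : ℝ) : ℝ := μ / (1 + t) + b t x

/-- `b ∈ C²([0,∞) × ℝ)` and `|∂ₜ^α ∂ₓ^β b(t,x)| ≤ δ / (1+t)^(k+α)` for `α, β ∈ {0,1}`. -/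
structure IsPerturbation (k δ : ℝ) (b : ℝ → ℝ → ℝ) : Prop where
  contDiff : IsC2 b
  bound : ∀ t x, 0 ≤ t → |b t x| ≤ δ / (1 + t) ^ k
  bound_dx : ∀ t x, 0 ≤ t → |dx b t x| ≤ δ / (1 + t) ^ k
  bound_dt : ∀ t x, 0 ≤ t → |dt b t x| ≤ δ / (1 + t) ^ (k + 1)
  bound_dt_dx : ∀ t x, 0 ≤ t → |dt (dx b) t x| ≤ δ / (1 + t) ^ (k + 1)

/-- `h ∈ C²([0,∞) × ℝ)` is a classical solution of
`h_tt - h_xx + (μ/(1+t) - b) h_t - (μ/(1+t) b + b_t) (1 + h) = 0` with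
`|h| ≤ θ (1+t)^(-(k-1))` and `|h_t|, |h_x| ≤ C (1+t)^(-k)`. -/
structure IsCorrector (μ k θ : ℝ) (b h : ℝ → ℝ → ℝ) : Prop where
  contDiff : IsC2 h
  equation : ∀ t x, 0 ≤ t →
    dt (dt h) t x - dx (dx h) t x + (μ / (1 + t) - b t x) * dt h t x
      - (μ / (1 + t) * b t x + dt b t x) * (1 + h t x) = 0
  bound : ∀ t x, 0 ≤ t → |h t x| ≤ θ / (1 + t) ^ (k - 1)
  bound_deriv : ∃ C : ℝ, 0 < C ∧ ∀ t x, 0 ≤ t →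
    |dt h t x| ≤ C / (1 + t) ^ k ∧ |dx h t x| ≤ C / (1 + t) ^ k

/-- The weight `g(t,x) = (1+t)^μ (1 + h(t,x))`. -/
def weight (μ : ℝ) (h : ℝ → ℝ → ℝ) (t x : ℝ) : ℝ := (1 + t) ^ μ * (1 + h t x)

/-- The condition on the data
`liminf_{R→∞} ∫_{-R}^R ((-g_t(0,x) + g(0,x) a(0,x)) u₀(x) + g(0,x) u₁(x)) dx > 0`.
The lower limit is taken in `[-∞,∞]`. -/
def DataCondition (a g : ℝ → ℝ → ℝ) (u₀ : H1) (u₁ : L2) : Prop :=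
  (0 : EReal) < liminf (fun R : ℝ =>
    ((∫ x in (-R)..R,
      ((-dt g 0 x + g 0 x * a 0 x) * toL2 u₀ x + g 0 x * u₁ x) : ℝ) : EReal)) atTop

/-! ### Solutions of `u_tt - u_xx + a u_t = |u|^p`, `(u,u_t)(0) = (u₀,u₁)` -/

/-- The time interval `[0,T)`, where `T ∈ (0,∞]`. -/
def timeInterval (T : EReal) : Set ℝ := {t : ℝ | 0 ≤ t ∧ (t : EReal) < T}

/-- The time derivative `u_t(t) ∈ L²(ℝ)` of `u : [0,T) → H¹(ℝ)`, taken in `L²(ℝ)`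
(one-sided at `t = 0`). -/
def velocity (T : EReal) (u : ℝ → H1) (t : ℝ) : L2 :=
  derivWithin (fun s => toL2 (u s)) (timeInterval T) t

/-- `u ∈ X(T) = C([0,T); H¹(ℝ)) ∩ C¹([0,T); L²(ℝ))`. -/
def MemX (T : EReal) (u : ℝ → H1) : Prop :=
  ContinuousOn u (timeInterval T) ∧ ContDiffOn ℝ 1 (fun t => toL2 (u t)) (timeInterval T)

/-- `ψ ∈ C₀²([0,T) × ℝ)`: a `C²` function on `[0,∞) × ℝ` that vanishes outside a compact subset
of `[0,T) × ℝ` (`ψ` need not vanish at `t = 0`). -/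
def IsTest (T : EReal) (ψ : ℝ → ℝ → ℝ) : Prop :=
  IsC2 ψ ∧ ∃ K : Set (ℝ × ℝ), IsCompact K ∧ K ⊆ timeInterval T ×ˢ univ ∧
    ∀ t x, 0 ≤ t → (t, x) ∉ K → ψ t x = 0

/-- `u ∈ X(T)` is a solution on `[0,T)`: for all `ψ ∈ C₀²([0,T) × ℝ)`,
`∬ u (ψ_tt - ψ_xx - (aψ)_t) dx dt
  = ∫ ((a(0,x) u₀ + u₁) ψ(0,x) - u₀ ψ_t(0,x)) dx + ∬ |u|^p ψ dx dt`.
As `u(t)` is a class of functions of `x` for each `t`, the space-time integrals are written as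
iterated integrals; the inner ones do not depend on the choice of representatives. -/
def IsSolution (a : ℝ → ℝ → ℝ) (p : ℝ) (u₀ : H1) (u₁ : L2) (T : EReal) (u : ℝ → H1) : Prop :=
  0 < T ∧ MemX T u ∧ ∀ ψ : ℝ → ℝ → ℝ, IsTest T ψ →
    ∫ t in timeInterval T, ∫ x, toL2 (u t) x *
        (dt (dt ψ) t x - dx (dx ψ) t x - dt (fun s y => a s y * ψ s y) t x)
      = (∫ x, ((a 0 x * toL2 u₀ x + u₁ x) * ψ 0 x - toL2 u₀ x * dt ψ 0 x))
        + ∫ t in timeInterval T, ∫ x, |toL2 (u t) x| ^ p * ψ t x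

/-- The local solution blows up in finite time: there are a finite `T > 0` and a solution `u` on
`[0,T)` with `‖(u,u_t)(t)‖_{H¹×L²} → ∞` as `t → T-`, and `u` is the (unique, maximal) local
solution, i.e. every solution on any interval `[0,T')` satisfies `T' ≤ T` and agrees with `u`. -/
def BlowsUpInFiniteTime (a : ℝ → ℝ → ℝ) (p : ℝ) (u₀ : H1) (u₁ : L2) : Prop :=
  ∃ T : ℝ, 0 < T ∧ ∃ u : ℝ → H1, IsSolution a p u₀ u₁ T u ∧
    Tendsto (fun t => ‖u t‖ + ‖velocity T u t‖) (𝓝[<] T) atTop ∧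
    ∀ (T' : EReal) (v : ℝ → H1), IsSolution a p u₀ u₁ T' v →
      T' ≤ T ∧ ∀ t ∈ timeInterval T', v t = u t

end DampedWave

end

/-! Two independent facts are combined. The maximal solution is global or its norm tends to infinity
in finite time (`blowsUpInFiniteTime_of_no_global` draws the conclusion), and there is no global
solution (`no_global_solution`).

Local theory. In terms of the Riemann invariants u_t ± u_x the free wave group acts by translations.
Conjugating with it removes the unbounded generator and leaves an ordinary differential equation in
H¹ × L², whose field is Lipschitz on bounded sets because H¹ embeds in L^∞ (`isLocLip_field`).
Picard–Lindelöf gives an existence time depending only on the size of the data, hence the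
alternative `IsLocLip.exists_maximal`. Weak solutions are the same as mild ones
(`IsMild.isSolution`, `IsSolution.isMild`), so existence, uniqueness and maximality carry over.

The corrector. The equation reads h_tt - h_xx = F (1 + h) - B h_t with F = μb/(1+t) + b_t small and
B = μ/(1+t) - b. It is solved from t = ∞ by d'Alembert's formula: the unknown is q = h_t, h is its
primitive vanishing at infinity, and q must equal minus half the sum of the integrals of the
right-hand side along the two forward characteristics. In the norm sup (1+t)^k |q| one such
integration of a source decaying like (1+t)^(-k-1) gains 1/k, so the linear map has norm (μ +
O(δ))/k. This is less than 1 for small δ since k > μ; the condition k > 1 makes q integrable in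
time. The x-derivative of q is carried through the contraction, which makes h a C² function
(`Coeffs.exists_solution`, `exists_corrector`).

Nonexistence. Let L ψ = ψ_tt - ψ_xx - (aψ)_t be the adjoint operator. The corrector equation says
that g = (1+t)^μ (1+h) satisfies L g = 0 (`IsCorrector.adjoint_weight`). Testing with g φ_R, where
φ_R(t,x) = χ(t/R) χ(x/R), therefore leaves on the linear side only terms with derivatives of φ_R;
these vanish for t, |x| < R and are O((1+t)^(μ-1) R^(-1) φ_R^(1/p)). Put s = 1/(p-1), so that p ≤ 1
+ 2/μ means μ ≤ 2s, and I(R) = ∬ |u|^p g φ_R. Young's inequality with a parameter K gives, for large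
R, c + I(R) ≤ K (I(R) - I(R/2)) + D K^(-s) with c > 0 from the data and D independent of R and K
(`exists_absorption`). With K = 1/2 the quantity I stays bounded; with K large it grows by a fixed
amount at each doubling of R. This contradiction (`false_of_absorption`) covers the critical
exponent as well.

The data integrand need not be integrable on the line. Since χ is even and decreasing on the
half-line, its integral against the data is an average of integrals over symmetric intervals, which
is what the hypothesis controls (`le_integral_mul_cutoff`). -/

noncomputable section

namespace DampedWave

/-! ### Classes of functions in `L²(ℝ)` -/

open scoped Classical in
/-- The class in `L²(ℝ)` of a square integrable function, and `0` for other functions. -/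
def cls (f : ℝ → ℝ) : L2 := if h : MemLp f 2 volume then h.toLp f else 0

theorem coe_cls {f : ℝ → ℝ} (h : MemLp f 2 volume) : cls f =ᵐ[volume] f := by
  rw [cls, dif_pos h]
  exact h.coeFn_toLp

theorem eq_cls {u : L2} {f : ℝ → ℝ} (h : u =ᵐ[volume] f) : u = cls f := by
  have hf : MemLp f 2 volume := (memLp_congr_ae h).1 (Lp.memLp u)
  exact Lp.ext (h.trans (coe_cls hf).symm)

theorem inner_eq (u v : L2) : inner ℝ u v = ∫ x, u x * v x := by
  rw [L2.inner_def]
  exact integral_congr_ae (Eventually.of_forall fun x => by simp [mul_comm])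

theorem inner_cls (u : L2) {f : ℝ → ℝ} (h : MemLp f 2 volume) :
    inner ℝ u (cls f) = ∫ x, u x * f x := by
  rw [inner_eq]
  apply integral_congr_ae
  filter_upwards [coe_cls h] with x hx
  rw [hx]

theorem cls_add {f g : ℝ → ℝ} (hf : MemLp f 2 volume) (hg : MemLp g 2 volume) :
    cls (fun x => f x + g x) = cls f + cls g := by
  refine (eq_cls ?_).symm
  filter_upwards [Lp.coeFn_add (cls f) (cls g), coe_cls hf, coe_cls hg] with x h1 h2 h3
  rw [h1, Pi.add_apply, h2, h3]

theorem cls_sub {f g : ℝ → ℝ} (hf : MemLp f 2 volume) (hg : MemLp g 2 volume) :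
    cls (fun x => f x - g x) = cls f - cls g := by
  refine (eq_cls ?_).symm
  filter_upwards [Lp.coeFn_sub (cls f) (cls g), coe_cls hf, coe_cls hg] with x h1 h2 h3
  rw [h1, Pi.sub_apply, h2, h3]

theorem cls_smul (c : ℝ) {f : ℝ → ℝ} (hf : MemLp f 2 volume) :
    cls (fun x => c * f x) = c • cls f := by
  refine (eq_cls ?_).symm
  filter_upwards [Lp.coeFn_smul c (cls f), coe_cls hf] with x h1 h2
  rw [h1, Pi.smul_apply, h2, smul_eq_mul]

theorem norm_sq_eq (u : L2) : ‖u‖ ^ 2 = ∫ x, u x ^ 2 := by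
  rw [← real_inner_self_eq_norm_sq, inner_eq]
  simp_rw [pow_two]

theorem memLp_of_support {f : ℝ → ℝ} {M : ℝ} (hf : Continuous f)
    (hs : ∀ x, x ∉ Icc (-M) M → f x = 0) : MemLp f 2 volume :=
  hf.memLp_of_hasCompactSupport (HasCompactSupport.intro isCompact_Icc hs)

theorem norm_cls_le {f : ℝ → ℝ} {M ε : ℝ} (hf : Continuous f)
    (hs : ∀ x, x ∉ Icc (-M) M → f x = 0) (hb : ∀ x ∈ Icc (-M) M, |f x| ≤ ε) (hε : 0 ≤ ε)
    (hM : 0 ≤ M) : ‖cls f‖ ≤ ε * Real.sqrt (2 * M) := by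
  have hm := memLp_of_support hf hs
  have h1 : ‖cls f‖ ^ 2 ≤ ε ^ 2 * (2 * M) := by
    rw [norm_sq_eq]
    have h2 : ∫ x, (cls f) x ^ 2 = ∫ x in Icc (-M) M, f x ^ 2 := by
      rw [setIntegral_eq_integral_of_forall_compl_eq_zero
        (fun x hx => by rw [hs x hx]; simp)]
      apply integral_congr_ae
      filter_upwards [coe_cls hm] with x hx
      rw [hx]
    rw [h2]
    calc ∫ x in Icc (-M) M, f x ^ 2 ≤ ∫ x in Icc (-M) M, ε ^ 2 := by
          apply setIntegral_mono_on
          · exact (hf.pow 2).continuousOn.integrableOn_Icc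
          · exact continuousOn_const.integrableOn_Icc
          · exact measurableSet_Icc
          · intro x hx
            have := hb x hx
            rw [← sq_abs]
            gcongr
      _ = ε ^ 2 * (2 * M) := by
          rw [setIntegral_const]
          simp only [Measure.real, Real.volume_Icc, smul_eq_mul]
          rw [ENNReal.toReal_ofReal (by linarith)]
          ring
  have h3 : (ε * Real.sqrt (2 * M)) ^ 2 = ε ^ 2 * (2 * M) := by
    rw [mul_pow, Real.sq_sqrt (by linarith)]
  rw [← h3] at h1
  exact le_of_sq_le_sq h1 (by positivity)

/-- A compactly supported function, continuous in space-time, is continuous in time with values in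
`L²(ℝ)`. -/
theorem continuousOn_cls {c : ℝ → ℝ → ℝ} {s : Set ℝ} {M : ℝ} (hM : 0 ≤ M)
    (hc : ContinuousOn (Function.uncurry c) (s ×ˢ univ))
    (hs : ∀ t ∈ s, ∀ x, x ∉ Icc (-M) M → c t x = 0) :
    ContinuousOn (fun t => cls (c t)) s := by
  have hcx : ∀ t ∈ s, Continuous (c t) := fun t ht =>
    hc.comp_continuous (f := fun x => (t, x)) (by fun_prop) fun x => ⟨ht, mem_univ _⟩
  intro t ht
  refine Metric.continuousWithinAt_iff'.2 fun ε hε => ?_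
  set η := ε / (2 * (Real.sqrt (2 * M) + 1)) with hη
  have hηp : 0 < η := by positivity
  -- Continuity at t is uniform over the compact `[-M, M]`, outside of which both slices vanish; a
  -- sup bound η then costs a factor √(2M) in L².
  obtain ⟨v, hv, hv'⟩ := (isCompact_Icc (a := -M) (b := M)).mem_uniformity_of_prod
    (f := c) (hc.mono (prod_mono_right (subset_univ _))) ht (Metric.dist_mem_uniformity hηp)
  filter_upwards [hv, self_mem_nhdsWithin] with τ hτ hτs
  rw [dist_eq_norm, ← cls_sub (memLp_of_support (hcx τ hτs) (hs τ hτs))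
    (memLp_of_support (hcx t ht) (hs t ht))]
  refine (norm_cls_le (M := M) (ε := η) ((hcx τ hτs).sub (hcx t ht)) ?_ ?_ hηp.le hM).trans_lt ?_
  · intro x hx
    rw [Pi.sub_apply, hs τ hτs x hx, hs t ht x hx, sub_zero]
  · intro x hx
    exact (hv' τ hτ x hx).le
  · have : 0 ≤ Real.sqrt (2 * M) := Real.sqrt_nonneg _
    rw [hη, div_mul_eq_mul_div, div_lt_iff₀ (by positivity)]
    nlinarith

/-- A compactly supported function, `C¹` in time, is differentiable in time with values in
`L²(ℝ)`. -/
theorem hasDerivWithinAt_cls {c c' : ℝ → ℝ → ℝ} {s : Set ℝ} {M : ℝ} (hM : 0 ≤ M)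
    (hconv : Convex ℝ s) (hc : ∀ t ∈ s, Continuous (c t))
    (hc' : ContinuousOn (Function.uncurry c') (s ×ˢ univ))
    (hd : ∀ t ∈ s, ∀ x, HasDerivWithinAt (fun τ => c τ x) (c' t x) s t)
    (hs : ∀ t ∈ s, ∀ x, x ∉ Icc (-M) M → c t x = 0)
    (hs' : ∀ t ∈ s, ∀ x, x ∉ Icc (-M) M → c' t x = 0) {t : ℝ} (ht : t ∈ s) :
    HasDerivWithinAt (fun t => cls (c t)) (cls (c' t)) s t := by
  have hcx' : ∀ t ∈ s, Continuous (c' t) := fun t ht =>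
    hc'.comp_continuous (f := fun x => (t, x)) (by fun_prop) fun x => ⟨ht, mem_univ _⟩
  rw [hasDerivWithinAt_iff_isLittleO, Asymptotics.isLittleO_iff]
  intro ε hε
  set η := ε / (Real.sqrt (2 * M) + 1) with hη
  have hηp : 0 < η := by positivity
  obtain ⟨v, hv, hv'⟩ := (isCompact_Icc (a := -M) (b := M)).mem_uniformity_of_prod
    (f := c') (hc'.mono (prod_mono_right (subset_univ _))) ht (Metric.dist_mem_uniformity hηp)
  obtain ⟨ρ, hρ, hball⟩ := Metric.mem_nhdsWithin_iff.1 hv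
  filter_upwards [mem_nhdsWithin_of_mem_nhds (Metric.ball_mem_nhds t hρ), self_mem_nhdsWithin]
    with τ hτ hτs
  have m1 := memLp_of_support (hc τ hτs) (hs τ hτs)
  have m2 := memLp_of_support (hc t ht) (hs t ht)
  have m3 := memLp_of_support (hcx' t ht) (hs' t ht)
  have key : cls (c τ) - cls (c t) - (τ - t) • cls (c' t)
      = cls (fun x => (c τ x - c t x) - (τ - t) * c' t x) := by
    rw [cls_sub (f := fun x => c τ x - c t x) (m1.sub m2) (m3.const_mul (τ - t)),
      cls_sub m1 m2, cls_smul _ m3]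
  rw [key]
  refine (norm_cls_le (M := M) (ε := η * |τ - t|) (by
    exact ((hc τ hτs).sub (hc t ht)).sub ((hcx' t ht).const_mul _)) ?_ ?_ (by positivity) hM).trans ?_
  · intro x hx
    rw [hs τ hτs x hx, hs t ht x hx, hs' t ht x hx]
    simp
  · intro x hx
    -- The mean value inequality for σ ↦ c σ x - σ c' t x, near t where c' varies by at most η,
    -- bounds the remainder by η |τ - t| uniformly in x.
    have hd2 : ∀ σ ∈ s ∩ Metric.ball t ρ, HasDerivWithinAt (fun σ => c σ x - σ * c' t x)
        (c' σ x - c' t x) (s ∩ Metric.ball t ρ) σ := by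
      intro σ hσ
      have h1 := (hd σ hσ.1 x).mono (inter_subset_left (t := Metric.ball t ρ))
      simpa using h1.fun_sub ((hasDerivWithinAt_id σ _).mul_const (c' t x))
    have hb : ∀ σ ∈ s ∩ Metric.ball t ρ, ‖c' σ x - c' t x‖ ≤ η := by
      intro σ hσ
      exact (hv' σ (hball ⟨hσ.2, hσ.1⟩) x hx).le
    have h3 := (hconv.inter (convex_ball t ρ)).norm_image_sub_le_of_norm_hasDerivWithin_le hd2 hb
      ⟨ht, Metric.mem_ball_self hρ⟩ ⟨hτs, hτ⟩
    rw [Real.norm_eq_abs, Real.norm_eq_abs] at h3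
    convert h3 using 2
    ring
  · rw [Real.norm_eq_abs, hη]
    have h4 : 0 ≤ Real.sqrt (2 * M) := Real.sqrt_nonneg _
    have : ε / (Real.sqrt (2 * M) + 1) * Real.sqrt (2 * M) ≤ ε := by
      rw [div_mul_eq_mul_div, div_le_iff₀ (by positivity)]
      nlinarith
    nlinarith [abs_nonneg (τ - t)]

/-- An element of `L²(ℝ)` orthogonal to all test functions vanishes. -/
theorem eq_zero_of_inner_test {u : L2}
    (h : ∀ φ : ℝ → ℝ, ContDiff ℝ ∞ φ → HasCompactSupport φ → inner ℝ u (cls φ) = 0) : u = 0 := by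
  rw [Lp.eq_zero_iff_ae_eq_zero]
  refine ae_eq_zero_of_integral_contDiff_smul_eq_zero
    ((Lp.memLp u).locallyIntegrable (by norm_num)) ?_
  intro φ hφ hs
  rw [← h φ hφ hs, inner_cls u (hφ.continuous.memLp_of_hasCompactSupport hs)]
  exact integral_congr_ae (Eventually.of_forall fun x => by simp [mul_comm])

theorem eq_of_inner_test {u v : L2}
    (h : ∀ φ : ℝ → ℝ, ContDiff ℝ ∞ φ → HasCompactSupport φ →
      inner ℝ u (cls φ) = inner ℝ v (cls φ)) : u = v := by
  refine sub_eq_zero.1 (eq_zero_of_inner_test fun φ hφ hs => ?_)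
  rw [inner_sub_left, h φ hφ hs, sub_self]

/-! ### Translations -/

/-- The translation `f ↦ f(· + t)` of `L²(ℝ)`. -/
def shift (t : ℝ) : L2 →ₗᵢ[ℝ] L2 :=
  Lp.compMeasurePreservingₗᵢ ℝ (fun x => x + t) (measurePreserving_add_right volume t)

theorem coe_shift (t : ℝ) (f : L2) : shift t f =ᵐ[volume] fun x => f (x + t) :=
  Lp.coeFn_compMeasurePreserving f (measurePreserving_add_right volume t)

theorem ae_shift {P : ℝ → Prop} (h : ∀ᵐ x, P x) (t : ℝ) : ∀ᵐ x, P (x + t) :=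
  (measurePreserving_add_right volume t).quasiMeasurePreserving.ae h

theorem shift_shift (s t : ℝ) (f : L2) : shift s (shift t f) = shift (s + t) f := by
  apply Lp.ext
  filter_upwards [coe_shift s (shift t f), ae_shift (coe_shift t f) s, coe_shift (s + t) f]
    with x h1 h2 h3
  rw [h1, h2, h3, add_assoc]

theorem shift_zero (f : L2) : shift 0 f = f := by
  apply Lp.ext
  filter_upwards [coe_shift 0 f] with x h1
  rw [h1, add_zero]

theorem shift_neg_shift (t : ℝ) (f : L2) : shift (-t) (shift t f) = f := by
  rw [shift_shift, neg_add_cancel, shift_zero]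

theorem shift_shift_neg (t : ℝ) (f : L2) : shift t (shift (-t) f) = f := by
  rw [shift_shift, add_neg_cancel, shift_zero]

theorem inner_shift (t : ℝ) (f g : L2) : inner ℝ (shift t f) g = inner ℝ f (shift (-t) g) := by
  rw [← (shift t).inner_map_map f (shift (-t) g), shift_shift_neg]

theorem shift_cls (t : ℝ) {f : ℝ → ℝ} (hf : MemLp f 2 volume) :
    shift t (cls f) = cls (fun x => f (x + t)) := by
  apply eq_cls
  filter_upwards [coe_shift t (cls f), ae_shift (coe_cls hf) t] with x h1 h2
  rw [h1, h2]

theorem continuous_shift : Continuous fun q : ℝ × L2 => shift q.1 q.2 := by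
  have h : Continuous fun q : ℝ × L2 => (⟨fun x => x + q.1, by fun_prop⟩ : C(ℝ, ℝ)) := by
    apply ContinuousMap.continuous_of_continuous_uncurry
    simp only [Function.uncurry_def, ContinuousMap.coe_mk]
    fun_prop
  exact continuous_snd.compMeasurePreservingLp h
    (fun q => measurePreserving_add_right volume q.1) (by norm_num)

theorem continuous_shift_left (f : L2) : Continuous fun t => shift t f :=
  continuous_shift.comp (by fun_prop : Continuous fun t : ℝ => (t, f))

/-- The translates by |t| ≤ 1 are supported in one compact set, so the pointwise derivative passes
to L² at time 0; other times follow from the group law. -/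
theorem hasDerivAt_shift_cls {φ : ℝ → ℝ} (hφ : ContDiff ℝ 1 φ) (hs : HasCompactSupport φ) (t : ℝ) :
    HasDerivAt (fun t => shift t (cls φ)) (shift t (cls (deriv φ))) t := by
  have hd : Continuous (deriv φ) := hφ.continuous_deriv le_rfl
  have m1 := hφ.continuous.memLp_of_hasCompactSupport (p := 2) (μ := (volume : Measure ℝ)) hs
  have m2 := hd.memLp_of_hasCompactSupport (p := 2) (μ := (volume : Measure ℝ)) hs.deriv
  have h0 : HasDerivAt (fun t => shift t (cls φ)) (cls (deriv φ)) 0 := by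
    obtain ⟨M, hM⟩ := hs.isCompact.isBounded.subset_closedBall 0
    have hz : ∀ x, |M| < |x| → x ∉ tsupport φ := by
      intro x hx hx'
      have := hM hx'
      rw [Metric.mem_closedBall, dist_zero_right, Real.norm_eq_abs] at this
      linarith [le_abs_self M]
    have hz' : ∀ t ∈ Icc (-1 : ℝ) 1, ∀ x, x ∉ Icc (-(|M| + 1)) (|M| + 1) → |M| < |x + t| := by
      intro t ht x hx
      rw [mem_Icc, not_and_or, not_le, not_le] at hx
      rcases hx with hx | hx
      · rw [lt_abs]; right; linarith [ht.2]
      · rw [lt_abs]; left; linarith [ht.1]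
    have h1 : HasDerivWithinAt (fun t => cls (fun x => φ (x + t))) (cls (fun x => deriv φ (x + 0)))
        (Icc (-1) 1) 0 := by
      refine hasDerivWithinAt_cls (c := fun t x => φ (x + t)) (c' := fun t x => deriv φ (x + t))
        (M := |M| + 1) (by positivity) (convex_Icc _ _) (fun t _ => hφ.continuous.comp (by fun_prop))
        (hd.comp (by fun_prop : Continuous fun q : ℝ × ℝ => q.2 + q.1)).continuousOn ?_ ?_ ?_
        (by simp)
      · intro t _ x
        exact ((hφ.differentiable one_ne_zero (x + t)).hasDerivAt.comp_const_add x t).hasDerivWithinAt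
      · intro t ht x hx
        exact image_eq_zero_of_notMem_tsupport (hz _ (hz' t ht x hx))
      · intro t ht x hx
        exact image_eq_zero_of_notMem_tsupport fun h => hz _ (hz' t ht x hx)
          (tsupport_deriv_subset h)
    have h2 := h1.hasDerivAt (Icc_mem_nhds (by norm_num) (by norm_num))
    simp only [add_zero] at h2
    exact h2.congr_of_eventuallyEq (Eventually.of_forall fun t => shift_cls t m1)
  have h1 : HasDerivAt (fun τ => shift (τ - t) (cls φ)) (cls (deriv φ)) t := by
    have := HasDerivAt.comp_sub_const t t (f := fun t => shift t (cls φ)) (by simpa using h0)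
    exact this
  have h2 := (shift t).toContinuousLinearMap.hasFDerivAt.comp_hasDerivAt t h1
  refine h2.congr_of_eventuallyEq (Eventually.of_forall fun τ => ?_)
  simp [shift_shift]

/-! ### Weak derivatives and translations -/

theorem hasWeakDeriv_iff {f w : L2} : HasWeakDeriv f w ↔
    ∀ φ : ℝ → ℝ, ContDiff ℝ ∞ φ → HasCompactSupport φ →
      inner ℝ f (cls (deriv φ)) = - inner ℝ w (cls φ) := by
  refine forall_congr' fun φ => forall_congr' fun hφ => forall_congr' fun hs => ?_
  rw [inner_cls _ (hφ.continuous.memLp_of_hasCompactSupport hs),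
    inner_cls _ ((hφ.continuous_deriv (by simp)).memLp_of_hasCompactSupport hs.deriv)]

theorem contDiff_shift {φ : ℝ → ℝ} {n : WithTop ℕ∞} (hφ : ContDiff ℝ n φ) (t : ℝ) :
    ContDiff ℝ n fun x => φ (x + t) :=
  hφ.comp (contDiff_id.add contDiff_const)

theorem hasCompactSupport_shift {φ : ℝ → ℝ} (hs : HasCompactSupport φ) (t : ℝ) :
    HasCompactSupport fun x => φ (x + t) :=
  hs.comp_homeomorph (Homeomorph.addRight t)

/-- Paired with a test function, both sides vanish at t = 0 and have the same derivative: the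
translation moves onto the test function, where it is differentiable in L², and the weak derivative
moves it back. -/
theorem HasWeakDeriv.shift_sub {f w : L2} (h : HasWeakDeriv f w) (t : ℝ) :
    shift t f - f = ∫ s in (0 : ℝ)..t, shift s w := by
  rw [hasWeakDeriv_iff] at h
  apply eq_of_inner_test
  intro φ hφ hs
  have hφ1 : ContDiff ℝ 1 φ := hφ.of_le (by simp)
  have m1 := hφ.continuous.memLp_of_hasCompactSupport (p := 2) (μ := (volume : Measure ℝ)) hs
  have m2 := (hφ.continuous_deriv (by simp)).memLp_of_hasCompactSupport (p := 2)
    (μ := (volume : Measure ℝ)) hs.deriv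
  have d1 : ∀ t, HasDerivAt (fun t => inner ℝ (shift t f - f) (cls φ))
      (inner ℝ (shift t w) (cls φ)) t := by
    intro t
    have e1 : ∀ t, inner ℝ (shift t f - f) (cls φ)
        = inner ℝ f (shift (-t) (cls φ)) - inner ℝ f (cls φ) := fun t => by
      rw [inner_sub_left, inner_shift]
    have e2 : HasDerivAt (fun t => shift (-t) (cls φ)) (-shift (-t) (cls (deriv φ))) t := by
      exact ((hasDerivAt_shift_cls hφ1 hs (-t)).scomp t (hasDerivAt_neg t)).congr_deriv (by simp)
    have e3 := ((hasDerivAt_const t f).inner ℝ e2).sub_const (inner ℝ f (cls φ))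
    refine (e3.congr_deriv ?_).congr_of_eventuallyEq (Eventually.of_forall e1)
    have e4 : shift (-t) (cls (deriv φ)) = cls (deriv fun x => φ (x + -t)) := by
      rw [shift_cls _ m2]
      congr 1
      funext x
      rw [deriv_comp_add_const]
    rw [inner_zero_left, add_zero, inner_neg_right, e4,
      h _ (contDiff_shift hφ _) (hasCompactSupport_shift hs _), neg_neg, ← shift_cls _ m1,
      inner_shift]
  have d2 : ∀ t, HasDerivAt (fun t => inner ℝ (∫ s in (0 : ℝ)..t, shift s w) (cls φ))
      (inner ℝ (shift t w) (cls φ)) t := by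
    intro t
    have e1 := intervalIntegral.integral_hasDerivAt_right
      ((continuous_shift_left w).intervalIntegrable 0 t)
      ((continuous_shift_left w).stronglyMeasurableAtFilter _ _) (continuous_shift_left w).continuousAt
    simpa using e1.inner ℝ (hasDerivAt_const t (cls φ))
  have d3 : ∀ t, HasDerivAt (fun t => inner ℝ (shift t f - f) (cls φ)
      - inner ℝ (∫ s in (0 : ℝ)..t, shift s w) (cls φ)) 0 t := fun t => by
    simpa using (d1 t).fun_sub (d2 t)
  have := is_const_of_deriv_eq_zero (fun t => (d3 t).differentiableAt) (fun t => (d3 t).deriv) t 0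
  simp only [shift_zero, sub_self, inner_zero_left, intervalIntegral.integral_same] at this
  linarith

/-- The gain over the definition is that g is an arbitrary element of L², not a smooth test
function. -/
theorem HasWeakDeriv.hasDerivAt_inner {f w : L2} (h : HasWeakDeriv f w) (g : L2) :
    HasDerivAt (fun t => inner ℝ (shift t f) g) (inner ℝ w g) 0 := by
  have e1 := intervalIntegral.integral_hasDerivAt_right
      ((continuous_shift_left w).intervalIntegrable 0 0)
      ((continuous_shift_left w).stronglyMeasurableAtFilter _ _) (continuous_shift_left w).continuousAt
  have e2 := (e1.inner ℝ (hasDerivAt_const (0 : ℝ) g)).add_const (inner ℝ f g)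
  refine (e2.congr_deriv ?_).congr_of_eventuallyEq (Eventually.of_forall fun t => ?_)
  · simp [shift_zero]
  · change _ = inner ℝ (∫ s in (0 : ℝ)..t, shift s w) g + inner ℝ f g
    rw [← h.shift_sub, inner_sub_left, sub_add_cancel]

/-- The weak derivative may be tested with `C¹` functions. -/
theorem HasWeakDeriv.inner_deriv {f w : L2} (h : HasWeakDeriv f w) {φ : ℝ → ℝ}
    (hφ : ContDiff ℝ 1 φ) (hs : HasCompactSupport φ) :
    inner ℝ f (cls (deriv φ)) = - inner ℝ w (cls φ) := by
  have d1 := h.hasDerivAt_inner (cls φ)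
  have d2 : HasDerivAt (fun t => inner ℝ (shift t f) (cls φ)) (-inner ℝ f (cls (deriv φ))) 0 := by
    have e2 : HasDerivAt (fun t => shift (-t) (cls φ)) (-(cls (deriv φ))) 0 := by
      exact ((hasDerivAt_shift_cls hφ hs (-0)).scomp 0 (hasDerivAt_neg 0)).congr_deriv
        (by simp [shift_zero])
    have e3 := ((hasDerivAt_const 0 f).inner ℝ e2)
    refine (e3.congr_deriv ?_).congr_of_eventuallyEq (Eventually.of_forall fun t => ?_)
    · simp
    · exact inner_shift _ _ _
  have := d1.unique d2
  linarith

/-- Averaging over translations gains one weak derivative; this is why d'Alembert's formula takes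
values in H¹ when the velocity is only in L². -/
theorem hasWeakDeriv_integral_shift (t : ℝ) (A : L2) :
    HasWeakDeriv (∫ τ in (0 : ℝ)..t, shift τ A) (shift t A - A) := by
  rw [hasWeakDeriv_iff]
  intro φ hφ hs
  have hφ1 : ContDiff ℝ 1 φ := hφ.of_le (by simp)
  have d1 : ∀ t, HasDerivAt (fun t => inner ℝ (∫ s in (0 : ℝ)..t, shift s A) (cls (deriv φ)))
      (inner ℝ (shift t A) (cls (deriv φ))) t := by
    intro t
    have e1 := intervalIntegral.integral_hasDerivAt_right
      ((continuous_shift_left A).intervalIntegrable 0 t)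
      ((continuous_shift_left A).stronglyMeasurableAtFilter _ _) (continuous_shift_left A).continuousAt
    simpa using e1.inner ℝ (hasDerivAt_const t (cls (deriv φ)))
  have d2 : ∀ t, HasDerivAt (fun t => inner ℝ (shift t A - A) (cls φ))
      (-inner ℝ (shift t A) (cls (deriv φ))) t := by
    intro t
    have e1 : ∀ t, inner ℝ (shift t A - A) (cls φ)
        = inner ℝ A (shift (-t) (cls φ)) - inner ℝ A (cls φ) := fun t => by
      rw [inner_sub_left, inner_shift]
    have e2 : HasDerivAt (fun t => shift (-t) (cls φ)) (-shift (-t) (cls (deriv φ))) t := by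
      exact ((hasDerivAt_shift_cls hφ1 hs (-t)).scomp t (hasDerivAt_neg t)).congr_deriv (by simp)
    have e3 := ((hasDerivAt_const t A).inner ℝ e2).sub_const (inner ℝ A (cls φ))
    refine (e3.congr_deriv ?_).congr_of_eventuallyEq (Eventually.of_forall e1)
    rw [inner_zero_left, add_zero, inner_neg_right, inner_shift]
  have d3 : ∀ t, HasDerivAt (fun t => inner ℝ (∫ s in (0 : ℝ)..t, shift s A) (cls (deriv φ))
      + inner ℝ (shift t A - A) (cls φ)) 0 t := fun t => by
    simpa using (d1 t).fun_add (d2 t)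
  have := is_const_of_deriv_eq_zero (fun t => (d3 t).differentiableAt) (fun t => (d3 t).deriv) t 0
  simp only [shift_zero, sub_self, inner_zero_left, intervalIntegral.integral_same] at this
  linarith

/-! ### The space `H¹(ℝ)` -/

/-- The weak derivative of `f ∈ H¹(ℝ)`. -/
def wd (f : H1) : L2 := f.1.snd

/-- The element of `H¹(ℝ)` with given value and weak derivative. -/
def mkH1 (f w : L2) (h : HasWeakDeriv f w) : H1 := ⟨WithLp.toLp 2 (f, w), h⟩

@[simp] theorem toL2_mkH1 (f w : L2) (h : HasWeakDeriv f w) : toL2 (mkH1 f w h) = f := rfl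
@[simp] theorem wd_mkH1 (f w : L2) (h : HasWeakDeriv f w) : wd (mkH1 f w h) = w := rfl
@[simp] theorem toL2_add (f g : H1) : toL2 (f + g) = toL2 f + toL2 g := rfl
@[simp] theorem toL2_sub (f g : H1) : toL2 (f - g) = toL2 f - toL2 g := rfl
@[simp] theorem toL2_smul (c : ℝ) (f : H1) : toL2 (c • f) = c • toL2 f := rfl
@[simp] theorem toL2_zero : toL2 0 = 0 := rfl
@[simp] theorem wd_add (f g : H1) : wd (f + g) = wd f + wd g := rfl
@[simp] theorem wd_sub (f g : H1) : wd (f - g) = wd f - wd g := rfl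
@[simp] theorem wd_smul (c : ℝ) (f : H1) : wd (c • f) = c • wd f := rfl
@[simp] theorem wd_zero : wd 0 = 0 := rfl

theorem hasWeakDeriv (f : H1) : HasWeakDeriv (toL2 f) (wd f) := f.2

theorem H1.ext {f g : H1} (h : toL2 f = toL2 g) (h' : wd f = wd g) : f = g := by
  apply Subtype.ext
  apply (WithLp.equiv 2 (L2 × L2)).injective
  exact Prod.ext h h'

theorem norm_sq_H1 (f : H1) : ‖f‖ ^ 2 = ‖toL2 f‖ ^ 2 + ‖wd f‖ ^ 2 :=
  WithLp.prod_norm_sq_eq_of_L2 f.1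

theorem norm_toL2_le (f : H1) : ‖toL2 f‖ ≤ ‖f‖ := by
  have := norm_sq_H1 f
  exact le_of_sq_le_sq (by nlinarith [sq_nonneg ‖wd f‖]) (norm_nonneg _)

theorem norm_wd_le (f : H1) : ‖wd f‖ ≤ ‖f‖ := by
  have := norm_sq_H1 f
  exact le_of_sq_le_sq (by nlinarith [sq_nonneg ‖toL2 f‖]) (norm_nonneg _)

theorem norm_H1_le (f : H1) : ‖f‖ ≤ ‖toL2 f‖ + ‖wd f‖ := by
  have := norm_sq_H1 f
  refine le_of_sq_le_sq ?_ (by positivity)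
  nlinarith [mul_nonneg (norm_nonneg (toL2 f)) (norm_nonneg (wd f))]

/-- `toL2` as a continuous linear map. -/
def toL2L : H1 →L[ℝ] L2 :=
  LinearMap.mkContinuous ⟨⟨toL2, toL2_add⟩, toL2_smul⟩ 1 fun f => by
    rw [one_mul]; exact norm_toL2_le f

/-- `wd` as a continuous linear map. -/
def wdL : H1 →L[ℝ] L2 :=
  LinearMap.mkContinuous ⟨⟨wd, wd_add⟩, wd_smul⟩ 1 fun f => by
    rw [one_mul]; exact norm_wd_le f

theorem continuous_toL2 : Continuous toL2 := toL2L.continuous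
theorem continuous_wd : Continuous wd := wdL.continuous

theorem continuousWithinAt_H1 {X : Type*} [TopologicalSpace X] {f : X → H1} {s : Set X} {x : X}
    (h : ContinuousWithinAt (fun y => toL2 (f y)) s x)
    (h' : ContinuousWithinAt (fun y => wd (f y)) s x) : ContinuousWithinAt f s x := by
  rw [ContinuousWithinAt, tendsto_iff_norm_sub_tendsto_zero] at *
  refine squeeze_zero (fun _ => norm_nonneg _) (fun y => norm_H1_le (f y - f x)) ?_
  simpa using h.add h'

theorem continuous_H1 {X : Type*} [TopologicalSpace X] {f : X → H1}
    (h : Continuous fun y => toL2 (f y)) (h' : Continuous fun y => wd (f y)) : Continuous f := by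
  rw [← continuousOn_univ] at *
  exact fun x hx => continuousWithinAt_H1 (h x hx) (h' x hx)

theorem hasDerivWithinAt_H1 {f : ℝ → H1} {f' : H1} {s : Set ℝ} {x : ℝ}
    (h : HasDerivWithinAt (fun y => toL2 (f y)) (toL2 f') s x)
    (h' : HasDerivWithinAt (fun y => wd (f y)) (wd f') s x) : HasDerivWithinAt f f' s x := by
  rw [hasDerivWithinAt_iff_isLittleO, Asymptotics.isLittleO_iff] at *
  intro c hc
  filter_upwards [h (half_pos hc), h' (half_pos hc)] with y h1 h2
  refine (norm_H1_le _).trans ?_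
  simp only [toL2_sub, toL2_smul, wd_sub, wd_smul]
  linarith

/-- Each test function imposes one condition that is continuous in the pair. Completeness of H¹,
needed for Picard–Lindelöf, follows. -/
theorem isClosed_H1 : IsClosed (H1 : Set (WithLp 2 (L2 × L2))) := by
  have : (H1 : Set (WithLp 2 (L2 × L2))) = ⋂ φ : {φ : ℝ → ℝ // ContDiff ℝ ∞ φ ∧ HasCompactSupport φ},
      {z | inner ℝ z.fst (cls (deriv φ.1)) = - inner ℝ z.snd (cls φ.1)} := by
    ext z
    simp only [mem_iInter, mem_ofPred_eq, Subtype.forall, and_imp]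
    exact hasWeakDeriv_iff
  rw [this]
  refine isClosed_iInter fun φ => isClosed_eq ?_ ?_
  · exact (WithLp.prod_continuous_ofLp 2 L2 L2).fst.inner continuous_const
  · exact ((WithLp.prod_continuous_ofLp 2 L2 L2).snd.inner continuous_const).neg

instance : CompleteSpace H1 := isClosed_H1.completeSpace_coe

/-! ### The Sobolev embedding -/

/-- Fubini moves the average over t inside, and on an interval of length one the L¹ norm of t ↦ g (x
+ t) is at most its L² norm, hence at most ‖g‖. -/
theorem integral_inner_shift_indicator_le (g : L2) {A : Set ℝ} (hA : MeasurableSet A)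
    (hA' : volume A ≠ ⊤) :
    ∫ t in (0 : ℝ)..1, |∫ x in A, shift t g x| ≤ ‖g‖ * (volume A).toReal := by
  have hcont : Continuous fun t => ∫ x in A, shift t g x := by
    have : Continuous fun t => inner ℝ (indicatorConstLp 2 hA hA' (1 : ℝ)) (shift t g) :=
      continuous_const.inner (continuous_shift_left g)
    exact this.congr fun t => L2.inner_indicatorConstLp_one hA hA' _
  have hgm : StronglyMeasurable g := Lp.stronglyMeasurable g
  rw [intervalIntegral.integral_of_le zero_le_one, ← ENNReal.ofReal_le_ofReal_iff (by positivity),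
    ofReal_integral_eq_lintegral_ofReal
      (hcont.abs.intervalIntegrable 0 1).1 (Eventually.of_forall fun t => abs_nonneg _)]
  calc ∫⁻ t in Ioc (0 : ℝ) 1, ENNReal.ofReal |∫ x in A, shift t g x|
      ≤ ∫⁻ t in Ioc (0 : ℝ) 1, ∫⁻ x in A, ‖g (x + t)‖ₑ := by
        apply lintegral_mono
        intro t
        have e1 : ∫ x in A, shift t g x = ∫ x in A, g (x + t) :=
          integral_congr_ae (ae_restrict_of_ae (coe_shift t g))
        simp only
        rw [e1, ← Real.norm_eq_abs, ofReal_norm]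
        exact enorm_integral_le_lintegral_enorm _
    _ = ∫⁻ x in A, ∫⁻ t in Ioc (0 : ℝ) 1, ‖g (x + t)‖ₑ := by
        apply lintegral_lintegral_swap
        apply Measurable.aemeasurable
        exact (hgm.measurable.comp (by fun_prop : Measurable fun q : ℝ × ℝ => q.2 + q.1)).enorm
    _ ≤ ∫⁻ x in A, ENNReal.ofReal ‖g‖ := by
        apply lintegral_mono
        intro x
        have hm : StronglyMeasurable fun t => g (x + t) :=
          hgm.comp_measurable (by fun_prop)
        have e1 := eLpNorm_le_eLpNorm_mul_rpow_measure_univ (μ := volume.restrict (Ioc (0 : ℝ) 1))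
          (p := 1) (q := 2) (by norm_num) hm.aestronglyMeasurable
        have e2 : eLpNorm (fun t => g (x + t)) 2 volume = eLpNorm g 2 volume :=
          eLpNorm_comp_measurePreserving hgm.aestronglyMeasurable (measurePreserving_add_left volume x)
        simp only
        rw [← eLpNorm_one_eq_lintegral_enorm]
        refine e1.trans ?_
        simp only [MeasurableSet.univ, Measure.restrict_apply, univ_inter, Real.volume_Ioc, sub_zero,
          ENNReal.ofReal_one, ENNReal.one_rpow, mul_one]
        refine (eLpNorm_mono_measure _ Measure.restrict_le_self).trans ?_
        rw [e2, Lp.norm_def, ENNReal.ofReal_toReal (Lp.eLpNorm_ne_top g)]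
    _ = ENNReal.ofReal (‖g‖ * (volume A).toReal) := by
        rw [lintegral_const, Measure.restrict_apply_univ, ENNReal.ofReal_mul (norm_nonneg _),
          ENNReal.ofReal_toReal hA']

/-- The identity f = f(· + t) - ∫₀ᵗ f'(· + s) ds is integrated over A and averaged over t in [0,1].
Integrals over sets make a continuous representative unnecessary. -/
theorem abs_setIntegral_le (f : H1) {A : Set ℝ} (hA : MeasurableSet A) (hA' : volume A ≠ ⊤) :
    |∫ x in A, toL2 f x| ≤ (‖toL2 f‖ + ‖wd f‖) * (volume A).toReal := by
  have hc : ∀ g : L2, Continuous fun t => ∫ x in A, shift t g x := by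
    intro g
    have : Continuous fun t => inner ℝ (indicatorConstLp 2 hA hA' (1 : ℝ)) (shift t g) :=
      continuous_const.inner (continuous_shift_left g)
    exact this.congr fun t => L2.inner_indicatorConstLp_one hA hA' _
  have h1 : ∀ t ∈ Icc (0 : ℝ) 1, |∫ x in A, toL2 f x| ≤
      |∫ x in A, shift t (toL2 f) x| + ‖wd f‖ * (volume A).toReal := by
    intro t ht
    set e := indicatorConstLp 2 hA hA' (1 : ℝ) with he
    have e1 : ∫ x in A, toL2 f x = (∫ x in A, shift t (toL2 f) x)
        - ∫ s in (0 : ℝ)..t, ∫ x in A, shift s (wd f) x := by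
      have h2 : ∫ s in (0 : ℝ)..t, ∫ x in A, shift s (wd f) x
          = inner ℝ e (∫ s in (0 : ℝ)..t, shift s (wd f)) := by
        simp_rw [he, ← L2.inner_indicatorConstLp_one hA hA']
        exact (innerSL ℝ e).intervalIntegral_comp_comm
          ((continuous_shift_left (wd f)).intervalIntegrable 0 t)
      rw [h2, ← (hasWeakDeriv f).shift_sub t, inner_sub_right,
        L2.inner_indicatorConstLp_one, L2.inner_indicatorConstLp_one]
      ring
    rw [e1]
    refine (abs_sub _ _).trans ?_
    gcongr
    calc |∫ s in (0 : ℝ)..t, ∫ x in A, shift s (wd f) x|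
        ≤ ∫ s in (0 : ℝ)..t, |∫ x in A, shift s (wd f) x| :=
          intervalIntegral.abs_integral_le_integral_abs ht.1
      _ ≤ ∫ s in (0 : ℝ)..1, |∫ x in A, shift s (wd f) x| := by
          apply intervalIntegral.integral_mono_interval le_rfl ht.1 ht.2
            (Eventually.of_forall fun _ => abs_nonneg _)
          exact (hc (wd f)).abs.intervalIntegrable _ _
      _ ≤ _ := integral_inner_shift_indicator_le _ hA hA'
  have h2 := intervalIntegral.integral_mono_on zero_le_one
    ((continuous_const (y := |∫ x in A, toL2 f x|)).intervalIntegrable (μ := volume) 0 1)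
    (((hc (toL2 f)).abs.fun_add continuous_const).intervalIntegrable 0 1) h1
  rw [intervalIntegral.integral_const, intervalIntegral.integral_add
    ((hc (toL2 f)).abs.intervalIntegrable 0 1) (continuous_const.intervalIntegrable 0 1),
    intervalIntegral.integral_const] at h2
  have h3 := integral_inner_shift_indicator_le (toL2 f) hA hA'
  simp only [sub_zero, one_smul] at h2
  linarith

/-- The embedding of H¹ in L^∞: a function whose mean over every set of finite positive measure is
at most M in modulus is bounded by M almost everywhere. -/
theorem ae_abs_le (f : H1) : ∀ᵐ x, |toL2 f x| ≤ ‖toL2 f‖ + ‖wd f‖ := by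
  set M := ‖toL2 f‖ + ‖wd f‖ with hM
  have hint : ∀ s, MeasurableSet s → volume s < ⊤ → IntegrableOn (toL2 f) s volume :=
    fun s _ hs => integrableOn_Lp_of_measure_ne_top _ fact_one_le_two_ennreal.elim hs.ne
  have hconst : ∀ s, volume s < ⊤ → IntegrableOn (fun _ : ℝ => M) s volume :=
    fun s hs => integrableOn_const hs.ne
  have h1 : 0 ≤ᵐ[volume] fun x => M - toL2 f x := by
    refine ae_nonneg_of_forall_setIntegral_nonneg_of_sigmaFinite
      (fun s h1 h2 => (hconst s h2).sub (hint s h1 h2)) fun s h1 h2 => ?_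
    rw [integral_sub (hconst s h2) (hint s h1 h2), setIntegral_const]
    have := (abs_le.1 (abs_setIntegral_le f h1 h2.ne)).2
    simp only [Measure.real, smul_eq_mul]
    linarith
  have h2 : 0 ≤ᵐ[volume] fun x => M + toL2 f x := by
    refine ae_nonneg_of_forall_setIntegral_nonneg_of_sigmaFinite
      (fun s h1 h2 => (hconst s h2).add (hint s h1 h2)) fun s h1 h2 => ?_
    rw [integral_add (hconst s h2) (hint s h1 h2), setIntegral_const]
    have := (abs_le.1 (abs_setIntegral_le f h1 h2.ne)).1
    simp only [Measure.real, smul_eq_mul]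
    linarith
  filter_upwards [h1, h2] with x h1 h2
  simp only [Pi.zero_apply] at h1 h2
  exact abs_le.2 ⟨by linarith, by linarith⟩

theorem ae_abs_le_two_mul (f : H1) : ∀ᵐ x, |toL2 f x| ≤ 2 * ‖f‖ := by
  filter_upwards [ae_abs_le f] with x hx
  linarith [norm_toL2_le f, norm_wd_le f]

/-! ### The nonlinearity and the damping operator -/

/-- The class of `|u|^p`. -/
def nonlin (p : ℝ) (u : H1) : L2 := cls fun x => |toL2 u x| ^ p

theorem abs_rpow_sub_rpow_le {p : ℝ} (hp : 1 < p) {M x y : ℝ} (hx : |x| ≤ M) (hy : |y| ≤ M) :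
    |(|x| ^ p - |y| ^ p)| ≤ p * M ^ (p - 1) * |x - y| := by
  have h1 : ∀ z ∈ Icc 0 M, HasDerivWithinAt (fun z : ℝ => z ^ p) (p * z ^ (p - 1)) (Icc 0 M) z :=
    fun z _ => (Real.hasDerivAt_rpow_const (Or.inr hp.le)).hasDerivWithinAt
  have h2 : ∀ z ∈ Icc 0 M, ‖p * z ^ (p - 1)‖ ≤ p * M ^ (p - 1) := by
    intro z hz
    have := Real.rpow_nonneg hz.1 (p - 1)
    rw [Real.norm_eq_abs, abs_of_nonneg (by positivity)]
    gcongr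
    exacts [hz.1, hz.2]
  have h3 := (convex_Icc (0 : ℝ) M).norm_image_sub_le_of_norm_hasDerivWithin_le h1 h2
    ⟨abs_nonneg y, hy⟩ ⟨abs_nonneg x, hx⟩
  rw [Real.norm_eq_abs, Real.norm_eq_abs] at h3
  have hM : 0 ≤ M := (abs_nonneg x).trans hx
  refine h3.trans (mul_le_mul_of_nonneg_left ?_ (by positivity))
  exact abs_abs_sub_abs_le_abs_sub x y

theorem memLp_nonlin {p : ℝ} (hp : 1 < p) (u : H1) :
    MemLp (fun x => |toL2 u x| ^ p) 2 volume := by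
  refine MemLp.of_le_mul (c := p * (2 * ‖u‖) ^ (p - 1)) (Lp.memLp (toL2 u)) ?_ ?_
  · have := (Lp.aestronglyMeasurable (toL2 u)).norm.aemeasurable
    exact (this.pow_const p).aestronglyMeasurable
  · filter_upwards [ae_abs_le_two_mul u] with x hx
    have := abs_rpow_sub_rpow_le hp hx (y := 0) (by simp)
    simpa [Real.zero_rpow (by linarith : p ≠ 0)] using this

theorem coe_nonlin {p : ℝ} (hp : 1 < p) (u : H1) :
    nonlin p u =ᵐ[volume] fun x => |toL2 u x| ^ p := coe_cls (memLp_nonlin hp u)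

/-- Both functions are bounded by 2M almost everywhere, and on that range |z|^p is Lipschitz with
constant p (2M)^(p-1). -/
theorem norm_nonlin_sub_le {p : ℝ} (hp : 1 < p) {M : ℝ} {u v : H1} (hu : ‖u‖ ≤ M) (hv : ‖v‖ ≤ M) :
    ‖nonlin p u - nonlin p v‖ ≤ p * (2 * M) ^ (p - 1) * ‖u - v‖ := by
  have hM : 0 ≤ M := (norm_nonneg _).trans hu
  refine (Lp.norm_le_mul_norm_of_ae_le_mul (g := toL2 (u - v)) (c := p * (2 * M) ^ (p - 1)) ?_).trans ?_
  · rw [toL2_sub]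
    filter_upwards [coe_nonlin hp u, coe_nonlin hp v, ae_abs_le_two_mul u, ae_abs_le_two_mul v,
      Lp.coeFn_sub (nonlin p u) (nonlin p v), Lp.coeFn_sub (toL2 u) (toL2 v)] with x h1 h2 h3 h4 h5 h6
    rw [h5, h6, Pi.sub_apply, Pi.sub_apply, h1, h2]
    exact abs_rpow_sub_rpow_le hp (h3.trans (by linarith)) (h4.trans (by linarith))
  · gcongr
    exact norm_toL2_le _

theorem nonlin_zero {p : ℝ} (hp : 1 < p) : nonlin p 0 = 0 := by
  apply Lp.ext
  filter_upwards [coe_nonlin hp 0, Lp.coeFn_zero ℝ 2 (volume : Measure ℝ)] with x h1 h2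
  rw [h1, toL2_zero, h2]
  simp [Real.zero_rpow (by linarith : p ≠ 0)]

theorem continuous_nonlin {p : ℝ} (hp : 1 < p) : Continuous (nonlin p) := by
  rw [continuous_iff_continuousAt]
  intro u
  rw [ContinuousAt, tendsto_iff_norm_sub_tendsto_zero]
  have h : Tendsto (fun v => p * (2 * (‖u‖ + 1)) ^ (p - 1) * ‖v - u‖) (𝓝 u) (𝓝 0) := by
    have : Continuous fun v => p * (2 * (‖u‖ + 1)) ^ (p - 1) * ‖v - u‖ := by fun_prop
    simpa using this.tendsto u
  refine squeeze_zero' (Eventually.of_forall fun _ => norm_nonneg _) ?_ h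
  filter_upwards [Metric.ball_mem_nhds u one_pos] with v hv
  refine norm_nonlin_sub_le hp ?_ (by linarith)
  rw [Metric.mem_ball, dist_eq_norm] at hv
  linarith [norm_le_norm_add_norm_sub' v u]

/-- Multiplication by a bounded function. -/
def mulL2 (f : ℝ → ℝ) (v : L2) : L2 := cls fun x => f x * v x

section mul

variable {f g : ℝ → ℝ} {C : ℝ}

theorem memLp_mulL2 (hf : Continuous f) (hb : ∀ x, |f x| ≤ C) (v : L2) :
    MemLp (fun x => f x * v x) 2 volume := by
  refine MemLp.of_le_mul (c := C) (Lp.memLp v)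
    (hf.aestronglyMeasurable.mul (Lp.aestronglyMeasurable v)) (Eventually.of_forall fun x => ?_)
  rw [norm_mul]
  gcongr
  exact hb x

theorem coe_mulL2 (hf : Continuous f) (hb : ∀ x, |f x| ≤ C) (v : L2) :
    mulL2 f v =ᵐ[volume] fun x => f x * v x := coe_cls (memLp_mulL2 hf hb v)

theorem norm_mulL2_le (hf : Continuous f) (hb : ∀ x, |f x| ≤ C) (v : L2) :
    ‖mulL2 f v‖ ≤ C * ‖v‖ := by
  refine Lp.norm_le_mul_norm_of_ae_le_mul ?_
  filter_upwards [coe_mulL2 hf hb v] with x hx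
  rw [hx, norm_mul]
  gcongr
  exact hb x

theorem mulL2_sub (hf : Continuous f) (hb : ∀ x, |f x| ≤ C) (v w : L2) :
    mulL2 f (v - w) = mulL2 f v - mulL2 f w := by
  rw [mulL2, mulL2, mulL2, ← cls_sub (memLp_mulL2 hf hb v) (memLp_mulL2 hf hb w)]
  refine (eq_cls ?_)
  filter_upwards [coe_mulL2 hf hb (v - w), Lp.coeFn_sub v w] with x h1 h2
  rw [← mulL2, h1, h2, Pi.sub_apply]
  ring

theorem norm_mulL2_sub_mulL2_le {C' : ℝ} (hf : Continuous f) (hb : ∀ x, |f x| ≤ C)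
    (hg : Continuous g) (hb' : ∀ x, |g x| ≤ C) (hfg : ∀ x, |f x - g x| ≤ C') (v : L2) :
    ‖mulL2 f v - mulL2 g v‖ ≤ C' * ‖v‖ := by
  refine Lp.norm_le_mul_norm_of_ae_le_mul ?_
  filter_upwards [coe_mulL2 hf hb v, coe_mulL2 hg hb' v, Lp.coeFn_sub (mulL2 f v) (mulL2 g v)]
    with x h1 h2 h3
  rw [h3, Pi.sub_apply, h1, h2, ← sub_mul, norm_mul]
  gcongr
  exact hfg x

end mul

/-! ### The primitive of translations -/

theorem HasWeakDeriv.half_integral_shift (t : ℝ) (A : L2) :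
    HasWeakDeriv ((1 / 2 : ℝ) • ∫ τ in (0 : ℝ)..t, shift τ A) ((1 / 2 : ℝ) • (shift t A - A)) :=
  (hasWeakDeriv_integral_shift t A).smul _

/-- The operator `A ↦ ½ ∫₀ᵗ A(· + τ) dτ` from `L²(ℝ)` to `H¹(ℝ)`. -/
def prim (t : ℝ) : L2 →L[ℝ] H1 :=
  LinearMap.mkContinuous
    { toFun := fun A => mkH1 _ _ (HasWeakDeriv.half_integral_shift t A)
      map_add' := fun A B => by
        apply H1.ext
        · simp only [toL2_mkH1, toL2_add, map_add]
          rw [intervalIntegral.integral_add ((continuous_shift_left A).intervalIntegrable _ _)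
            ((continuous_shift_left B).intervalIntegrable _ _), smul_add]
        · simp only [wd_mkH1, wd_add, map_add]
          module
      map_smul' := fun c A => by
        apply H1.ext
        · simp only [toL2_mkH1, toL2_smul, map_smul, RingHom.id_apply]
          rw [intervalIntegral.integral_smul, smul_comm]
        · simp only [wd_mkH1, wd_smul, map_smul, RingHom.id_apply]
          module } (|t| + 1) fun A => by
    refine (norm_H1_le _).trans ?_
    simp only [LinearMap.coe_mk, AddHom.coe_mk, toL2_mkH1, wd_mkH1]
    have h1 : ‖∫ τ in (0 : ℝ)..t, shift τ A‖ ≤ ‖A‖ * |t - 0| :=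
      intervalIntegral.norm_integral_le_of_norm_le_const fun τ _ => ((shift τ).norm_map A).le
    have h2 : ‖shift t A - A‖ ≤ ‖A‖ + ‖A‖ := by
      refine (norm_sub_le _ _).trans ?_
      rw [(shift t).norm_map]
    rw [norm_smul, norm_smul]
    rw [sub_zero] at h1
    norm_num
    nlinarith [norm_nonneg A, abs_nonneg t]

theorem toL2_prim (t : ℝ) (A : L2) :
    toL2 (prim t A) = (1 / 2 : ℝ) • ∫ τ in (0 : ℝ)..t, shift τ A := rfl

theorem wd_prim (t : ℝ) (A : L2) : wd (prim t A) = (1 / 2 : ℝ) • (shift t A - A) := rfl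

theorem norm_prim_le (t : ℝ) (A : L2) : ‖prim t A‖ ≤ (|t| + 1) * ‖A‖ :=
  (prim t).le_of_opNorm_le (LinearMap.mkContinuous_norm_le _ (by positivity) _) A

theorem prim_zero (A : L2) : prim 0 A = 0 := by
  apply H1.ext
  · simp [toL2_prim]
  · simp [wd_prim, shift_zero]

/-- The substitution τ ↦ τ - t turns ∫₀ᵗ into an integral over (-t, 0). It converts the terms
produced by differentiating d'Alembert's formula into those of `waveBack`. -/
theorem prim_shift_neg (t : ℝ) (A : L2) : prim t (shift (-t) A) = - prim (-t) A := by
  rw [← sub_eq_zero, sub_neg_eq_add]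
  apply H1.ext
  · simp only [toL2_add, toL2_prim, shift_shift, toL2_zero]
    have h1 : ∫ τ in (0 : ℝ)..t, shift (τ + -t) A = ∫ τ in (-t)..0, shift τ A := by
      rw [intervalIntegral.integral_comp_add_right (fun τ => shift τ A)]
      simp
    rw [h1, intervalIntegral.integral_symm, smul_neg, neg_add_cancel]
  · simp only [wd_add, wd_prim, shift_shift_neg, wd_zero]
    module

theorem hasDerivAt_toL2_prim (t : ℝ) (A : L2) :
    HasDerivAt (fun t => toL2 (prim t A)) ((1 / 2 : ℝ) • shift t A) t :=
  (intervalIntegral.integral_hasDerivAt_right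
      ((continuous_shift_left A).intervalIntegrable 0 t)
      ((continuous_shift_left A).stronglyMeasurableAtFilter _ _)
      (continuous_shift_left A).continuousAt).const_smul (1 / 2 : ℝ)

theorem continuous_prim_left (A : L2) : Continuous fun t => prim t A := by
  apply continuous_H1
  · exact continuous_iff_continuousAt.2 fun t => (hasDerivAt_toL2_prim t A).continuousAt
  · simp only [wd_prim]
    exact ((continuous_shift_left A).sub continuous_const).const_smul (1 / 2 : ℝ)

/-! ### Maximal solutions of ordinary differential equations in Banach spaces -/

section ODE

variable {X : Type*} [NormedAddCommGroup X] [NormedSpace ℝ X]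

/-- `w` solves `w' = Φ(t, w)` on `[0,T)`. -/
def IsODESol (Φ : ℝ → X → X) (T : EReal) (w : ℝ → X) : Prop :=
  ∀ t : ℝ, 0 ≤ t → (t : EReal) < T → HasDerivWithinAt w (Φ t (w t)) (Ici 0) t

/-- `Φ` is continuous in time, vanishes at the origin, and is Lipschitz continuous on bounded
sets. -/
structure IsLocLip (Φ : ℝ → X → X) : Prop where
  cont : ∀ x, Continuous fun t => Φ t x
  zero : ∀ t, Φ t 0 = 0
  lip : ∀ M T : ℝ, ∃ K : NNReal, ∀ t, 0 ≤ t → t ≤ T → ∀ x y, ‖x‖ ≤ M → ‖y‖ ≤ M →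
    ‖Φ t x - Φ t y‖ ≤ K * ‖x - y‖

variable {Φ : ℝ → X → X}

theorem IsODESol.mono {T T' : EReal} {w : ℝ → X} (h : IsODESol Φ T w) (hT : T' ≤ T) :
    IsODESol Φ T' w := fun t ht ht' => h t ht (ht'.trans_le hT)

theorem IsODESol.continuousOn {T : EReal} {w : ℝ → X} (h : IsODESol Φ T w) :
    ContinuousOn w (timeInterval T) := fun t ht =>
  (h t ht.1 ht.2).continuousWithinAt.mono fun _ hs => hs.1

theorem IsODESol.unique (hΦ : IsLocLip Φ) {T : EReal} {w v : ℝ → X} (hw : IsODESol Φ T w)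
    (hv : IsODESol Φ T v) (h0 : w 0 = v 0) {t : ℝ} (ht : 0 ≤ t) (ht' : (t : EReal) < T) :
    w t = v t := by
  have hlt : ∀ s, s ≤ t → (s : EReal) < T := fun s hs => (EReal.coe_le_coe_iff.2 hs).trans_lt ht'
  have hwc : ContinuousOn w (Icc 0 t) := hw.continuousOn.mono fun s hs => ⟨hs.1, hlt s hs.2⟩
  have hvc : ContinuousOn v (Icc 0 t) := hv.continuousOn.mono fun s hs => ⟨hs.1, hlt s hs.2⟩
  obtain ⟨M₁, hM₁⟩ := isCompact_Icc.exists_bound_of_continuousOn hwc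
  obtain ⟨M₂, hM₂⟩ := isCompact_Icc.exists_bound_of_continuousOn hvc
  obtain ⟨K, hK⟩ := hΦ.lip (max M₁ M₂) t
  -- Both solutions stay in one ball up to time t. Clamping the time to `[0, t]` makes the Lipschitz
  -- bound valid for every s.
  refine ODE_solution_unique_of_mem_Icc_right (v := fun s x => Φ (max 0 (min s t)) x) (K := K)
    (s := fun _ => Metric.closedBall 0 (max M₁ M₂)) (a := 0) (b := t) ?_ hwc ?_ ?_ hvc ?_ ?_ h0
    ⟨ht, le_rfl⟩
  · intro s _
    refine LipschitzOnWith.of_dist_le_mul fun x hx y hy => ?_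
    rw [mem_closedBall_zero_iff] at hx hy
    rw [dist_eq_norm, dist_eq_norm]
    exact hK _ (le_max_left _ _) (max_le ht (min_le_right _ _)) x y hx hy
  · intro s hs
    rw [min_eq_left hs.2.le, max_eq_right hs.1]
    exact (hw s hs.1 (hlt s hs.2.le)).mono (Ici_subset_Ici.2 hs.1)
  · intro s hs
    exact mem_closedBall_zero_iff.2 ((hM₁ s ⟨hs.1, hs.2.le⟩).trans (le_max_left _ _))
  · intro s hs
    rw [min_eq_left hs.2.le, max_eq_right hs.1]
    exact (hv s hs.1 (hlt s hs.2.le)).mono (Ici_subset_Ici.2 hs.1)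
  · intro s hs
    exact mem_closedBall_zero_iff.2 ((hM₂ s ⟨hs.1, hs.2.le⟩).trans (le_max_right _ _))

/-- Gluing of a solution on `[0,T)` with a solution on `[t,t+τ]`. -/
theorem IsODESol.glue {T : EReal} {w v : ℝ → X} (hw : IsODESol Φ T w) {t τ : ℝ} (ht : 0 ≤ t)
    (htT : (t : EReal) < T) (hτ : 0 < τ) (hv0 : v t = w t)
    (hv : ∀ s ∈ Icc t (t + τ), HasDerivWithinAt v (Φ s (v s)) (Icc t (t + τ)) s) :
    IsODESol Φ ((t + τ : ℝ) : EReal) (fun s => if s < t then w s else v s) := by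
  intro s hs0 hs1
  rw [EReal.coe_lt_coe_iff] at hs1
  change HasDerivWithinAt _ (Φ s (if s < t then w s else v s)) _ _
  rcases lt_trichotomy s t with h | h | h
  · rw [if_pos h]
    refine (hw s hs0 ((EReal.coe_lt_coe_iff.2 h).trans htT)).congr_of_eventuallyEq ?_ (if_pos h)
    filter_upwards [mem_nhdsWithin_of_mem_nhds (Iio_mem_nhds h)] with r hr
    exact if_pos hr
  · subst h
    rw [if_neg (lt_irrefl _)]
    have h1 : HasDerivWithinAt (fun r => if r < s then w r else v r) (Φ s (v s)) (Ico 0 s) s := by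
      have h2 := (hw s hs0 htT).mono (fun r hr => hr.1 : Ico 0 s ⊆ Ici 0)
      rw [← hv0] at h2
      exact h2.congr (fun r hr => if_pos hr.2) (by rw [if_neg (lt_irrefl _), hv0])
    have h2 : HasDerivWithinAt (fun r => if r < s then w r else v r) (Φ s (v s)) (Icc s (s + τ)) s :=
      (hv s ⟨le_rfl, by linarith⟩).congr (fun r hr => if_neg (not_lt.2 hr.1))
        (if_neg (lt_irrefl _))
    refine (h1.union h2).mono_of_mem_nhdsWithin ?_
    filter_upwards [self_mem_nhdsWithin, mem_nhdsWithin_of_mem_nhds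
      (Iio_mem_nhds (by linarith : s < s + τ))] with r hr hr'
    rcases lt_or_ge r s with h | h
    · exact Or.inl ⟨hr, h⟩
    · exact Or.inr ⟨h, le_of_lt hr'⟩
  · rw [if_neg (not_lt.2 h.le)]
    have h1 := (hv s ⟨h.le, hs1.le⟩).hasDerivAt (Icc_mem_nhds h hs1)
    refine (h1.congr_of_eventuallyEq ?_).hasDerivWithinAt
    filter_upwards [Ioi_mem_nhds h] with r hr
    exact if_neg (not_lt.2 (le_of_lt hr))

variable [CompleteSpace X]

/-- Local existence, on a time interval whose length depends on the norm of the data only. -/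
theorem IsLocLip.exists_local (hΦ : IsLocLip Φ) (M T : ℝ) :
    ∃ τ : ℝ, 0 < τ ∧ ∀ t₀, 0 ≤ t₀ → t₀ ≤ T → ∀ x, ‖x‖ ≤ M →
      ∃ w : ℝ → X, w t₀ = x ∧ ∀ t ∈ Icc t₀ (t₀ + τ),
        HasDerivWithinAt w (Φ t (w t)) (Icc t₀ (t₀ + τ)) t := by
  obtain ⟨K, hK⟩ := hΦ.lip (|M| + 1) (T + 1)
  -- On the unit ball about x norms are at most |M| + 1, so the Lipschitz bound and `hΦ.zero` bound
  -- the speed by L. A time at most 1/(L+1) keeps the solution in that ball, whatever x is.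
  set L : NNReal := K * Real.toNNReal (|M| + 1) with hL
  have hτp : (0 : ℝ) < 1 / (L + 1) := by positivity
  refine ⟨min 1 (1 / (L + 1)), lt_min one_pos hτp, fun t₀ h0 h1 x hx => ?_⟩
  set τ : ℝ := min 1 (1 / (L + 1)) with hτ
  have hτ0 : 0 < τ := lt_min one_pos hτp
  have hball : ∀ y ∈ Metric.closedBall x ((1 : NNReal) : ℝ), ‖y‖ ≤ |M| + 1 := by
    intro y hy
    rw [Metric.mem_closedBall, dist_eq_norm, NNReal.coe_one] at hy
    have := norm_le_norm_add_norm_sub' y x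
    linarith [le_abs_self M]
  have hPL : IsPicardLindelof Φ (tmin := t₀) (tmax := t₀ + τ) ⟨t₀, le_rfl, by linarith⟩ x 1 0 L K := by
    refine ⟨?_, ?_, ?_, ?_⟩
    · intro t ht
      refine LipschitzOnWith.of_dist_le_mul fun y hy z hz => ?_
      rw [dist_eq_norm, dist_eq_norm]
      exact hK t (h0.trans ht.1) (by linarith [ht.2, min_le_left (1 : ℝ) (1 / (L + 1))]) y z
        (hball y hy) (hball z hz)
    · intro y _
      exact (hΦ.cont y).continuousOn
    · intro t ht y hy
      have := hK t (h0.trans ht.1) (by linarith [ht.2, min_le_left (1 : ℝ) (1 / (L + 1))]) y 0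
        (hball y hy) (by simp; positivity)
      rw [hΦ.zero, sub_zero, sub_zero] at this
      refine this.trans ?_
      rw [hL, NNReal.coe_mul, Real.coe_toNNReal _ (by positivity)]
      exact mul_le_mul_of_nonneg_left (hball y hy) K.2
    · have h2 : τ ≤ 1 / (L + 1) := min_le_right _ _
      simp only [add_sub_cancel_left, sub_self, NNReal.coe_one, NNReal.coe_zero, sub_zero]
      rw [max_eq_left hτ0.le]
      calc (L : ℝ) * τ ≤ L * (1 / (L + 1)) := by gcongr
        _ ≤ 1 := by
          rw [mul_one_div, div_le_one (by positivity)]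
          linarith
  exact hPL.exists_eq_forall_mem_Icc_hasDerivWithinAt₀

/-- The maximal solution is global, or its norm tends to infinity in finite time. -/
theorem IsLocLip.exists_maximal (hΦ : IsLocLip Φ) (x : X) :
    (∃ w : ℝ → X, w 0 = x ∧ IsODESol Φ ⊤ w) ∨
    ∃ T : ℝ, 0 < T ∧ ∃ w : ℝ → X, w 0 = x ∧ IsODESol Φ T w ∧
      Tendsto (fun t => ‖w t‖) (𝓝[<] T) atTop ∧
      ∀ (T' : ℝ) (v : ℝ → X), 0 < T' → v 0 = x → IsODESol Φ T' v → T' ≤ T := by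
  classical
  set A : Set ℝ := {T | 0 < T ∧ ∃ w : ℝ → X, w 0 = x ∧ IsODESol Φ T w} with hA
  have hne : A.Nonempty := by
    obtain ⟨τ, hτ, h⟩ := hΦ.exists_local ‖x‖ 0
    obtain ⟨w, hw, hw'⟩ := h 0 le_rfl le_rfl x le_rfl
    rw [zero_add] at hw'
    refine ⟨τ, hτ, w, hw, fun t ht ht' => (hw' t ⟨ht, (EReal.coe_lt_coe_iff.1 ht').le⟩).mono_of_mem_nhdsWithin ?_⟩
    filter_upwards [self_mem_nhdsWithin, mem_nhdsWithin_of_mem_nhds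
      (Iio_mem_nhds (EReal.coe_lt_coe_iff.1 ht'))] with r hr hr'
    exact ⟨hr, le_of_lt hr'⟩
  choose! u hu0 hu using fun T (hT : T ∈ A) => hT.2
  -- Solutions on different intervals agree by uniqueness, so the choice of an interval containing t
  -- is immaterial.
  set W : ℝ → X := fun t => if h : ∃ T ∈ A, t < T then u h.choose t else x with hW
  have hWeq : ∀ T ∈ A, ∀ t, 0 ≤ t → t < T → W t = u T t := by
    intro T hT t ht htT
    have h : ∃ T ∈ A, t < T := ⟨T, hT, htT⟩
    have hc := h.choose_spec
    have : W t = u h.choose t := dif_pos h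
    rw [this]
    refine IsODESol.unique hΦ (T := ((min h.choose T : ℝ) : EReal)) ((hu _ hc.1).mono ?_)
      ((hu T hT).mono ?_) ?_ ht ?_
    · exact EReal.coe_le_coe_iff.2 (min_le_left _ _)
    · exact EReal.coe_le_coe_iff.2 (min_le_right _ _)
    · rw [hu0 _ hc.1, hu0 T hT]
    · exact EReal.coe_lt_coe_iff.2 (lt_min hc.2 htT)
  have hWd : ∀ T ∈ A, ∀ t, 0 ≤ t → t < T → HasDerivWithinAt W (Φ t (W t)) (Ici 0) t := by
    intro T hT t ht htT
    rw [hWeq T hT t ht htT]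
    refine ((hu T hT) t ht (EReal.coe_lt_coe_iff.2 htT)).congr_of_eventuallyEq ?_
      (hWeq T hT t ht htT)
    filter_upwards [self_mem_nhdsWithin, mem_nhdsWithin_of_mem_nhds (Iio_mem_nhds htT)] with r hr hr'
    exact hWeq T hT r hr hr'
  have hW0 : W 0 = x := by
    obtain ⟨T, hT⟩ := hne
    rw [hWeq T hT 0 le_rfl hT.1, hu0 T hT]
  by_cases hbdd : BddAbove A
  · right
    set Ts := sSup A with hTs
    have hpos : 0 < Ts := by
      obtain ⟨T, hT⟩ := hne
      exact hT.1.trans_le (le_csSup hbdd hT)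
    have hsol : IsODESol Φ Ts W := by
      intro t ht htT
      obtain ⟨T, hT, htT'⟩ := exists_lt_of_lt_csSup hne (EReal.coe_lt_coe_iff.1 htT)
      exact hWd T hT t ht htT'
    refine ⟨Ts, hpos, W, hW0, hsol, ?_, fun T' v h1 h2 h3 => le_csSup hbdd ⟨h1, v, h2, h3⟩⟩
    -- Otherwise the norm is below some M at times arbitrarily close to `Ts`. Restarting within τ/2
    -- of `Ts`, with the existence time τ that belongs to M, continues the solution past `Ts`.
    by_contra hnt
    rw [tendsto_atTop] at hnt
    push Not at hnt
    obtain ⟨M, hM⟩ := hnt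
    obtain ⟨τ, hτ, hloc⟩ := hΦ.exists_local M Ts
    have hev : ∀ᶠ t in 𝓝[<] Ts, 0 < t ∧ Ts - τ / 2 < t ∧ t < Ts := by
      filter_upwards [self_mem_nhdsWithin, mem_nhdsWithin_of_mem_nhds (Ioi_mem_nhds hpos),
        mem_nhdsWithin_of_mem_nhds (Ioi_mem_nhds (by linarith : Ts - τ / 2 < Ts))] with t h1 h2 h3
      exact ⟨h2, h3, h1⟩
    obtain ⟨t, ht1, ht2, ht3, ht4⟩ := (hM.and_eventually hev).exists
    obtain ⟨v, hv, hv'⟩ := hloc t ht2.le ht4.le (W t) ht1.le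
    have hglue := hsol.glue ht2.le (EReal.coe_lt_coe_iff.2 ht4) hτ hv hv'
    have : t + τ ∈ A := ⟨by linarith, _, by simp only [if_pos ht2, hW0], hglue⟩
    linarith [le_csSup hbdd this]
  · left
    refine ⟨W, hW0, fun t ht _ => ?_⟩
    rw [not_bddAbove_iff] at hbdd
    obtain ⟨T, hT, htT⟩ := hbdd t
    exact hWd T hT t ht htT

end ODE

/-! ### The wave group and the ordinary differential equation in `H¹ × L²` -/

/-- Strong continuity and a locally bounded norm suffice for joint continuity; translations are not
continuous in operator norm. -/
theorem continuous_clm_family {X Y : Type*} [NormedAddCommGroup X] [NormedSpace ℝ X]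
    [NormedAddCommGroup Y] [NormedSpace ℝ Y] {T : ℝ → X →L[ℝ] Y} {C : ℝ → ℝ} (hC : Continuous C)
    (hT : ∀ t x, ‖T t x‖ ≤ C t * ‖x‖) (hs : ∀ x, Continuous fun t => T t x) :
    Continuous fun q : ℝ × X => T q.1 q.2 := by
  rw [continuous_iff_continuousAt]
  intro q
  rw [ContinuousAt, tendsto_iff_norm_sub_tendsto_zero]
  have h : Tendsto (fun r : ℝ × X => C r.1 * ‖r.2 - q.2‖ + ‖T r.1 q.2 - T q.1 q.2‖) (𝓝 q) (𝓝 0) := by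
    have h1 : Continuous fun r : ℝ × X => C r.1 * ‖r.2 - q.2‖ + ‖T r.1 q.2 - T q.1 q.2‖ := by
      have := hs q.2
      fun_prop
    simpa using h1.tendsto q
  refine squeeze_zero (fun _ => norm_nonneg _) (fun r => ?_) h
  have e : T r.1 r.2 - T q.1 q.2 = T r.1 (r.2 - q.2) + (T r.1 q.2 - T q.1 q.2) := by
    rw [map_sub]; abel
  rw [e]
  exact (norm_add_le _ _).trans (add_le_add_left (hT _ _) _)

/-- A product rule for a family differentiable only on the one vector `R t`: the slope splits into
that of τ ↦ T τ (R t) and T τ applied to the slope of R, and joint continuity gives the limit of the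
latter. -/
theorem hasDerivWithinAt_clm_family {X Y : Type*} [NormedAddCommGroup X] [NormedSpace ℝ X]
    [NormedAddCommGroup Y] [NormedSpace ℝ Y] {T : ℝ → X →L[ℝ] Y} {R : ℝ → X} {R' : X} {A : Y}
    {s : Set ℝ} {t : ℝ} (hT : Continuous fun q : ℝ × X => T q.1 q.2)
    (h : HasDerivWithinAt (fun τ => T τ (R t)) A s t) (hR : HasDerivWithinAt R R' s t) :
    HasDerivWithinAt (fun τ => T τ (R τ)) (A + T t R') s t := by
  rw [hasDerivWithinAt_iff_tendsto_slope] at *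
  have h1 : Tendsto (fun τ => T τ (slope R t τ)) (𝓝[s \ {t}] t) (𝓝 (T t R')) :=
    (hT.tendsto (t, R')).comp ((tendsto_nhdsWithin_of_tendsto_nhds tendsto_id).prodMk_nhds hR)
  refine (h.add h1).congr fun τ => ?_
  simp only [slope, vsub_eq_sub, map_smul, map_sub]
  rw [← smul_add]
  congr 1
  abel

theorem continuous_prim : Continuous fun q : ℝ × L2 => prim q.1 q.2 :=
  continuous_clm_family (C := fun t => |t| + 1) (by fun_prop) norm_prim_le continuous_prim_left

/-- The Riemann invariant `u_t + u_x`. -/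
def riemL : H1 × L2 →L[ℝ] L2 :=
  ContinuousLinearMap.snd ℝ H1 L2 + wdL.comp (ContinuousLinearMap.fst ℝ H1 L2)

/-- The Riemann invariant `u_t - u_x`. -/
def riemR : H1 × L2 →L[ℝ] L2 :=
  ContinuousLinearMap.snd ℝ H1 L2 - wdL.comp (ContinuousLinearMap.fst ℝ H1 L2)

theorem riemL_apply (w : H1 × L2) : riemL w = w.2 + wd w.1 := rfl
theorem riemR_apply (w : H1 × L2) : riemR w = w.2 - wd w.1 := rfl

theorem norm_riemL_le (w : H1 × L2) : ‖riemL w‖ ≤ 2 * ‖w‖ := by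
  rw [riemL_apply]
  linarith [norm_add_le w.2 (wd w.1), norm_wd_le w.1, norm_fst_le w, norm_snd_le w]

theorem norm_riemR_le (w : H1 × L2) : ‖riemR w‖ ≤ 2 * ‖w‖ := by
  rw [riemR_apply]
  linarith [norm_sub_le w.2 (wd w.1), norm_wd_le w.1, norm_fst_le w, norm_snd_le w]

/-- The first component of the free wave evolution. -/
def waveFst (t : ℝ) : H1 × L2 →L[ℝ] H1 :=
  ContinuousLinearMap.fst ℝ H1 L2 + (prim t).comp riemL - (prim (-t)).comp riemR

/-- The second component of the free wave evolution. -/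
def waveSnd (t : ℝ) : H1 × L2 →L[ℝ] L2 :=
  (1 / 2 : ℝ) • ((shift t).toContinuousLinearMap.comp riemL
    + (shift (-t)).toContinuousLinearMap.comp riemR)

/-- The free wave evolution over the time `-t` of the state `(0, f)`. -/
def waveBack (t : ℝ) (f : L2) : H1 × L2 :=
  (prim (-t) f - prim t f, (1 / 2 : ℝ) • (shift (-t) f + shift t f))

theorem waveFst_apply (t : ℝ) (w : H1 × L2) :
    waveFst t w = w.1 + prim t (riemL w) - prim (-t) (riemR w) := rfl

theorem waveSnd_apply (t : ℝ) (w : H1 × L2) :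
    waveSnd t w = (1 / 2 : ℝ) • (shift t (riemL w) + shift (-t) (riemR w)) := rfl

theorem norm_waveFst_le (t : ℝ) (w : H1 × L2) : ‖waveFst t w‖ ≤ (4 * |t| + 5) * ‖w‖ := by
  rw [waveFst_apply]
  have h1 := norm_prim_le t (riemL w)
  have h2 := norm_prim_le (-t) (riemR w)
  rw [abs_neg] at h2
  have h3 := mul_le_mul_of_nonneg_left (norm_riemL_le w) (by positivity : 0 ≤ |t| + 1)
  have h4 := mul_le_mul_of_nonneg_left (norm_riemR_le w) (by positivity : 0 ≤ |t| + 1)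
  have h5 := norm_sub_le (w.1 + prim t (riemL w)) (prim (-t) (riemR w))
  have h6 := norm_add_le w.1 (prim t (riemL w))
  have h7 := norm_fst_le w
  linarith

theorem norm_waveSnd_le (t : ℝ) (w : H1 × L2) : ‖waveSnd t w‖ ≤ 2 * ‖w‖ := by
  rw [waveSnd_apply, norm_smul]
  have h1 := norm_add_le (shift t (riemL w)) (shift (-t) (riemR w))
  rw [(shift t).norm_map, (shift (-t)).norm_map] at h1
  have h2 := norm_riemL_le w
  have h3 := norm_riemR_le w
  norm_num
  linarith

theorem norm_waveBack_le (t : ℝ) (f : L2) : ‖waveBack t f‖ ≤ 2 * (|t| + 1) * ‖f‖ := by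
  rw [waveBack, Prod.norm_def, max_le_iff]
  have h1 := norm_prim_le t f
  have h2 := norm_prim_le (-t) f
  rw [abs_neg] at h2
  have h5 := norm_sub_le (prim (-t) f) (prim t f)
  refine ⟨by simp only; linarith, ?_⟩
  simp only
  rw [norm_smul]
  have h3 := norm_add_le (shift (-t) f) (shift t f)
  rw [(shift t).norm_map, (shift (-t)).norm_map] at h3
  norm_num
  nlinarith [norm_nonneg f, abs_nonneg t, mul_nonneg (norm_nonneg f) (abs_nonneg t)]

theorem waveBack_sub (t : ℝ) (f g : L2) : waveBack t (f - g) = waveBack t f - waveBack t g := by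
  simp only [waveBack, map_sub, Prod.mk_sub_mk]
  congr 1
  · abel
  · module

theorem waveBack_zero (t : ℝ) : waveBack t 0 = 0 := by
  have := waveBack_sub t 0 0
  rwa [sub_zero, sub_self] at this

theorem continuous_waveBack : Continuous fun q : ℝ × L2 => waveBack q.1 q.2 := by
  have hn : Continuous fun q : ℝ × L2 => (-q.1, q.2) := by fun_prop
  exact ((continuous_prim.comp hn).sub continuous_prim).prodMk
    (((continuous_shift.comp hn).add continuous_shift).const_smul (1 / 2 : ℝ))

/-- A damping coefficient that is bounded, with bounded time derivative. -/
structure IsDamping (a : ℝ → ℝ → ℝ) : Prop where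
  contDiff : IsC2 a
  bound : ∃ C, ∀ t x, 0 ≤ t → |a t x| ≤ C ∧ |dt a t x| ≤ C

/-- The right hand side `|u|^p - a v` of the wave equation. -/
def force (a : ℝ → ℝ → ℝ) (p t : ℝ) (u : H1) (v : L2) : L2 :=
  nonlin p u - mulL2 (a (max t 0)) v

/-- The vector field of the wave equation after conjugation with the free evolution. -/
def field (a : ℝ → ℝ → ℝ) (p t : ℝ) (w : H1 × L2) : H1 × L2 :=
  waveBack t (force a p t (waveFst t w) (waveSnd t w))

/-! ### Restrictions of C² functions to lines in the closed half-plane -/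

section IsC2

theorem IsC2.continuousOn {f : ℝ → ℝ → ℝ} (h : IsC2 f) :
    ContinuousOn (fun q : ℝ × ℝ => f q.1 q.2) (Ici 0 ×ˢ univ) := ContDiffOn.continuousOn h

theorem IsC2.continuous_right {f : ℝ → ℝ → ℝ} (h : IsC2 f) {t : ℝ} (ht : 0 ≤ t) :
    Continuous (f t) :=
  h.continuousOn.comp_continuous (f := fun x => (t, x)) (by fun_prop) fun x => ⟨ht, mem_univ _⟩

theorem IsC2.hasDerivWithinAt {f : ℝ → ℝ → ℝ} (h : IsC2 f) {t : ℝ} (ht : 0 ≤ t) (x : ℝ) :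
    HasDerivWithinAt (fun s => f s x) (dt f t x) (Ici 0) t := by
  have h1 : DifferentiableWithinAt ℝ (fun q : ℝ × ℝ => f q.1 q.2) (Ici 0 ×ˢ univ) (t, x) :=
    (h.differentiableOn two_ne_zero) (t, x) ⟨ht, mem_univ _⟩
  have h2 : DifferentiableWithinAt ℝ (fun s => f s x) (Ici 0) t :=
    DifferentiableWithinAt.comp (g := fun q : ℝ × ℝ => f q.1 q.2) (f := fun s : ℝ => (s, x))
      (t := Ici 0 ×ˢ univ) t h1
      (by fun_prop) fun s hs => ⟨hs, mem_univ _⟩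
  exact h2.hasDerivWithinAt

end IsC2

/-! ### Lipschitz bounds for the conjugated field, and its relation to mild solutions -/

section damping

variable {a : ℝ → ℝ → ℝ} {p : ℝ}

theorem IsDamping.abs_sub_le {a : ℝ → ℝ → ℝ} {C : ℝ} (ha : IsC2 a)
    (hC : ∀ t x, 0 ≤ t → |a t x| ≤ C ∧ |dt a t x| ≤ C) {s t : ℝ} (hs : 0 ≤ s) (ht : 0 ≤ t) (x : ℝ) :
    |a s x - a t x| ≤ C * |s - t| :=
  (convex_Ici (0 : ℝ)).norm_image_sub_le_of_norm_hasDerivWithin_le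
    (fun _ hr => ha.hasDerivWithinAt hr x) (fun r hr => (hC r x hr).2) ht hs

theorem continuous_mulL2_damping (ha : IsDamping a) :
    Continuous fun q : ℝ × L2 => mulL2 (a (max q.1 0)) q.2 := by
  obtain ⟨C, hC⟩ := ha.bound
  have hc : ∀ t : ℝ, Continuous (a (max t 0)) :=
    fun t => ha.contDiff.continuous_right (le_max_right _ _)
  have hb : ∀ t x : ℝ, |a (max t 0) x| ≤ C := fun t x => (hC _ x (le_max_right _ _)).1
  rw [continuous_iff_continuousAt]
  intro q
  rw [ContinuousAt, tendsto_iff_norm_sub_tendsto_zero]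
  have h : Tendsto (fun r : ℝ × L2 => C * ‖r.2 - q.2‖ + C * |max r.1 0 - max q.1 0| * ‖q.2‖)
      (𝓝 q) (𝓝 0) := by
    have h1 : Continuous fun r : ℝ × L2 =>
      C * ‖r.2 - q.2‖ + C * |max r.1 0 - max q.1 0| * ‖q.2‖ := by fun_prop
    simpa using h1.tendsto q
  refine squeeze_zero (fun _ => norm_nonneg _) (fun r => ?_) h
  have e : mulL2 (a (max r.1 0)) r.2 - mulL2 (a (max q.1 0)) q.2 =
      mulL2 (a (max r.1 0)) (r.2 - q.2) +
        (mulL2 (a (max r.1 0)) q.2 - mulL2 (a (max q.1 0)) q.2) := by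
    rw [mulL2_sub (hc _) (hb _)]; abel
  rw [e]
  refine (norm_add_le _ _).trans (add_le_add (norm_mulL2_le (hc _) (hb _) _) ?_)
  exact norm_mulL2_sub_mulL2_le (hc _) (hb _) (hc _) (hb _)
    (fun x => IsDamping.abs_sub_le ha.contDiff hC (le_max_right _ _) (le_max_right _ _) x) _

theorem continuous_force (ha : IsDamping a) (hp : 1 < p) :
    Continuous fun q : ℝ × H1 × L2 => force a p q.1 q.2.1 q.2.2 :=
  ((continuous_nonlin hp).comp (by fun_prop)).sub ((continuous_mulL2_damping ha).comp
    (by fun_prop : Continuous fun q : ℝ × H1 × L2 => (q.1, q.2.2)))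

/-- The free evolution and its inverse are bounded on bounded time intervals, the damping is a
bounded linear operator on L², and the power is Lipschitz on bounded sets of H¹. No derivative is
lost, as the conjugation has removed the generator. -/
theorem isLocLip_field (ha : IsDamping a) (hp : 1 < p) : IsLocLip (field a p) := by
  obtain ⟨C, hC⟩ := ha.bound
  have hC0 : 0 ≤ C := (abs_nonneg _).trans (hC 0 0 le_rfl).1
  have hc : ∀ t : ℝ, Continuous (a (max t 0)) :=
    fun t => ha.contDiff.continuous_right (le_max_right _ _)
  have hb : ∀ t x : ℝ, |a (max t 0) x| ≤ C := fun t x => (hC _ x (le_max_right _ _)).1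
  refine ⟨fun w => ?_, fun t => ?_, fun M T => ?_⟩
  · have h1 : Continuous fun t : ℝ => waveFst t w := by
      simp only [waveFst_apply]
      exact (continuous_const.add (continuous_prim_left _)).sub
        ((continuous_prim_left _).comp continuous_neg)
    have h2 : Continuous fun t : ℝ => waveSnd t w := by
      simp only [waveSnd_apply]
      exact ((continuous_shift_left _).add ((continuous_shift_left _).comp continuous_neg)).const_smul
        (1 / 2 : ℝ)
    have h3 : Continuous fun t : ℝ => ((t, waveFst t w, waveSnd t w) : ℝ × H1 × L2) :=
      continuous_id.prodMk (h1.prodMk h2)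
    have h4 : Continuous fun t : ℝ => force a p t (waveFst t w) (waveSnd t w) :=
      Continuous.comp (f := fun t : ℝ => ((t, waveFst t w, waveSnd t w) : ℝ × H1 × L2))
        (g := fun q : ℝ × H1 × L2 => force a p q.1 q.2.1 q.2.2) (continuous_force ha hp) h3
    exact Continuous.comp (f := fun t : ℝ => (t, force a p t (waveFst t w) (waveSnd t w)))
      (g := fun q : ℝ × L2 => waveBack q.1 q.2) continuous_waveBack (continuous_id.prodMk h4)
  · have h1 : mulL2 (a (max t 0)) 0 = 0 := by
      have := mulL2_sub (hc t) (hb t) 0 0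
      rwa [sub_zero, sub_self] at this
    rw [field, map_zero, map_zero, force, nonlin_zero hp, h1, sub_zero, waveBack_zero]
  · set B := (4 * |T| + 5) with hB
    set Kf := p * (2 * (B * |M|)) ^ (p - 1) * B + C * 2 with hKf
    have hKf0 : 0 ≤ Kf := by positivity
    refine ⟨Real.toNNReal (2 * (|T| + 1) * Kf), fun t ht htT x y hx hy => ?_⟩
    have hT : |t| ≤ |T| := by
      rw [abs_of_nonneg ht]; exact htT.trans (le_abs_self T)
    rw [Real.coe_toNNReal _ (by positivity), field, field, ← waveBack_sub]
    have hbd : ∀ z : H1 × L2, ‖waveFst t z‖ ≤ B * ‖z‖ := fun z =>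
      (norm_waveFst_le t z).trans (by rw [hB]; gcongr)
    have hbM : ∀ z : H1 × L2, ‖z‖ ≤ M → ‖waveFst t z‖ ≤ B * |M| := fun z hz =>
      (hbd z).trans (by gcongr; exact hz.trans (le_abs_self M))
    have h1 : ‖force a p t (waveFst t x) (waveSnd t x) - force a p t (waveFst t y) (waveSnd t y)‖
        ≤ Kf * ‖x - y‖ := by
      have e : force a p t (waveFst t x) (waveSnd t x) - force a p t (waveFst t y) (waveSnd t y)
          = (nonlin p (waveFst t x) - nonlin p (waveFst t y))
            - mulL2 (a (max t 0)) (waveSnd t (x - y)) := by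
        rw [map_sub, mulL2_sub (hc t) (hb t), force, force]; abel
      rw [e]
      refine (norm_sub_le _ _).trans ?_
      have h2 := norm_nonlin_sub_le hp (hbM x hx) (hbM y hy)
      have h3 := norm_mulL2_le (hc t) (hb t) (waveSnd t (x - y))
      have h4 := norm_waveSnd_le t (x - y)
      rw [← map_sub] at h2
      have h5 := mul_le_mul_of_nonneg_left (hbd (x - y))
        (by positivity : 0 ≤ p * (2 * (B * |M|)) ^ (p - 1))
      have h6 := mul_le_mul_of_nonneg_left h4 hC0
      rw [hKf]
      linarith
    calc _ ≤ 2 * (|t| + 1) * (Kf * ‖x - y‖) := (norm_waveBack_le _ _).trans (by gcongr)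
      _ ≤ 2 * (|T| + 1) * (Kf * ‖x - y‖) := by gcongr
      _ = _ := by ring

/-! ### Mild solutions -/

/-- `(u, v)` is a mild solution on `[0,T)`: `u_t = v`, and the equation holds along
characteristics. -/
structure IsMild (a : ℝ → ℝ → ℝ) (p : ℝ) (T : EReal) (u : ℝ → H1) (v : ℝ → L2) : Prop where
  deriv_fst : ∀ t : ℝ, 0 ≤ t → (t : EReal) < T →
    HasDerivWithinAt (fun t => toL2 (u t)) (v t) (Ici 0) t
  deriv_riemL : ∀ t : ℝ, 0 ≤ t → (t : EReal) < T →
    HasDerivWithinAt (fun t => shift (-t) (v t + wd (u t))) (shift (-t) (force a p t (u t) (v t)))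
      (Ici 0) t
  deriv_riemR : ∀ t : ℝ, 0 ≤ t → (t : EReal) < T →
    HasDerivWithinAt (fun t => shift t (v t - wd (u t))) (shift t (force a p t (u t) (v t)))
      (Ici 0) t

theorem hasDerivWithinAt_toL2_prim {R : ℝ → L2} {R' : L2} {s : Set ℝ} {t : ℝ}
    (hR : HasDerivWithinAt R R' s t) :
    HasDerivWithinAt (fun t => toL2 (prim t (R t)))
      ((1 / 2 : ℝ) • shift t (R t) + toL2 (prim t R')) s t :=
  hasDerivWithinAt_clm_family (T := fun t => toL2L.comp (prim t))
    (continuous_toL2.comp continuous_prim) (hasDerivAt_toL2_prim t (R t)).hasDerivWithinAt hR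

theorem hasDerivWithinAt_toL2_prim_neg {R : ℝ → L2} {R' : L2} {s : Set ℝ} {t : ℝ}
    (hR : HasDerivWithinAt R R' s t) :
    HasDerivWithinAt (fun t => toL2 (prim (-t) (R t)))
      (-((1 / 2 : ℝ) • shift (-t) (R t)) + toL2 (prim (-t) R')) s t := by
  have hc : Continuous fun q : ℝ × L2 => toL2 (prim (-q.1) q.2) :=
    continuous_toL2.comp (Continuous.comp (f := fun q : ℝ × L2 => (-q.1, q.2))
      (g := fun q : ℝ × L2 => prim q.1 q.2) continuous_prim (by fun_prop))
  refine hasDerivWithinAt_clm_family (T := fun t => toL2L.comp (prim (-t))) hc ?_ hR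
  have := HasDerivAt.scomp (g₁ := fun τ => toL2 (prim τ (R t))) t
    (hasDerivAt_toL2_prim (-t) (R t)) (hasDerivAt_neg t)
  exact (this.congr_deriv (by simp)).hasDerivWithinAt

/-- The Riemann invariants of the state are translates of those of w, so the equation for w is the
equation along characteristics. In the derivative of the first component the primitives of the force
cancel against the first component of the field, leaving exactly `waveSnd`. -/
theorem IsODESol.isMild {T : EReal} {w : ℝ → H1 × L2} (h : IsODESol (field a p) T w) :
    IsMild a p T (fun t => waveFst t (w t)) (fun t => waveSnd t (w t)) := by
  have hL : ∀ t, waveSnd t (w t) + wd (waveFst t (w t)) = shift t (riemL (w t)) := by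
    intro t
    simp only [waveFst_apply, waveSnd_apply, wd_add, wd_sub, wd_prim, riemL_apply, riemR_apply]
    module
  have hR : ∀ t, waveSnd t (w t) - wd (waveFst t (w t)) = shift (-t) (riemR (w t)) := by
    intro t
    simp only [waveFst_apply, waveSnd_apply, wd_add, wd_sub, wd_prim, riemL_apply, riemR_apply]
    module
  have dL : ∀ t : ℝ, 0 ≤ t → (t : EReal) < T → HasDerivWithinAt (fun t => riemL (w t))
      (shift (-t) (force a p t (waveFst t (w t)) (waveSnd t (w t)))) (Ici 0) t := by
    intro t ht htT
    refine (riemL.hasFDerivAt.comp_hasDerivWithinAt t (h t ht htT)).congr_deriv ?_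
    simp only [field, waveBack, riemL_apply, wd_sub, wd_prim]
    module
  have dR : ∀ t : ℝ, 0 ≤ t → (t : EReal) < T → HasDerivWithinAt (fun t => riemR (w t))
      (shift t (force a p t (waveFst t (w t)) (waveSnd t (w t)))) (Ici 0) t := by
    intro t ht htT
    refine (riemR.hasFDerivAt.comp_hasDerivWithinAt t (h t ht htT)).congr_deriv ?_
    simp only [field, waveBack, riemR_apply, wd_sub, wd_prim]
    module
  refine ⟨fun t ht htT => ?_, fun t ht htT => ?_, fun t ht htT => ?_⟩
  · have h1 := (toL2L.comp (ContinuousLinearMap.fst ℝ H1 L2)).hasFDerivAt.comp_hasDerivWithinAt t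
      (h t ht htT)
    have h2 := hasDerivWithinAt_toL2_prim (dL t ht htT)
    have h3 := hasDerivWithinAt_toL2_prim_neg (dR t ht htT)
    refine ((h1.add h2).sub h3).congr_deriv ?_
    rw [prim_shift_neg]
    have e := prim_shift_neg (-t) (force a p t (waveFst t (w t)) (waveSnd t (w t)))
    rw [neg_neg] at e
    rw [e]
    have e1 : (toL2L.comp (ContinuousLinearMap.fst ℝ H1 L2)) (field a p t (w t))
      = toL2 (prim (-t) (force a p t (waveFst t (w t)) (waveSnd t (w t))))
        - toL2 (prim t (force a p t (waveFst t (w t)) (waveSnd t (w t)))) := rfl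
    have e2 : ∀ z : H1, toL2 (-z) = - toL2 z := fun z => rfl
    rw [e1, e2, e2]
    rw [waveSnd_apply]
    module
  · refine (dL t ht htT).congr (fun s _ => ?_) ?_
    · simp only [hL, shift_neg_shift]
    · simp only [hL, shift_neg_shift]
  · refine (dR t ht htT).congr (fun s _ => ?_) ?_
    · simp only [hR, shift_shift_neg]
    · simp only [hR, shift_shift_neg]

/-- The conjugated state. -/
def conjState (u : ℝ → H1) (v : ℝ → L2) (t : ℝ) : H1 × L2 :=
  (u t - prim t (shift (-t) (v t + wd (u t))) + prim (-t) (shift t (v t - wd (u t))),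
    (1 / 2 : ℝ) • (shift (-t) (v t + wd (u t)) + shift t (v t - wd (u t))))

theorem wd_conjState (u : ℝ → H1) (v : ℝ → L2) (t : ℝ) : wd (conjState u v t).1 =
    (1 / 2 : ℝ) • (shift (-t) (v t + wd (u t)) - shift t (v t - wd (u t))) := by
  simp only [conjState, wd_add, wd_sub, wd_prim, shift_shift_neg, shift_neg_shift]
  module

theorem riemL_conjState (u : ℝ → H1) (v : ℝ → L2) (t : ℝ) :
    riemL (conjState u v t) = shift (-t) (v t + wd (u t)) := by
  rw [riemL_apply, wd_conjState]
  simp only [conjState]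
  module

theorem riemR_conjState (u : ℝ → H1) (v : ℝ → L2) (t : ℝ) :
    riemR (conjState u v t) = shift t (v t - wd (u t)) := by
  rw [riemR_apply, wd_conjState]
  simp only [conjState]
  module

theorem waveFst_conjState (u : ℝ → H1) (v : ℝ → L2) (t : ℝ) : waveFst t (conjState u v t) = u t := by
  rw [waveFst_apply, riemL_conjState, riemR_conjState]
  simp only [conjState]
  abel

theorem waveSnd_conjState (u : ℝ → H1) (v : ℝ → L2) (t : ℝ) : waveSnd t (conjState u v t) = v t := by
  rw [waveSnd_apply, riemL_conjState, riemR_conjState, shift_shift_neg, shift_neg_shift]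
  module

theorem conjState_zero (u : ℝ → H1) (v : ℝ → L2) : conjState u v 0 = (u 0, v 0) := by
  simp only [conjState, neg_zero, prim_zero, shift_zero, sub_zero, add_zero]
  congr 1
  module

theorem norm_conjState_le (u : ℝ → H1) (v : ℝ → L2) (t : ℝ) :
    ‖conjState u v t‖ ≤ (2 * |t| + 3) * (‖u t‖ + ‖v t‖) := by
  have h1 : ‖shift (-t) (v t + wd (u t))‖ ≤ ‖u t‖ + ‖v t‖ := by
    rw [(shift (-t)).norm_map]
    linarith [norm_add_le (v t) (wd (u t)), norm_wd_le (u t)]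
  have h2 : ‖shift t (v t - wd (u t))‖ ≤ ‖u t‖ + ‖v t‖ := by
    rw [(shift t).norm_map]
    linarith [norm_sub_le (v t) (wd (u t)), norm_wd_le (u t)]
  have h3 := norm_prim_le t (shift (-t) (v t + wd (u t)))
  have h4 := norm_prim_le (-t) (shift t (v t - wd (u t)))
  rw [abs_neg] at h4
  have h5 := mul_le_mul_of_nonneg_left h1 (by positivity : 0 ≤ |t| + 1)
  have h6 := mul_le_mul_of_nonneg_left h2 (by positivity : 0 ≤ |t| + 1)
  have h7 : 0 ≤ |t| * (‖u t‖ + ‖v t‖) := by positivity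
  rw [conjState, Prod.norm_def, max_le_iff]
  constructor
  · simp only
    have h8 := norm_add_le (u t - prim t (shift (-t) (v t + wd (u t))))
      (prim (-t) (shift t (v t - wd (u t))))
    have h9 := norm_sub_le (u t) (prim t (shift (-t) (v t + wd (u t))))
    linarith [norm_nonneg (v t)]
  · simp only
    rw [norm_smul, Real.norm_of_nonneg (by norm_num)]
    have h8 := norm_add_le (shift (-t) (v t + wd (u t))) (shift t (v t - wd (u t)))
    linarith [norm_nonneg (v t), norm_nonneg (u t)]

/-- The converse of `IsODESol.isMild`; it makes uniqueness for the differential equation available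
for every mild solution. Differentiability in H¹ is checked separately on the function and on its
weak derivative. -/
theorem IsMild.isODESol {T : EReal} {u : ℝ → H1} {v : ℝ → L2} (h : IsMild a p T u v) :
    IsODESol (field a p) T (conjState u v) := by
  intro t ht htT
  rw [field, waveFst_conjState, waveSnd_conjState]
  set f := force a p t (u t) (v t) with hf
  have dL := h.deriv_riemL t ht htT
  have dR := h.deriv_riemR t ht htT
  rw [← hf] at dL dR
  have e : conjState u v = fun t => ((conjState u v t).1, (conjState u v t).2) := rfl
  rw [e]
  refine HasDerivWithinAt.prodMk ?_ ?_
  · refine hasDerivWithinAt_H1 ?_ ?_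
    · have h2 := hasDerivWithinAt_toL2_prim dL
      have h3 := hasDerivWithinAt_toL2_prim_neg dR
      refine (((h.deriv_fst t ht htT).sub h2).add h3).congr_deriv ?_
      have e1 := prim_shift_neg t f
      have e := prim_shift_neg (-t) f
      rw [neg_neg] at e
      have e2 : ∀ z : H1, toL2 (-z) = - toL2 z := fun z => rfl
      rw [e, e1, e2, e2, shift_shift_neg, shift_neg_shift, toL2_sub]
      module
    · simp only [wd_conjState]
      refine ((dL.sub dR).const_smul (1 / 2 : ℝ)).congr_deriv ?_
      simp only [wd_sub, wd_prim]
      module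
  · exact (dL.add dR).const_smul (1 / 2 : ℝ)

end damping

/-! ### Calculus on `[0,∞) × ℝ` -/

/-- `f ∈ Cⁿ([0,∞) × ℝ)`. -/
def IsCn (n : WithTop ℕ∞) (f : ℝ → ℝ → ℝ) : Prop :=
  ContDiffOn ℝ n (fun q : ℝ × ℝ => f q.1 q.2) (Ici 0 ×ˢ univ)

theorem uniqueDiffOn_halfPlane : UniqueDiffOn ℝ (Ici (0 : ℝ) ×ˢ (univ : Set ℝ)) :=
  (uniqueDiffOn_Ici 0).prod uniqueDiffOn_univ

namespace IsCn

variable {f g : ℝ → ℝ → ℝ} {n m : WithTop ℕ∞} {t : ℝ}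

theorem of_le (h : IsCn n f) (hm : m ≤ n) : IsCn m f := ContDiffOn.of_le h hm

theorem continuousOn (h : IsCn n f) :
    ContinuousOn (Function.uncurry f) (Ici 0 ×ˢ univ) := ContDiffOn.continuousOn h

theorem continuous_right (h : IsCn n f) (ht : 0 ≤ t) : Continuous (f t) :=
  h.continuousOn.comp_continuous (f := fun x => (t, x)) (by fun_prop) fun x => ⟨ht, mem_univ _⟩

theorem hasFDerivWithinAt (h : IsCn n f) (hn : n ≠ 0) (ht : 0 ≤ t) (x : ℝ) :
    HasFDerivWithinAt (fun q : ℝ × ℝ => f q.1 q.2)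
      (fderivWithin ℝ (fun q : ℝ × ℝ => f q.1 q.2) (Ici 0 ×ˢ univ) (t, x)) (Ici 0 ×ˢ univ) (t, x) :=
  ((ContDiffOn.differentiableOn h hn) (t, x) ⟨ht, mem_univ _⟩).hasFDerivWithinAt

theorem hasDerivWithinAt_fderivWithin (h : IsCn n f) (hn : n ≠ 0) (ht : 0 ≤ t) (x : ℝ) :
    HasDerivWithinAt (fun s => f s x)
      (fderivWithin ℝ (fun q : ℝ × ℝ => f q.1 q.2) (Ici 0 ×ˢ univ) (t, x) (1, 0)) (Ici 0) t := by
  have h1 : HasDerivWithinAt (fun s : ℝ => (s, x)) ((1 : ℝ), (0 : ℝ)) (Ici 0) t :=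
    (hasDerivWithinAt_id t _).prodMk (hasDerivWithinAt_const t _ x)
  exact (h.hasFDerivWithinAt hn ht x).comp_hasDerivWithinAt t h1
    (fun _ hs => mk_mem_prod hs (mem_univ _) :
      MapsTo (fun s : ℝ => (s, x)) (Ici 0) (Ici (0 : ℝ) ×ˢ (univ : Set ℝ)))

theorem hasDerivAt_fderivWithin (h : IsCn n f) (hn : n ≠ 0) (ht : 0 ≤ t) (x : ℝ) :
    HasDerivAt (fun y => f t y)
      (fderivWithin ℝ (fun q : ℝ × ℝ => f q.1 q.2) (Ici 0 ×ˢ univ) (t, x) (0, 1)) x := by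
  have h1 : HasDerivWithinAt (fun y : ℝ => (t, y)) ((0 : ℝ), (1 : ℝ)) univ x :=
    (hasDerivWithinAt_const x _ t).prodMk (hasDerivWithinAt_id x _)
  rw [← hasDerivWithinAt_univ]
  exact (h.hasFDerivWithinAt hn ht x).comp_hasDerivWithinAt x h1 fun s _ => ⟨ht, mem_univ _⟩

theorem dt_eq (h : IsCn n f) (hn : n ≠ 0) (ht : 0 ≤ t) (x : ℝ) : dt f t x =
    fderivWithin ℝ (fun q : ℝ × ℝ => f q.1 q.2) (Ici 0 ×ˢ univ) (t, x) (1, 0) :=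
  (h.hasDerivWithinAt_fderivWithin hn ht x).derivWithin (uniqueDiffOn_Ici 0 t ht)

theorem dx_eq (h : IsCn n f) (hn : n ≠ 0) (ht : 0 ≤ t) (x : ℝ) : dx f t x =
    fderivWithin ℝ (fun q : ℝ × ℝ => f q.1 q.2) (Ici 0 ×ˢ univ) (t, x) (0, 1) :=
  (h.hasDerivAt_fderivWithin hn ht x).deriv

theorem hasDerivWithinAt (h : IsCn n f) (hn : n ≠ 0) (ht : 0 ≤ t) (x : ℝ) :
    HasDerivWithinAt (fun s => f s x) (dt f t x) (Ici 0) t := by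
  rw [h.dt_eq hn ht]
  exact h.hasDerivWithinAt_fderivWithin hn ht x

theorem hasDerivAt (h : IsCn n f) (hn : n ≠ 0) (ht : 0 ≤ t) (x : ℝ) :
    HasDerivAt (fun y => f t y) (dx f t x) x := by
  rw [h.dx_eq hn ht]
  exact h.hasDerivAt_fderivWithin hn ht x

theorem isCn_dt (h : IsCn n f) (hm : m + 1 ≤ n) : IsCn m (dt f) := by
  have hn : n ≠ 0 := by
    rintro rfl
    simp at hm
  have h1 := ContDiffOn.fderivWithin h uniqueDiffOn_halfPlane hm
  refine (h1.clm_apply contDiffOn_const (g := fun _ => ((1 : ℝ), (0 : ℝ)))).congr fun q hq => ?_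
  exact h.dt_eq hn hq.1 q.2

theorem isCn_dx (h : IsCn n f) (hm : m + 1 ≤ n) : IsCn m (dx f) := by
  have hn : n ≠ 0 := by
    rintro rfl
    simp at hm
  have h1 := ContDiffOn.fderivWithin h uniqueDiffOn_halfPlane hm
  refine (h1.clm_apply contDiffOn_const (g := fun _ => ((0 : ℝ), (1 : ℝ)))).congr fun q hq => ?_
  exact h.dx_eq hn hq.1 q.2

theorem mul (h : IsCn n f) (h' : IsCn n g) : IsCn n fun t x => f t x * g t x := ContDiffOn.mul h h'
theorem add (h : IsCn n f) (h' : IsCn n g) : IsCn n fun t x => f t x + g t x := ContDiffOn.add h h'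
theorem sub (h : IsCn n f) (h' : IsCn n g) : IsCn n fun t x => f t x - g t x := ContDiffOn.sub h h'

theorem of_contDiff (h : ContDiff ℝ n fun q : ℝ × ℝ => f q.1 q.2) : IsCn n f := h.contDiffOn

theorem of_time {f : ℝ → ℝ} (h : ContDiffOn ℝ n f (Ici 0)) : IsCn n fun t _ => f t :=
  h.comp contDiff_fst.contDiffOn fun _ hq => hq.1

theorem dt_mul (h : IsCn n f) (h' : IsCn n g) (hn : n ≠ 0) (ht : 0 ≤ t) (x : ℝ) :
    dt (fun t x => f t x * g t x) t x = dt f t x * g t x + f t x * dt g t x :=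
  ((h.hasDerivWithinAt hn ht x).mul (h'.hasDerivWithinAt hn ht x)).derivWithin
    (uniqueDiffOn_Ici 0 t ht)

theorem dt_add (h : IsCn n f) (h' : IsCn n g) (hn : n ≠ 0) (ht : 0 ≤ t) (x : ℝ) :
    dt (fun t x => f t x + g t x) t x = dt f t x + dt g t x :=
  ((h.hasDerivWithinAt hn ht x).add (h'.hasDerivWithinAt hn ht x)).derivWithin
    (uniqueDiffOn_Ici 0 t ht)

theorem dx_mul (h : IsCn n f) (h' : IsCn n g) (hn : n ≠ 0) (ht : 0 ≤ t) (x : ℝ) :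
    dx (fun t x => f t x * g t x) t x = dx f t x * g t x + f t x * dx g t x :=
  ((h.hasDerivAt hn ht x).mul (h'.hasDerivAt hn ht x)).deriv

theorem dx_add (h : IsCn n f) (h' : IsCn n g) (hn : n ≠ 0) (ht : 0 ≤ t) (x : ℝ) :
    dx (fun t x => f t x + g t x) t x = dx f t x + dx g t x :=
  ((h.hasDerivAt hn ht x).add (h'.hasDerivAt hn ht x)).deriv

end IsCn

theorem dt_congr {f g : ℝ → ℝ → ℝ} (h : ∀ t x, 0 ≤ t → f t x = g t x) {t : ℝ} (ht : 0 ≤ t) (x : ℝ) :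
    dt f t x = dt g t x :=
  derivWithin_congr (fun s hs => h s x hs) (h t x ht)

theorem dx_congr {f g : ℝ → ℝ → ℝ} (h : ∀ t x, 0 ≤ t → f t x = g t x) {t : ℝ} (ht : 0 ≤ t) (x : ℝ) :
    dx f t x = dx g t x := by
  have : (fun y => f t y) = fun y => g t y := funext fun y => h t y ht
  rw [dx, dx, this]

/-! ### Supports of test functions -/

/-- `ψ` vanishes outside `[0,T₁] × [-M,M]`. -/
def SuppIn (T₁ M : ℝ) (ψ : ℝ → ℝ → ℝ) : Prop :=
  ∀ t x, 0 ≤ t → (T₁ < t ∨ x ∉ Icc (-M) M) → ψ t x = 0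

theorem IsTest.exists_suppIn {T : EReal} (hT : 0 < T) {ψ : ℝ → ℝ → ℝ} (h : IsTest T ψ) :
    ∃ T₁ M : ℝ, 0 ≤ T₁ ∧ (T₁ : EReal) < T ∧ 0 ≤ M ∧ SuppIn T₁ M ψ := by
  obtain ⟨-, K, hK, hKT, hv⟩ := h
  obtain ⟨M, hM⟩ := (hK.image continuous_snd).isBounded.subset_closedBall 0
  rcases K.eq_empty_or_nonempty with rfl | hne
  · exact ⟨0, 0, le_rfl, by simpa using hT, le_rfl, fun t x ht _ => hv t x ht (by simp)⟩
  obtain ⟨q, hq, hmax⟩ := hK.exists_isMaxOn hne continuous_fst.continuousOn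
  refine ⟨q.1, |M|, (hKT hq).1.1, (hKT hq).1.2, abs_nonneg _, fun t x ht hx => hv t x ht fun hK => ?_⟩
  rcases hx with hx | hx
  · have := hmax hK
    simp only [mem_ofPred_eq] at this
    linarith
  · have := hM ⟨(t, x), hK, rfl⟩
    rw [Metric.mem_closedBall, dist_zero_right, Real.norm_eq_abs] at this
    exact hx (abs_le.1 (this.trans (le_abs_self M)))

theorem isTest_of_suppIn {T : EReal} {T₁ M : ℝ} (hT : (T₁ : EReal) < T) {ψ : ℝ → ℝ → ℝ}
    (h : IsC2 ψ) (hs : SuppIn T₁ M ψ) : IsTest T ψ := by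
  refine ⟨h, Icc 0 T₁ ×ˢ Icc (-M) M, isCompact_Icc.prod isCompact_Icc, ?_, ?_⟩
  · exact prod_mono (fun t ht => ⟨ht.1, (EReal.coe_le_coe_iff.2 ht.2).trans_lt hT⟩) (subset_univ _)
  · intro t x ht hx
    refine hs t x ht ?_
    by_contra hcon
    push Not at hcon
    exact hx ⟨⟨ht, hcon.1⟩, hcon.2⟩

namespace SuppIn

variable {T₁ M : ℝ} {ψ : ℝ → ℝ → ℝ}

theorem dt (h : SuppIn T₁ M ψ) : SuppIn T₁ M (dt ψ) := by
  intro t x ht hx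
  rcases hx with hx | hx
  · have : (fun s => ψ s x) =ᶠ[𝓝[Ici 0] t] fun _ => 0 := by
      filter_upwards [self_mem_nhdsWithin, mem_nhdsWithin_of_mem_nhds (Ioi_mem_nhds hx)] with s hs hs'
      exact h s x hs (Or.inl hs')
    rw [DampedWave.dt, this.derivWithin_eq (h t x ht (Or.inl hx)), derivWithin_fun_const]
    rfl
  · rw [dt_congr (f := ψ) (g := fun s y => if y = x then 0 else ψ s y) ?_ ht]
    · simp [DampedWave.dt]
    · intro s y hs
      by_cases hy : y = x
      · rw [if_pos hy, hy, h s x hs (Or.inr hx)]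
      · rw [if_neg hy]

theorem dx (h : SuppIn T₁ M ψ) : SuppIn T₁ M (dx ψ) := by
  intro t x ht hx
  have : (fun y => ψ t y) =ᶠ[𝓝 x] fun _ => 0 := by
    rcases hx with hx | hx
    · exact Eventually.of_forall fun y => h t y ht (Or.inl hx)
    · filter_upwards [isClosed_Icc.isOpen_compl.mem_nhds hx] with y hy
      exact h t y ht (Or.inr hy)
  rw [DampedWave.dx, this.deriv_eq, deriv_const]

theorem mul_left (h : SuppIn T₁ M ψ) (a : ℝ → ℝ → ℝ) : SuppIn T₁ M fun t x => a t x * ψ t x :=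
  fun t x ht hx => by simp only [h t x ht hx, mul_zero]

theorem memLp (h : SuppIn T₁ M ψ) {n : WithTop ℕ∞} (hψ : IsCn n ψ) {t : ℝ} (ht : 0 ≤ t) :
    MemLp (ψ t) 2 volume :=
  memLp_of_support (hψ.continuous_right ht) fun x hx => h t x ht (Or.inr hx)

theorem cls_eq_zero (h : SuppIn T₁ M ψ) {t : ℝ} (ht : 0 ≤ t) (ht' : T₁ < t) : cls (ψ t) = 0 := by
  have : ψ t = fun _ => 0 := funext fun x => h t x ht (Or.inl ht')
  rw [this]
  refine (eq_cls ?_).symm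
  exact Lp.coeFn_zero ℝ 2 volume

theorem continuousOn_cls (h : SuppIn T₁ M ψ) (hM : 0 ≤ M) {n : WithTop ℕ∞} (hψ : IsCn n ψ) :
    ContinuousOn (fun t => cls (ψ t)) (Ici 0) :=
  DampedWave.continuousOn_cls hM hψ.continuousOn fun t ht x hx => h t x ht (Or.inr hx)

theorem hasDerivWithinAt_cls (h : SuppIn T₁ M ψ) (hM : 0 ≤ M) (hψ : IsCn 1 ψ) {t : ℝ} (ht : 0 ≤ t) :
    HasDerivWithinAt (fun t => cls (ψ t)) (cls (DampedWave.dt ψ t)) (Ici 0) t :=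
  DampedWave.hasDerivWithinAt_cls hM (convex_Ici 0) (fun _ ht => hψ.continuous_right ht)
    (hψ.isCn_dt (m := 0) (by simp)).continuousOn
    (fun _ ht x => hψ.hasDerivWithinAt one_ne_zero ht x)
    (fun t ht x hx => h t x ht (Or.inr hx)) (fun t ht x hx => h.dt t x ht (Or.inr hx)) ht

/-- Differentiation of a test function along a characteristic. -/
theorem hasDerivWithinAt_shift_cls (h : SuppIn T₁ M ψ) (hM : 0 ≤ M) (hψ : IsCn 1 ψ) (c : ℝ) {t : ℝ}
    (ht : 0 ≤ t) : HasDerivWithinAt (fun t => shift (c * t) (cls (ψ t)))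
      (shift (c * t) (cls fun x => DampedWave.dt ψ t x + c * DampedWave.dx ψ t x)) (Ici 0) t := by
  -- The support moves by at most |c| T₁ along the characteristic before ψ vanishes, so one compact
  -- interval serves for all times.
  set M' := M + |c| * |T₁| with hM'
  have hsupp : ∀ χ : ℝ → ℝ → ℝ, SuppIn T₁ M χ → ∀ t ∈ Ici (0 : ℝ), ∀ x, x ∉ Icc (-M') M' →
      χ t (x + c * t) = 0 := by
    intro χ hχ t ht x hx
    refine hχ t _ ht ?_
    by_contra hcon
    push Not at hcon
    apply hx
    have h1 : |c * t| ≤ |c| * |T₁| := by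
      rw [abs_mul, abs_of_nonneg (show 0 ≤ t from ht)]
      gcongr
      exact hcon.1.trans (le_abs_self _)
    have h2 := abs_le.1 h1
    exact ⟨by linarith [hcon.2.1], by linarith [hcon.2.2]⟩
  have hmap : ∀ χ : ℝ → ℝ → ℝ, IsCn 0 χ →
      ContinuousOn (Function.uncurry fun t x => χ t (x + c * t)) (Ici 0 ×ˢ univ) := by
    intro χ hχ
    exact hχ.continuousOn.comp (f := fun q : ℝ × ℝ => (q.1, q.2 + c * q.1)) (by fun_prop)
      fun q hq => ⟨hq.1, mem_univ _⟩
  have c1 := hψ.isCn_dt (m := 0) (by simp)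
  have c2 := hψ.isCn_dx (m := 0) (by simp)
  have key := DampedWave.hasDerivWithinAt_cls (c := fun t x => ψ t (x + c * t))
    (c' := fun t x => DampedWave.dt ψ t (x + c * t) + c * DampedWave.dx ψ t (x + c * t))
    (s := Ici 0) (M := M') (by positivity) (convex_Ici 0)
    (fun t ht => (hψ.continuous_right ht).comp (by fun_prop))
    ((hmap _ c1).add (continuousOn_const.mul (hmap _ c2)))
    (fun t ht x => ?_) (hsupp ψ h)
    (fun t ht x hx => by simp only [hsupp _ h.dt t ht x hx, hsupp _ h.dx t ht x hx]; ring) ht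
  · have m1 : MemLp (fun x => DampedWave.dt ψ t x + c * DampedWave.dx ψ t x) 2 volume :=
      (h.dt.memLp c1 ht).add ((h.dx.memLp c2 ht).const_mul c)
    rw [shift_cls _ m1]
    refine key.congr (fun s hs => ?_) ?_
    · exact shift_cls _ (h.memLp hψ hs)
    · exact shift_cls _ (h.memLp hψ ht)
  · have h1 : HasDerivWithinAt (fun s : ℝ => (s, x + c * s)) ((1 : ℝ), c) (Ici 0) t := by
      refine (hasDerivWithinAt_id t _).prodMk ?_
      simpa using (((hasDerivAt_id t).const_mul c).const_add x).hasDerivWithinAt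
    have h2 := (hψ.hasFDerivWithinAt one_ne_zero ht (x + c * t)).comp_hasDerivWithinAt t h1
      (fun _ hs => mk_mem_prod hs (mem_univ _) :
        MapsTo (fun s : ℝ => (s, x + c * s)) (Ici 0) (Ici (0 : ℝ) ×ˢ (univ : Set ℝ)))
    refine h2.congr_deriv ?_
    rw [hψ.dt_eq one_ne_zero ht, hψ.dx_eq one_ne_zero ht]
    have e : ((1 : ℝ), c) = (1, 0) + c • (0, 1) := by simp
    rw [e, map_add, map_smul, smul_eq_mul]

end SuppIn

/-! ### The time interval -/

theorem timeInterval_eq (T : EReal) : timeInterval T = Ici 0 ∩ {t : ℝ | (t : EReal) < T} := rfl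

theorem isOpen_coe_lt (T : EReal) : IsOpen {t : ℝ | (t : EReal) < T} :=
  isOpen_Iio.preimage continuous_coe_real_ereal

theorem measurableSet_timeInterval (T : EReal) : MeasurableSet (timeInterval T) :=
  measurableSet_Ici.inter (isOpen_coe_lt T).measurableSet

theorem nhdsWithin_timeInterval {T : EReal} {t : ℝ} (ht : t ∈ timeInterval T) :
    𝓝[timeInterval T] t = 𝓝[Ici 0] t := by
  rw [timeInterval_eq, nhdsWithin_inter_of_mem']
  exact mem_nhdsWithin_of_mem_nhds ((isOpen_coe_lt T).mem_nhds ht.2)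

theorem hasDerivWithinAt_timeInterval_iff {X : Type*} [NormedAddCommGroup X] [NormedSpace ℝ X]
    {f : ℝ → X} {f' : X} {T : EReal} {t : ℝ} (ht : t ∈ timeInterval T) :
    HasDerivWithinAt f f' (timeInterval T) t ↔ HasDerivWithinAt f f' (Ici 0) t := by
  constructor
  · intro h
    refine h.mono_of_mem_nhdsWithin ?_
    rw [← nhdsWithin_timeInterval ht]
    exact self_mem_nhdsWithin
  · intro h
    exact h.mono fun s hs => hs.1

theorem uniqueDiffOn_timeInterval (T : EReal) : UniqueDiffOn ℝ (timeInterval T) := by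
  intro t ht
  rw [timeInterval_eq]
  exact (uniqueDiffOn_Ici (0 : ℝ)).inter (isOpen_coe_lt T) t ht

theorem zero_mem_timeInterval {T : EReal} (hT : 0 < T) : (0 : ℝ) ∈ timeInterval T :=
  ⟨le_rfl, by simpa using hT⟩

theorem Icc_subset_timeInterval {T : EReal} {T₂ : ℝ} (h : (T₂ : EReal) < T) :
    Icc 0 T₂ ⊆ timeInterval T :=
  fun _ ht => ⟨ht.1, (EReal.coe_le_coe_iff.2 ht.2).trans_lt h⟩

theorem setIntegral_timeInterval {T : EReal} {T₁ T₂ : ℝ} (h0 : 0 ≤ T₁) (h12 : T₁ < T₂)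
    (h2 : (T₂ : EReal) < T) {G : ℝ → ℝ} (hG : ∀ t, 0 ≤ t → T₁ < t → G t = 0) :
    ∫ t in timeInterval T, G t = ∫ t in (0 : ℝ)..T₂, G t := by
  rw [intervalIntegral.integral_of_le (h0.trans h12.le), ← integral_Icc_eq_integral_Ioc]
  refine setIntegral_eq_of_subset_of_forall_sdiff_eq_zero (measurableSet_timeInterval T)
    (Icc_subset_timeInterval h2) fun t ht => hG t ht.1.1 ?_
  by_contra hcon
  exact ht.2 ⟨ht.1.1, by linarith⟩

theorem exists_between_time {T : EReal} {T₁ : ℝ} (h : (T₁ : EReal) < T) :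
    ∃ T₂ : ℝ, T₁ < T₂ ∧ (T₂ : EReal) < T := by
  obtain ⟨T₂, h1, h2⟩ := EReal.lt_iff_exists_real_btwn.1 h
  exact ⟨T₂, EReal.coe_lt_coe_iff.1 h1, h2⟩

/-! ### The weak formulation -/

variable {a : ℝ → ℝ → ℝ} {p : ℝ}

theorem MemX.hasDerivWithinAt {T : EReal} {u : ℝ → H1} (h : MemX T u) {t : ℝ}
    (ht : t ∈ timeInterval T) :
    HasDerivWithinAt (fun s => toL2 (u s)) (velocity T u t) (Ici 0) t := by
  rw [← hasDerivWithinAt_timeInterval_iff ht]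
  exact ((h.2.differentiableOn one_ne_zero) t ht).hasDerivWithinAt

theorem MemX.continuousOn_velocity {T : EReal} {u : ℝ → H1} (h : MemX T u) :
    ContinuousOn (velocity T u) (timeInterval T) :=
  h.2.continuousOn_derivWithin (uniqueDiffOn_timeInterval T) le_rfl

theorem memX_of_hasDerivWithinAt {T : EReal} {u : ℝ → H1} {v : ℝ → L2}
    (hu : ContinuousOn u (timeInterval T)) (hv : ContinuousOn v (timeInterval T))
    (hd : ∀ t ∈ timeInterval T, HasDerivWithinAt (fun s => toL2 (u s)) (v t) (Ici 0) t) :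
    MemX T u ∧ ∀ t ∈ timeInterval T, velocity T u t = v t := by
  have h1 : ∀ t ∈ timeInterval T,
      HasDerivWithinAt (fun s => toL2 (u s)) (v t) (timeInterval T) t := fun t ht =>
    (hasDerivWithinAt_timeInterval_iff ht).2 (hd t ht)
  have h2 : ∀ t ∈ timeInterval T, velocity T u t = v t := fun t ht =>
    (h1 t ht).derivWithin (uniqueDiffOn_timeInterval T t ht)
  refine ⟨⟨hu, ?_⟩, h2⟩
  have h3 : ContDiffOn ℝ (0 + 1) (fun t => toL2 (u t)) (timeInterval T) := by
    rw [contDiffOn_succ_iff_derivWithin (uniqueDiffOn_timeInterval T)]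
    refine ⟨fun t ht => (h1 t ht).differentiableWithinAt, by simp, ?_⟩
    rw [contDiffOn_zero]
    exact hv.congr h2
  simpa using h3

theorem inner_mulL2 {f : ℝ → ℝ} {C : ℝ} (hf : Continuous f) (hb : ∀ x, |f x| ≤ C) (v : L2)
    {φ : ℝ → ℝ} (hφ : MemLp φ 2 volume) (hφ' : MemLp (fun x => f x * φ x) 2 volume) :
    inner ℝ (mulL2 f v) (cls φ) = inner ℝ v (cls fun x => f x * φ x) := by
  rw [inner_cls _ hφ, inner_cls _ hφ']
  apply integral_congr_ae
  filter_upwards [coe_mulL2 hf hb v] with x hx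
  rw [hx]
  ring

theorem continuousOn_force (ha : IsDamping a) (hp : 1 < p) {T : EReal} {u : ℝ → H1} {v : ℝ → L2}
    (hu : ContinuousOn u (timeInterval T)) (hv : ContinuousOn v (timeInterval T)) :
    ContinuousOn (fun t => force a p t (u t) (v t)) (timeInterval T) :=
  Continuous.comp_continuousOn (f := fun t : ℝ => ((t, u t, v t) : ℝ × H1 × L2))
    (g := fun q : ℝ × H1 × L2 => force a p q.1 q.2.1 q.2.2) (continuous_force ha hp)
    (continuousOn_id.prodMk (hu.prodMk hv))

/-- The weak formulation after an integration by parts in time. -/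
theorem weak_iff (ha : IsDamping a) (hp : 1 < p) {T : EReal} {u : ℝ → H1} {v : ℝ → L2}
    (u₀ : H1) (u₁ : L2)
    (hu : ContinuousOn u (timeInterval T)) (hv : ContinuousOn v (timeInterval T))
    (hd : ∀ t ∈ timeInterval T, HasDerivWithinAt (fun s => toL2 (u s)) (v t) (Ici 0) t)
    {ψ : ℝ → ℝ → ℝ} (hψ : IsC2 ψ) {T₁ T₂ M : ℝ} (hs : SuppIn T₁ M ψ) (h0 : 0 ≤ T₁) (h12 : T₁ < T₂)
    (h2 : (T₂ : EReal) < T) (hM : 0 ≤ M) :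
    (∫ t in timeInterval T, ∫ x, toL2 (u t) x *
        (dt (dt ψ) t x - dx (dx ψ) t x - dt (fun s y => a s y * ψ s y) t x)
      = (∫ x, ((a 0 x * toL2 u₀ x + u₁ x) * ψ 0 x - toL2 u₀ x * dt ψ 0 x))
        + ∫ t in timeInterval T, ∫ x, |toL2 (u t) x| ^ p * ψ t x) ↔
    ∫ t in (0 : ℝ)..T₂, (inner ℝ (v t) (cls (dt ψ t)) + inner ℝ (toL2 (u t)) (cls (dx (dx ψ) t))
        + inner ℝ (force a p t (u t) (v t)) (cls (ψ t)))
      = inner ℝ (toL2 u₀ - toL2 (u 0)) (cls (dt ψ 0) - cls (fun x => a 0 x * ψ 0 x))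
        - inner ℝ u₁ (cls (ψ 0)) := by
  obtain ⟨C, hC⟩ := ha.bound
  have hψ' : IsCn 2 ψ := hψ
  have hsub := Icc_subset_timeInterval h2
  have c1 : IsCn 1 (dt ψ) := hψ'.isCn_dt (by norm_num)
  have c2 : IsCn 1 (dx ψ) := hψ'.isCn_dx (by norm_num)
  have c3 : IsCn 0 (dt (dt ψ)) := c1.isCn_dt (by simp)
  have c4 : IsCn 0 (dx (dx ψ)) := c2.isCn_dx (by simp)
  have caψ : IsCn 2 (fun t x => a t x * ψ t x) := IsCn.mul (n := 2) ha.contDiff hψ'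
  have c5 : IsCn 1 (dt fun t x => a t x * ψ t x) := caψ.isCn_dt (by norm_num)
  have saψ : SuppIn T₁ M (fun t x => a t x * ψ t x) := hs.mul_left a
  have huL : ContinuousOn (fun t => toL2 (u t)) (timeInterval T) :=
    continuous_toL2.comp_continuousOn hu
  have hsubI : timeInterval T ⊆ Ici 0 := fun t ht => ht.1
  have hT2 : 0 ≤ T₂ := h0.trans h12.le
  -- the space integrals as inner products
  have e1 : ∀ t ∈ timeInterval T, ∫ x, toL2 (u t) x *
        (dt (dt ψ) t x - dx (dx ψ) t x - dt (fun s y => a s y * ψ s y) t x)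
      = inner ℝ (toL2 (u t)) (cls (dt (dt ψ) t)) - inner ℝ (toL2 (u t)) (cls (dx (dx ψ) t))
        - inner ℝ (toL2 (u t)) (cls (dt (fun s y => a s y * ψ s y) t)) := by
    intro t ht
    have m1 := hs.dt.dt.memLp c3 ht.1
    have m2 := hs.dx.dx.memLp c4 ht.1
    have m3 := saψ.dt.memLp c5 ht.1
    have m12 : MemLp (fun x => dt (dt ψ) t x - dx (dx ψ) t x) 2 volume := m1.sub m2
    rw [← inner_sub_right, ← inner_sub_right, ← cls_sub m1 m2, ← cls_sub m12 m3,
      inner_cls _ (by exact m12.sub m3)]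
  have e2 : ∀ t ∈ timeInterval T, ∫ x, |toL2 (u t) x| ^ p * ψ t x
      = inner ℝ (nonlin p (u t)) (cls (ψ t)) := by
    intro t ht
    rw [inner_cls _ (hs.memLp hψ' ht.1)]
    apply integral_congr_ae
    filter_upwards [coe_nonlin hp (u t)] with x hx
    rw [hx]
  have e3 : ∫ x, ((a 0 x * toL2 u₀ x + u₁ x) * ψ 0 x - toL2 u₀ x * dt ψ 0 x)
      = inner ℝ (toL2 u₀) (cls fun x => a 0 x * ψ 0 x) + inner ℝ u₁ (cls (ψ 0))
        - inner ℝ (toL2 u₀) (cls (dt ψ 0)) := by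
    have m1 := saψ.memLp caψ (le_refl 0)
    have m2 := hs.memLp hψ' (le_refl 0)
    have m3 := hs.dt.memLp c1 (le_refl 0)
    rw [inner_cls _ m1, inner_cls _ m2, inner_cls _ m3]
    have i1 : Integrable fun x => toL2 u₀ x * (a 0 x * ψ 0 x) :=
      (Lp.memLp (toL2 u₀)).integrable_mul (q := 2) m1
    have i2 : Integrable fun x => u₁ x * ψ 0 x := (Lp.memLp u₁).integrable_mul (q := 2) m2
    have i3 : Integrable fun x => toL2 u₀ x * dt ψ 0 x :=
      (Lp.memLp (toL2 u₀)).integrable_mul (q := 2) m3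
    rw [← integral_add i1 i2, ← integral_sub (i1.fun_add i2) i3]
    refine integral_congr_ae (Eventually.of_forall fun x => ?_)
    simp only
    ring
  have e4 : ∀ t ∈ timeInterval T, inner ℝ (force a p t (u t) (v t)) (cls (ψ t))
      = inner ℝ (nonlin p (u t)) (cls (ψ t)) - inner ℝ (v t) (cls fun x => a t x * ψ t x) := by
    intro t ht
    rw [force, inner_sub_left, max_eq_left ht.1, inner_mulL2
      (IsC2.continuous_right ha.contDiff ht.1) (fun x => (hC t x ht.1).1) _ (hs.memLp hψ' ht.1)
      (saψ.memLp caψ ht.1)]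
  -- vanishing for large times
  have z1 : ∀ t, 0 ≤ t → T₁ < t → ∫ x, toL2 (u t) x *
        (dt (dt ψ) t x - dx (dx ψ) t x - dt (fun s y => a s y * ψ s y) t x) = 0 := by
    intro t ht ht'
    rw [← integral_zero ℝ ℝ (μ := volume)]
    refine integral_congr_ae (Eventually.of_forall fun x => ?_)
    simp only
    rw [hs.dt.dt t x ht (Or.inl ht'), hs.dx.dx t x ht (Or.inl ht'), saψ.dt t x ht (Or.inl ht')]
    ring
  have z2 : ∀ t, 0 ≤ t → T₁ < t → ∫ x, |toL2 (u t) x| ^ p * ψ t x = 0 := by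
    intro t ht ht'
    rw [← integral_zero ℝ ℝ (μ := volume)]
    refine integral_congr_ae (Eventually.of_forall fun x => ?_)
    simp only
    rw [hs t x ht (Or.inl ht'), mul_zero]
  rw [setIntegral_timeInterval h0 h12 h2 z1, setIntegral_timeInterval h0 h12 h2 z2, e3]
  have hIcc : ∀ t ∈ uIcc 0 T₂, t ∈ timeInterval T := fun t ht => hsub (uIcc_of_le hT2 ▸ ht)
  have g1 : ∫ t in (0 : ℝ)..T₂, ∫ x, toL2 (u t) x *
        (dt (dt ψ) t x - dx (dx ψ) t x - dt (fun s y => a s y * ψ s y) t x)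
      = ∫ t in (0 : ℝ)..T₂, (inner ℝ (toL2 (u t)) (cls (dt (dt ψ) t))
        - inner ℝ (toL2 (u t)) (cls (dx (dx ψ) t))
        - inner ℝ (toL2 (u t)) (cls (dt (fun s y => a s y * ψ s y) t))) :=
    intervalIntegral.integral_congr fun t ht => e1 t (hIcc t ht)
  have g2 : ∫ t in (0 : ℝ)..T₂, ∫ x, |toL2 (u t) x| ^ p * ψ t x
      = ∫ t in (0 : ℝ)..T₂, inner ℝ (nonlin p (u t)) (cls (ψ t)) :=
    intervalIntegral.integral_congr fun t ht => e2 t (hIcc t ht)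
  have g4 : ∫ t in (0 : ℝ)..T₂, (inner ℝ (v t) (cls (dt ψ t))
        + inner ℝ (toL2 (u t)) (cls (dx (dx ψ) t)) + inner ℝ (force a p t (u t) (v t)) (cls (ψ t)))
      = ∫ t in (0 : ℝ)..T₂, (inner ℝ (v t) (cls (dt ψ t))
        + inner ℝ (toL2 (u t)) (cls (dx (dx ψ) t)) + (inner ℝ (nonlin p (u t)) (cls (ψ t))
          - inner ℝ (v t) (cls fun x => a t x * ψ t x))) :=
    intervalIntegral.integral_congr fun t ht => by rw [e4 t (hIcc t ht)]
  rw [g1, g2, g4]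
  -- integrability
  have hi : ∀ {F G : ℝ → L2}, ContinuousOn F (timeInterval T) → ContinuousOn G (Ici 0) →
      IntervalIntegrable (fun t => inner ℝ (F t) (G t)) volume 0 T₂ := by
    intro F G hF hG
    apply ContinuousOn.intervalIntegrable
    rw [uIcc_of_le hT2]
    exact (hF.mono hsub).inner (hG.mono fun t ht => ht.1)
  have k1 := hs.continuousOn_cls hM hψ'
  have k2 := hs.dt.continuousOn_cls hM c1
  have k3 := hs.dt.dt.continuousOn_cls hM c3
  have k4 := hs.dx.dx.continuousOn_cls hM c4
  have k5 := saψ.continuousOn_cls hM caψ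
  have k6 := saψ.dt.continuousOn_cls hM c5
  have hN : ContinuousOn (fun t => nonlin p (u t)) (timeInterval T) :=
    (continuous_nonlin hp).comp_continuousOn hu
  -- integration by parts
  have parts : ∫ t in (0 : ℝ)..T₂, (inner ℝ (toL2 (u t)) (cls (dt (dt ψ) t)
        - cls (dt (fun s y => a s y * ψ s y) t))
        + inner ℝ (v t) (cls (dt ψ t) - cls (fun x => a t x * ψ t x)))
      = - inner ℝ (toL2 (u 0)) (cls (dt ψ 0) - cls (fun x => a 0 x * ψ 0 x)) := by
    have hcont : ContinuousOn (fun t => inner ℝ (toL2 (u t))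
        (cls (dt ψ t) - cls (fun x => a t x * ψ t x))) (Icc 0 T₂) :=
      (huL.mono hsub).inner ((k2.fun_sub k5).mono fun t ht => ht.1)
    have hder : ∀ t ∈ Ioo 0 T₂, HasDerivWithinAt (fun t => inner ℝ (toL2 (u t))
        (cls (dt ψ t) - cls (fun x => a t x * ψ t x)))
        (inner ℝ (toL2 (u t)) (cls (dt (dt ψ) t) - cls (dt (fun s y => a s y * ψ s y) t))
          + inner ℝ (v t) (cls (dt ψ t) - cls (fun x => a t x * ψ t x))) (Ioi t) t := by
      intro t ht
      have d1 := hs.dt.hasDerivWithinAt_cls hM c1 ht.1.le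
      have d2 := saψ.hasDerivWithinAt_cls hM (caψ.of_le (by norm_num)) ht.1.le
      exact ((hd t (hsub ⟨ht.1.le, ht.2.le⟩)).inner ℝ (d1.sub d2)).mono
        (Ioi_subset_Ici ht.1.le)
    have := intervalIntegral.integral_eq_sub_of_hasDeriv_right_of_le hT2 hcont hder
      ((hi huL (k3.fun_sub k6)).add (hi hv (k2.fun_sub k5)))
    rw [this, hs.dt.cls_eq_zero hT2 h12, saψ.cls_eq_zero hT2 h12, sub_zero, inner_zero_right,
      zero_sub]
  rw [intervalIntegral.integral_add (hi huL (k3.fun_sub k6)) (hi hv (k2.fun_sub k5))] at parts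
  simp only [inner_sub_right] at parts
  rw [intervalIntegral.integral_sub (hi huL k3) (hi huL k6),
    intervalIntegral.integral_sub (hi hv k2) (hi hv k5)] at parts
  rw [intervalIntegral.integral_sub ((hi huL k3).sub (hi huL k4)) (hi huL k6),
    intervalIntegral.integral_sub (hi huL k3) (hi huL k4),
    intervalIntegral.integral_add ((hi hv k2).add (hi huL k4)) ((hi hN k1).sub (hi hv k5)),
    intervalIntegral.integral_add (hi hv k2) (hi huL k4),
    intervalIntegral.integral_sub (hi hN k1) (hi hv k5)]
  simp only [inner_sub_left, inner_sub_right]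
  constructor <;> intro h <;> linarith

/-! ### Mild solutions are weak solutions -/

theorem continuousWithinAt_shift {c : ℝ → ℝ} (hc : Continuous c) {F : ℝ → L2} {s : Set ℝ} {t : ℝ}
    (hF : ContinuousWithinAt F s t) : ContinuousWithinAt (fun t => shift (c t) (F t)) s t :=
  ContinuousAt.comp_continuousWithinAt (g := fun q : ℝ × L2 => shift q.1 q.2)
    (f := fun t => (c t, F t)) continuous_shift.continuousAt (hc.continuousWithinAt.prodMk hF)

theorem IsMild.continuousOn {T : EReal} {u : ℝ → H1} {v : ℝ → L2} (h : IsMild a p T u v) :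
    ContinuousOn u (timeInterval T) ∧ ContinuousOn v (timeInterval T) := by
  have hL : ContinuousOn (fun t => v t + wd (u t)) (timeInterval T) := by
    intro t ht
    have h1 := continuousWithinAt_shift continuous_id
      ((h.deriv_riemL t ht.1 ht.2).continuousWithinAt.mono fun s hs => hs.1 : ContinuousWithinAt _
        (timeInterval T) t)
    simpa only [id_eq, shift_shift_neg] using h1
  have hR : ContinuousOn (fun t => v t - wd (u t)) (timeInterval T) := by
    intro t ht
    have h1 := continuousWithinAt_shift continuous_neg
      ((h.deriv_riemR t ht.1 ht.2).continuousWithinAt.mono fun s hs => hs.1 : ContinuousWithinAt _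
        (timeInterval T) t)
    simpa only [shift_neg_shift] using h1
  have hv : ContinuousOn v (timeInterval T) := by
    refine ((hL.add hR).const_smul (1 / 2 : ℝ)).congr fun t _ => ?_
    simp only [Pi.add_apply, Pi.smul_apply]
    module
  refine ⟨fun t ht => continuousWithinAt_H1 ?_ ?_, hv⟩
  · exact (h.deriv_fst t ht.1 ht.2).continuousWithinAt.mono fun s hs => hs.1
  · refine ((hL.sub hv) t ht).congr (fun s _ => ?_) ?_ <;> simp

/-- Although v need not be differentiable in L², its pairing with ψ is half the sum of the pairings
of the two Riemann invariants with ψ. Translations are isometric, so each of these is differentiated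
along its own characteristic. -/
theorem IsMild.isSolution (ha : IsDamping a) (hp : 1 < p) {T : EReal} (hT : 0 < T) {u : ℝ → H1}
    {v : ℝ → L2} (h : IsMild a p T u v) :
    IsSolution a p (u 0) (v 0) T u ∧ ∀ t ∈ timeInterval T, velocity T u t = v t := by
  obtain ⟨hu, hv⟩ := h.continuousOn
  have hd : ∀ t ∈ timeInterval T, HasDerivWithinAt (fun s => toL2 (u s)) (v t) (Ici 0) t :=
    fun t ht => h.deriv_fst t ht.1 ht.2
  have hX := memX_of_hasDerivWithinAt hu hv hd
  refine ⟨⟨hT, hX.1, fun ψ hψ => ?_⟩, hX.2⟩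
  obtain ⟨T₁, M, h0, h1, hM, hs⟩ := hψ.exists_suppIn hT
  obtain ⟨T₂, h12, h2⟩ := exists_between_time h1
  rw [weak_iff ha hp (u 0) (v 0) hu hv hd hψ.1 hs h0 h12 h2 hM, sub_self, inner_zero_left, zero_sub]
  have hψ' : IsCn 2 ψ := hψ.1
  have hψ1 : IsCn 1 ψ := hψ'.of_le (by norm_num)
  have c1 : IsCn 1 (dt ψ) := hψ'.isCn_dt (by norm_num)
  have c2 : IsCn 1 (dx ψ) := hψ'.isCn_dx (by norm_num)
  have c4 : IsCn 0 (dx (dx ψ)) := c2.isCn_dx (by simp)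
  have hT2 : 0 ≤ T₂ := h0.trans h12.le
  have hsub := Icc_subset_timeInterval h2
  have huL : ContinuousOn (fun t => toL2 (u t)) (timeInterval T) :=
    continuous_toL2.comp_continuousOn hu
  have hf := continuousOn_force (a := a) ha hp hu hv
  have k1 := hs.continuousOn_cls hM hψ'
  have k2 := hs.dt.continuousOn_cls hM c1
  have k4 := hs.dx.dx.continuousOn_cls hM c4
  have hi : ∀ {F G : ℝ → L2}, ContinuousOn F (timeInterval T) → ContinuousOn G (Ici 0) →
      IntervalIntegrable (fun t => inner ℝ (F t) (G t)) volume 0 T₂ := by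
    intro F G hF hG
    apply ContinuousOn.intervalIntegrable
    rw [uIcc_of_le hT2]
    exact (hF.mono hsub).inner (hG.mono fun t ht => ht.1)
  have hcont : ContinuousOn (fun t => inner ℝ (v t) (cls (ψ t))) (Icc 0 T₂) :=
    (hv.mono hsub).inner (k1.mono fun t ht => ht.1)
  have hder : ∀ t ∈ Ioo 0 T₂, HasDerivWithinAt (fun t => inner ℝ (v t) (cls (ψ t)))
      (inner ℝ (v t) (cls (dt ψ t)) + inner ℝ (toL2 (u t)) (cls (dx (dx ψ) t))
        + inner ℝ (force a p t (u t) (v t)) (cls (ψ t))) (Ioi t) t := by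
    intro t ht
    have htT : t ∈ timeInterval T := hsub ⟨ht.1.le, ht.2.le⟩
    have d1 := hs.hasDerivWithinAt_shift_cls hM hψ1 (-1) ht.1.le
    have d2 := hs.hasDerivWithinAt_shift_cls hM hψ1 1 ht.1.le
    simp only [neg_mul, one_mul] at d1 d2
    have d3 := ((h.deriv_riemL t htT.1 htT.2).inner ℝ d1).add
      ((h.deriv_riemR t htT.1 htT.2).inner ℝ d2)
    simp only [LinearIsometry.inner_map_map] at d3
    have m1 := hs.dt.memLp c1 ht.1.le
    have m2 := hs.dx.memLp c2 ht.1.le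
    have m2' : MemLp (fun x => -dx ψ t x) 2 volume := m2.neg
    have e1 : cls (fun x => dt ψ t x + -dx ψ t x) = cls (dt ψ t) - cls (dx ψ t) := by
      rw [← cls_sub m1 m2]
      rfl
    have e2 : cls (fun x => dt ψ t x + dx ψ t x) = cls (dt ψ t) + cls (dx ψ t) := cls_add m1 m2
    rw [e1, e2] at d3
    have e3 : inner ℝ (toL2 (u t)) (cls (dx (dx ψ) t)) = - inner ℝ (wd (u t)) (cls (dx ψ t)) := by
      have hcd : ContDiff ℝ 1 (dx ψ t) :=
        (contDiffOn_univ.1 (ContDiffOn.comp c2 (s := univ) (f := fun x : ℝ => (t, x)) (by fun_prop)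
          fun x _ => ⟨ht.1.le, mem_univ _⟩))
      exact (hasWeakDeriv (u t)).inner_deriv hcd
        (HasCompactSupport.intro isCompact_Icc fun x hx => hs.dx t x ht.1.le (Or.inr hx))
    have d4 := (d3.const_smul (1 / 2 : ℝ)).mono (Ioi_subset_Ici ht.1.le)
    refine (d4.congr_deriv ?_).congr (fun s _ => ?_) ?_
    · rw [e3]
      simp only [inner_add_left, inner_sub_left, inner_add_right, inner_sub_right, smul_eq_mul]
      ring
    all_goals
      simp only [Pi.smul_apply, Pi.add_apply, inner_add_left,
        inner_sub_left, smul_eq_mul]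
      ring
  have := intervalIntegral.integral_eq_sub_of_hasDeriv_right_of_le hT2 hcont hder
    (((hi hv k2).add (hi huL k4)).add (hi hf k1))
  rw [this, hs.cls_eq_zero hT2 h12, inner_zero_right, zero_sub]

/-! ### Weak solutions are mild solutions -/

theorem hasDerivWithinAt_integral_timeInterval {X : Type*} [NormedAddCommGroup X] [NormedSpace ℝ X]
    [CompleteSpace X] {h : ℝ → X} {T : EReal} (hh : ContinuousOn h (timeInterval T)) {t : ℝ}
    (ht : t ∈ timeInterval T) : HasDerivWithinAt (fun t => ∫ s in (0 : ℝ)..t, h s) (h t) (Ici 0) t := by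
  obtain ⟨T₂, h12, h2⟩ := exists_between_time ht.2
  have hT2 : 0 ≤ T₂ := ht.1.trans h12.le
  -- Clamping the time to `[0, T₂]` extends the integrand continuously to the whole line without
  -- changing it near t.
  set c : ℝ → ℝ := fun s => max 0 (min s T₂) with hc
  have hcm : ∀ s, c s ∈ timeInterval T := fun s =>
    Icc_subset_timeInterval h2 ⟨le_max_left _ _, max_le hT2 (min_le_right _ _)⟩
  have hcc : Continuous fun s => h (c s) := hh.comp_continuous (by fun_prop) hcm
  have hce : ∀ s, 0 ≤ s → s ≤ T₂ → c s = s := fun s h0 h1 => by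
    simp only [hc]; rw [min_eq_left h1, max_eq_right h0]
  have d := (intervalIntegral.integral_hasDerivAt_right (hcc.intervalIntegrable 0 t)
    (hcc.stronglyMeasurableAtFilter _ _) hcc.continuousAt).hasDerivWithinAt (s := Ici 0)
  have heq : ∀ r, 0 ≤ r → r ≤ T₂ → ∫ s in (0 : ℝ)..r, h s = ∫ s in (0 : ℝ)..r, h (c s) := by
    intro r h0 h1
    refine intervalIntegral.integral_congr fun s hs => ?_
    rw [uIcc_of_le h0] at hs
    rw [hce s hs.1 (hs.2.trans h1)]
  rw [hce t ht.1 h12.le] at d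
  refine d.congr_of_eventuallyEq ?_ (heq t ht.1 h12.le)
  filter_upwards [self_mem_nhdsWithin, mem_nhdsWithin_of_mem_nhds (Iio_mem_nhds h12)] with r hr hr'
  exact heq r hr (le_of_lt hr')

theorem eq_of_hasDerivWithinAt_eq {X : Type*} [NormedAddCommGroup X] [NormedSpace ℝ X]
    {f g f' : ℝ → X} {T : EReal}
    (hf : ∀ t ∈ timeInterval T, HasDerivWithinAt f (f' t) (Ici 0) t)
    (hg : ∀ t ∈ timeInterval T, HasDerivWithinAt g (f' t) (Ici 0) t) (h0 : f 0 = g 0) {t : ℝ}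
    (ht : t ∈ timeInterval T) : f t = g t := by
  have hsub := Icc_subset_timeInterval ht.2
  have hd : ∀ s ∈ timeInterval T, HasDerivWithinAt (fun s => f s - g s) 0 (Ici 0) s := fun s hs =>
    ((hf s hs).fun_sub (hg s hs)).congr_deriv (sub_self _)
  have := constant_of_has_deriv_right_zero (f := fun s => f s - g s) (a := 0) (b := t)
    (fun s hs => (hd s (hsub hs)).continuousWithinAt.mono fun r hr => hr.1)
    (fun s hs => (hd s (hsub ⟨hs.1, hs.2.le⟩)).mono (Ici_subset_Ici.2 hs.1)) t ⟨ht.1, le_rfl⟩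
  simp only [h0, sub_self] at this
  exact sub_eq_zero.1 this

/-- A du Bois-Reymond lemma on `[0,T)`. -/
theorem eq_zero_of_forall_integral_test {γ : ℝ → ℝ} {A : ℝ} {T : EReal} (hT : 0 < T)
    (hγ : ContinuousOn γ (timeInterval T))
    (h : ∀ η : ℝ → ℝ, ContDiff ℝ ∞ η → HasCompactSupport η → ∀ T₁ T₂ : ℝ, 0 ≤ T₁ → T₁ < T₂ →
      (T₂ : EReal) < T → (∀ t, T₁ < t → η t = 0) → ∫ t in (0 : ℝ)..T₂, η t * γ t = η 0 * A) :
    (∀ t ∈ timeInterval T, γ t = 0) ∧ A = 0 := by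
  have hpos : ∀ S : ℝ, 0 < S → (S : EReal) < T → ∀ t ∈ Icc 0 S, γ t = 0 := by
    intro S hS hST
    obtain ⟨T₂, h12, h2⟩ := exists_between_time hST
    have hc : ContinuousOn γ (Icc 0 S) := hγ.mono (Icc_subset_timeInterval hST)
    have hae : ∀ᵐ t, t ∈ Ioo 0 S → γ t = 0 := by
      refine isOpen_Ioo.ae_eq_zero_of_integral_contDiff_smul_eq_zero
        ((hc.mono Ioo_subset_Icc_self).locallyIntegrableOn measurableSet_Ioo) ?_
      intro η hη hs hU
      have hz : ∀ t, t ∉ Ioo 0 S → η t = 0 := fun t ht =>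
        image_eq_zero_of_notMem_tsupport fun h => ht (hU h)
      have h1 := h η hη hs S T₂ hS.le h12 h2 fun t ht => hz t fun h => by linarith [h.2]
      rw [hz 0 (by simp), zero_mul, intervalIntegral.integral_of_le (hS.le.trans h12.le)] at h1
      rw [← h1, setIntegral_eq_integral_of_forall_compl_eq_zero]
      · rfl
      · intro t ht
        rw [hz t fun h => ht ⟨h.1, by linarith [h.2]⟩, zero_mul]
    have hae' : γ =ᵐ[volume.restrict (Icc 0 S)] fun _ => 0 := by
      rw [← restrict_Ioo_eq_restrict_Icc]
      exact (ae_restrict_iff' measurableSet_Ioo).2 hae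
    exact Measure.eqOn_Icc_of_ae_eq volume hS.ne hae' hc continuousOn_const
  have hzero : ∀ t ∈ timeInterval T, γ t = 0 := by
    intro t ht
    obtain ⟨S, h1, h2⟩ := exists_between_time ht.2
    exact hpos S (ht.1.trans_lt h1) h2 t ⟨ht.1, h1.le⟩
  refine ⟨hzero, ?_⟩
  obtain ⟨S, h1, h2⟩ := exists_between_time (T₁ := 0) (by simpa using hT)
  -- Once γ vanishes, a bump with η 0 = 1 supported before S isolates A.
  let η : ContDiffBump (0 : ℝ) := ⟨S / 4, S / 2, by linarith, by linarith⟩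
  have h3 := h η η.contDiff η.hasCompactSupport (S / 2) S (by linarith) (by linarith) h2
    fun t ht => by
      refine η.zero_of_le_dist ?_
      rw [dist_zero_right, Real.norm_eq_abs]
      exact ht.le.trans (le_abs_self t)
  have h4 : η 0 = 1 := η.one_of_mem_closedBall (by simp [η]; linarith)
  rw [h4, one_mul] at h3
  rw [← h3]
  have : ∫ t in (0 : ℝ)..S, η t * γ t = ∫ t in (0 : ℝ)..S, (0 : ℝ) := by
    refine intervalIntegral.integral_congr fun t ht => ?_
    rw [uIcc_of_le h1.le] at ht
    rw [hpos S h1 h2 t ht, mul_zero]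
  rw [this, intervalIntegral.integral_zero]

/-- A product rule in which ρ is norm continuous but differentiable only against the fixed vector `G
t`: the slope of the pairing is ⟨ρ τ, slope of G⟩ plus the slope of ⟨ρ ·, G t⟩. -/
theorem hasDerivWithinAt_inner_of_continuous {ρ G : ℝ → L2} {G' : L2} {m : ℝ} {s : Set ℝ} {t : ℝ}
    (hρ : ContinuousWithinAt ρ s t) (hG : HasDerivWithinAt G G' s t)
    (h : HasDerivWithinAt (fun τ => inner ℝ (ρ τ) (G t)) m s t) :
    HasDerivWithinAt (fun τ => inner ℝ (ρ τ) (G τ)) (inner ℝ (ρ t) G' + m) s t := by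
  rw [hasDerivWithinAt_iff_tendsto_slope] at *
  have h1 : Tendsto (fun τ => inner ℝ (ρ τ) (slope G t τ)) (𝓝[s \ {t}] t) (𝓝 (inner ℝ (ρ t) G')) :=
    Tendsto.inner (hρ.mono_left (nhdsWithin_mono _ sdiff_subset)) hG
  refine (h1.add h).congr fun τ => ?_
  simp only [slope, vsub_eq_sub, inner_smul_right, inner_sub_right, smul_eq_mul]
  ring

theorem HasWeakDeriv.unique {f v w : L2} (hv : HasWeakDeriv f v) (hw : HasWeakDeriv f w) : v = w := by
  rw [hasWeakDeriv_iff] at hv hw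
  refine eq_of_inner_test fun φ hφ hs => ?_
  linarith [hv φ hφ hs, hw φ hφ hs]

theorem H1.ext_toL2 {f g : H1} (h : toL2 f = toL2 g) : f = g :=
  H1.ext h ((hasWeakDeriv f).unique (h ▸ hasWeakDeriv g))

variable {a : ℝ → ℝ → ℝ} {p : ℝ}

/-- The weak formulation tested with `χ(t) φ(x)`. -/
theorem IsSolution.product_test (ha : IsDamping a) (hp : 1 < p) {T : EReal} {u : ℝ → H1} {u₀ : H1}
    {u₁ : L2} (h : IsSolution a p u₀ u₁ T u) {φ : ℝ → ℝ} (hφ : ContDiff ℝ ∞ φ)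
    (hφs : HasCompactSupport φ) {η : ℝ → ℝ} (hη : ContDiff ℝ ∞ η) {T₁ T₂ : ℝ} (h0 : 0 ≤ T₁)
    (h12 : T₁ < T₂) (h2 : (T₂ : EReal) < T) (hz : ∀ t, T₁ < t → η t = 0) :
    ∫ t in (0 : ℝ)..T₂, η t * (inner ℝ (velocity T u t) (cls φ)
      - (∫ s in (0 : ℝ)..t, (inner ℝ (toL2 (u s)) (cls (deriv (deriv φ)))
          + inner ℝ (force a p s (u s) (velocity T u s)) (cls φ)))
      - (inner ℝ u₁ (cls φ) + inner ℝ (toL2 u₀ - toL2 (u 0)) (cls fun x => a 0 x * φ x)))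
    = η 0 * inner ℝ (toL2 u₀ - toL2 (u 0)) (cls φ) := by
  obtain ⟨hT, hX, hw⟩ := h
  have hT2 : 0 ≤ T₂ := h0.trans h12.le
  -- This primitive of η vanishes after T₁, so χ(t) φ(x) is an admissible test function with time
  -- derivative η φ. A second integration by parts then expresses every term through η.
  set χ : ℝ → ℝ := fun t => ∫ s in T₁..t, η s with hχ
  have hχd : ∀ t, HasDerivAt χ (η t) t := fun t =>
    intervalIntegral.integral_hasDerivAt_right (hη.continuous.intervalIntegrable _ _)
      (hη.continuous.stronglyMeasurableAtFilter _ _) hη.continuous.continuousAt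
  have hχz : ∀ t, T₁ < t → χ t = 0 := by
    intro t ht
    simp only [hχ]
    rw [intervalIntegral.integral_of_le ht.le, setIntegral_congr_fun measurableSet_Ioc
      (fun s hs => hz s hs.1), integral_zero]
  have hχ2 : ContDiff ℝ 2 χ := by
    have : ContDiff ℝ (1 + 1) χ := by
      rw [contDiff_succ_iff_deriv]
      refine ⟨fun t => (hχd t).differentiableAt, by simp, ?_⟩
      have e : deriv χ = η := funext fun t => (hχd t).deriv
      rw [e]
      exact hη.of_le (by exact_mod_cast le_top)
    exact this
  have hφ2 : ContDiff ℝ 2 φ := by exact_mod_cast contDiff_infty.1 hφ 2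
  have hφ1 : ContDiff ℝ ∞ (deriv φ) := (contDiff_infty_iff_deriv.1 hφ).2
  have hφ11 : ContDiff ℝ ∞ (deriv (deriv φ)) := (contDiff_infty_iff_deriv.1 hφ1).2
  have mφ := hφ.continuous.memLp_of_hasCompactSupport (p := 2) (μ := (volume : Measure ℝ)) hφs
  have mφ2 := hφ11.continuous.memLp_of_hasCompactSupport (p := 2) (μ := (volume : Measure ℝ))
    hφs.deriv.deriv
  obtain ⟨M, hM⟩ := hφs.isCompact.isBounded.subset_closedBall 0
  set ψ : ℝ → ℝ → ℝ := fun t x => χ t * φ x with hψ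
  have hψ2 : IsC2 ψ := by
    refine ContDiff.contDiffOn ?_
    exact (hχ2.comp contDiff_fst).mul (hφ2.comp contDiff_snd)
  have hs : SuppIn T₁ |M| ψ := by
    intro t x ht hx
    rcases hx with hx | hx
    · simp only [hψ, hχz t hx, zero_mul]
    · simp only [hψ]
      rw [image_eq_zero_of_notMem_tsupport (f := φ), mul_zero]
      intro hx'
      have := hM hx'
      rw [Metric.mem_closedBall, dist_zero_right, Real.norm_eq_abs] at this
      exact hx (abs_le.1 (this.trans (le_abs_self M)))
  have e1 : ∀ t, 0 ≤ t → dt ψ t = fun x => η t * φ x := fun t ht => funext fun x =>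
    ((hχd t).mul_const (φ x)).hasDerivWithinAt.derivWithin (uniqueDiffOn_Ici 0 t ht)
  have e2 : ∀ t, dx (dx ψ) t = fun x => χ t * deriv (deriv φ) x := by
    intro t
    have : ∀ t x, dx ψ t x = χ t * deriv φ x := fun t x => by
      simp only [dx, hψ]
      exact deriv_const_mul _ (hφ2.differentiable (by norm_num) x)
    funext x
    simp only [dx] at this ⊢
    simp only [this]
    exact deriv_const_mul _ (hφ1.differentiable (by simp) x)
  have hv := hX.continuousOn_velocity
  have hu := hX.1
  have huL : ContinuousOn (fun t => toL2 (u t)) (timeInterval T) :=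
    continuous_toL2.comp_continuousOn hu
  have key := (weak_iff ha hp u₀ u₁ hu hv (fun t ht => hX.hasDerivWithinAt ht) hψ2 hs h0 h12 h2
    (abs_nonneg M)).1 (hw ψ (isTest_of_suppIn ((EReal.coe_lt_coe_iff.2 h12).trans h2) hψ2 hs))
  set α : ℝ → ℝ := fun t => inner ℝ (velocity T u t) (cls φ) with hα
  set β : ℝ → ℝ := fun s => inner ℝ (toL2 (u s)) (cls (deriv (deriv φ)))
          + inner ℝ (force a p s (u s) (velocity T u s)) (cls φ) with hβ
  set A := inner ℝ (toL2 u₀ - toL2 (u 0)) (cls φ) with hA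
  set B := inner ℝ u₁ (cls φ) + inner ℝ (toL2 u₀ - toL2 (u 0)) (cls fun x => a 0 x * φ x) with hB
  have hα_c : ContinuousOn α (timeInterval T) := hv.inner continuousOn_const
  have hβ_c : ContinuousOn β (timeInterval T) :=
    (huL.inner continuousOn_const).add ((continuousOn_force ha hp hu hv).inner continuousOn_const)
  have hsub := Icc_subset_timeInterval h2
  have maφ : MemLp (fun x => a 0 x * φ x) 2 volume := by
    have c0 : Continuous (a 0) := IsC2.continuous_right ha.contDiff le_rfl
    exact (c0.mul hφ.continuous).memLp_of_hasCompactSupport hφs.mul_left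
  have r1 : inner ℝ (toL2 u₀ - toL2 (u 0)) (cls (dt ψ 0) - cls (fun x => a 0 x * ψ 0 x))
        - inner ℝ u₁ (cls (ψ 0)) = η 0 * A - χ 0 * B := by
    have f1 : cls (ψ 0) = χ 0 • cls φ := cls_smul _ mφ
    have f2 : cls (fun x => a 0 x * ψ 0 x) = χ 0 • cls (fun x => a 0 x * φ x) := by
      rw [← cls_smul _ maφ]
      congr 1
      funext x
      simp only [hψ]
      ring
    rw [e1 0 le_rfl, cls_smul _ mφ, f1, f2, inner_sub_right, inner_smul_right, inner_smul_right,
      inner_smul_right]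
    ring
  have r2 : ∫ t in (0 : ℝ)..T₂, (inner ℝ (velocity T u t) (cls (dt ψ t))
        + inner ℝ (toL2 (u t)) (cls (dx (dx ψ) t))
        + inner ℝ (force a p t (u t) (velocity T u t)) (cls (ψ t)))
      = ∫ t in (0 : ℝ)..T₂, (η t * α t + χ t * β t) := by
    refine intervalIntegral.integral_congr fun t ht => ?_
    rw [uIcc_of_le hT2] at ht
    have f1 : cls (ψ t) = χ t • cls φ := cls_smul _ mφ
    rw [e1 t ht.1, e2 t, cls_smul _ mφ, cls_smul _ mφ2, f1, inner_smul_right, inner_smul_right,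
      inner_smul_right]
    simp only [hα, hβ]
    ring
  rw [r1, r2] at key
  have hΓd : ∀ t ∈ timeInterval T, HasDerivWithinAt (fun t => ∫ s in (0 : ℝ)..t, β s) (β t) (Ici 0) t :=
    fun t ht => hasDerivWithinAt_integral_timeInterval hβ_c ht
  have hΓc : ContinuousOn (fun t => ∫ s in (0 : ℝ)..t, β s) (Icc 0 T₂) := fun t ht =>
    (hΓd t (hsub ht)).continuousWithinAt.mono fun s hs => hs.1
  have hχc : Continuous χ := hχ2.continuous
  have ii : ∀ {F : ℝ → ℝ}, ContinuousOn F (Icc 0 T₂) → IntervalIntegrable F volume 0 T₂ := by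
    intro F hF
    apply ContinuousOn.intervalIntegrable
    rwa [uIcc_of_le hT2]
  have i1 : IntervalIntegrable (fun t => η t * α t) volume 0 T₂ :=
    ii (hη.continuous.continuousOn.mul (hα_c.mono hsub))
  have i2 : IntervalIntegrable (fun t => χ t * β t) volume 0 T₂ :=
    ii (hχc.continuousOn.mul (hβ_c.mono hsub))
  have i3 : IntervalIntegrable (fun t => η t * ∫ s in (0 : ℝ)..t, β s) volume 0 T₂ :=
    ii (hη.continuous.continuousOn.mul hΓc)
  have i4 : IntervalIntegrable (fun t => η t * B) volume 0 T₂ :=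
    ii (hη.continuous.continuousOn.mul continuousOn_const)
  have p1 : ∫ t in (0 : ℝ)..T₂, (η t * (∫ s in (0 : ℝ)..t, β s) + χ t * β t) = 0 := by
    have := intervalIntegral.integral_eq_sub_of_hasDeriv_right_of_le hT2
      (f := fun t => χ t * ∫ s in (0 : ℝ)..t, β s) (hχc.continuousOn.mul hΓc)
      (fun t ht => ((hχd t).hasDerivWithinAt.mul (hΓd t (hsub ⟨ht.1.le, ht.2.le⟩))).mono
        (Ioi_subset_Ici ht.1.le)) (i3.add i2)
    rw [this, hχz T₂ h12]
    simp
  have p2 : ∫ t in (0 : ℝ)..T₂, η t * B = - (χ 0 * B) := by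
    have := intervalIntegral.integral_eq_sub_of_hasDerivAt (f := fun t => χ t * B)
      (f' := fun t => η t * B) (a := 0) (b := T₂) (fun t _ => (hχd t).mul_const B) i4
    rw [this, hχz T₂ h12]
    ring
  rw [intervalIntegral.integral_add i3 i2] at p1
  rw [intervalIntegral.integral_add i1 i2] at key
  simp only [mul_sub]
  rw [intervalIntegral.integral_sub (i1.sub i3) i4, intervalIntegral.integral_sub i1 i3, p2]
  linarith

/-- The function η and its value at 0 are both free, so the du Bois-Reymond lemma gives u(0) = u₀
together with the equation integrated in time. Its value at t = 0 is u_t(0) = u₁, and its derivative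
is the last claim. -/
theorem IsSolution.initial_and_deriv (ha : IsDamping a) (hp : 1 < p) {T : EReal} {u : ℝ → H1}
    {u₀ : H1} {u₁ : L2} (h : IsSolution a p u₀ u₁ T u) :
    u 0 = u₀ ∧ velocity T u 0 = u₁ ∧ ∀ φ : ℝ → ℝ, ContDiff ℝ ∞ φ → HasCompactSupport φ →
      ∀ t ∈ timeInterval T, HasDerivWithinAt (fun t => inner ℝ (velocity T u t) (cls φ))
        (inner ℝ (force a p t (u t) (velocity T u t)) (cls φ)
          - inner ℝ (wd (u t)) (cls (deriv φ))) (Ici 0) t := by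
  have hT := h.1
  have hv := h.2.1.continuousOn_velocity
  have hu := h.2.1.1
  have huL : ContinuousOn (fun t => toL2 (u t)) (timeInterval T) :=
    continuous_toL2.comp_continuousOn hu
  have hβ_c : ∀ φ : ℝ → ℝ, ContinuousOn (fun s => inner ℝ (toL2 (u s)) (cls (deriv (deriv φ)))
          + inner ℝ (force a p s (u s) (velocity T u s)) (cls φ)) (timeInterval T) := fun φ =>
    (huL.inner continuousOn_const).add ((continuousOn_force ha hp hu hv).inner continuousOn_const)
  have key := fun (φ : ℝ → ℝ) (hφ : ContDiff ℝ ∞ φ) (hs : HasCompactSupport φ) =>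
    eq_zero_of_forall_integral_test hT
      (γ := fun t => inner ℝ (velocity T u t) (cls φ)
      - (∫ s in (0 : ℝ)..t, (inner ℝ (toL2 (u s)) (cls (deriv (deriv φ)))
          + inner ℝ (force a p s (u s) (velocity T u s)) (cls φ)))
      - (inner ℝ u₁ (cls φ) + inner ℝ (toL2 u₀ - toL2 (u 0)) (cls fun x => a 0 x * φ x)))
      (A := inner ℝ (toL2 u₀ - toL2 (u 0)) (cls φ))
      (((hv.inner continuousOn_const).sub (fun t ht =>
        (hasDerivWithinAt_integral_timeInterval (hβ_c φ) ht).continuousWithinAt.mono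
          fun s hs => hs.1)).sub continuousOn_const)
      (fun η hη _ T₁ T₂ h0 h12 h2 hz => h.product_test ha hp hφ hs hη h0 h12 h2 hz)
  have hu0 : toL2 u₀ - toL2 (u 0) = 0 := eq_zero_of_inner_test fun φ hφ hs => (key φ hφ hs).2
  have hv0 : velocity T u 0 = u₁ := by
    refine eq_of_inner_test fun φ hφ hs => ?_
    have := (key φ hφ hs).1 0 (zero_mem_timeInterval hT)
    rw [hu0] at this
    simp only [intervalIntegral.integral_same, inner_zero_left] at this
    linarith
  refine ⟨H1.ext_toL2 (sub_eq_zero.1 hu0).symm, hv0, fun φ hφ hs t ht => ?_⟩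
  have hφ1 : ContDiff ℝ 1 (deriv φ) := ((contDiff_infty_iff_deriv.1 hφ).2).of_le (by simp)
  have d := (hasDerivWithinAt_integral_timeInterval (hβ_c φ) ht).add_const (inner ℝ u₁ (cls φ))
  rw [(hasWeakDeriv (u t)).inner_deriv hφ1 hs.deriv] at d
  refine (d.congr_deriv (by ring)).congr_of_eventuallyEq ?_ ?_
  · filter_upwards [nhdsWithin_timeInterval ht ▸ self_mem_nhdsWithin] with s hs'
    have := (key φ hφ hs).1 s hs'
    rw [hu0] at this
    simp only [inner_zero_left] at this
    linarith
  · have := (key φ hφ hs).1 t ht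
    rw [hu0] at this
    simp only [inner_zero_left] at this
    linarith

/-- Paired with a test function carried along the characteristic, the invariant u_t + σ u_x, σ = ±1,
has the force as its derivative. The translated invariant is thus its initial value plus the
L²-valued integral of the translated force, whose continuity yields strong differentiability. -/
theorem IsSolution.isMild (ha : IsDamping a) (hp : 1 < p) {T : EReal} {u : ℝ → H1}
    {u₀ : H1} {u₁ : L2} (h : IsSolution a p u₀ u₁ T u) :
    u 0 = u₀ ∧ velocity T u 0 = u₁ ∧ IsMild a p T u (velocity T u) := by
  obtain ⟨hu0, hv0, hd⟩ := h.initial_and_deriv ha hp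
  refine ⟨hu0, hv0, ?_⟩
  have hv := h.2.1.continuousOn_velocity
  have hu := h.2.1.1
  have hf := continuousOn_force ha hp hu hv
  have hwd : ContinuousOn (fun t => wd (u t)) (timeInterval T) := continuous_wd.comp_continuousOn hu
  have key : ∀ σ : ℝ, σ * σ = 1 → ∀ t ∈ timeInterval T,
      HasDerivWithinAt (fun t => shift (-(σ * t)) (velocity T u t + σ • wd (u t)))
        (shift (-(σ * t)) (force a p t (u t) (velocity T u t))) (Ici 0) t := by
    intro σ hσ
    have hS : ContinuousOn (fun t => shift (-(σ * t)) (force a p t (u t) (velocity T u t)))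
        (timeInterval T) := fun t ht =>
      continuousWithinAt_shift (c := fun t => -(σ * t)) (by fun_prop) (hf t ht)
    have hρ : ContinuousOn (fun t => velocity T u t + σ • wd (u t)) (timeInterval T) :=
      hv.add (hwd.const_smul σ)
    have hρd : ∀ φ : ℝ → ℝ, ContDiff ℝ ∞ φ → HasCompactSupport φ → ∀ t ∈ timeInterval T,
        HasDerivWithinAt (fun t => inner ℝ (velocity T u t + σ • wd (u t)) (cls φ))
          (inner ℝ (force a p t (u t) (velocity T u t)) (cls φ)
            - σ * inner ℝ (velocity T u t + σ • wd (u t)) (cls (deriv φ))) (Ici 0) t := by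
      intro φ hφ hs t ht
      have d1 := (h.2.1.hasDerivWithinAt ht).inner ℝ
        (hasDerivWithinAt_const t (Ici 0) (cls (deriv φ)))
      rw [inner_zero_right, zero_add] at d1
      have d2 := (hd φ hφ hs t ht).fun_sub (d1.const_mul σ)
      have e : ∀ t, inner ℝ (velocity T u t + σ • wd (u t)) (cls φ)
          = inner ℝ (velocity T u t) (cls φ) - σ * inner ℝ (toL2 (u t)) (cls (deriv φ)) := by
        intro t
        rw [inner_add_left, real_inner_smul_left,
          (hasWeakDeriv (u t)).inner_deriv (hφ.of_le (by simp)) hs]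
        ring
      refine (d2.congr_deriv ?_).congr (fun s _ => e s) (e t)
      rw [inner_add_left, real_inner_smul_left]
      linear_combination inner ℝ (wd (u t)) (cls (deriv φ)) * hσ
    have hRd : ∀ φ : ℝ → ℝ, ContDiff ℝ ∞ φ → HasCompactSupport φ → ∀ t ∈ timeInterval T,
        HasDerivWithinAt (fun t => inner ℝ (shift (-(σ * t)) (velocity T u t + σ • wd (u t))) (cls φ))
          (inner ℝ (shift (-(σ * t)) (force a p t (u t) (velocity T u t))) (cls φ)) (Ici 0) t := by
      intro φ hφ hs t ht
      have mφ := hφ.continuous.memLp_of_hasCompactSupport (p := 2) (μ := (volume : Measure ℝ)) hs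
      have mφ' := (hφ.continuous_deriv (by simp)).memLp_of_hasCompactSupport (p := 2)
        (μ := (volume : Measure ℝ)) hs.deriv
      have dG : HasDerivWithinAt (fun τ => shift (σ * τ) (cls φ))
          (σ • shift (σ * t) (cls (deriv φ))) (Ici 0) t := by
        have h1 := hasDerivAt_shift_cls (hφ.of_le (by simp)) hs (σ * t)
        have h2 : HasDerivAt (fun τ => σ * τ) σ t := by
          simpa using (hasDerivAt_id t).const_mul σ
        exact (h1.scomp t h2).hasDerivWithinAt
      have d1 := hρd _ (contDiff_shift hφ (σ * t)) (hasCompactSupport_shift hs (σ * t)) t ht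
      have e1 : cls (deriv fun x => φ (x + σ * t)) = shift (σ * t) (cls (deriv φ)) := by
        rw [shift_cls _ mφ']
        congr 1
        funext x
        rw [deriv_comp_add_const]
      rw [e1] at d1
      simp only [← shift_cls _ mφ] at d1
      have hρt : ContinuousWithinAt (fun t => velocity T u t + σ • wd (u t)) (Ici 0) t := by
        have := hρ t ht
        rwa [ContinuousWithinAt, nhdsWithin_timeInterval ht] at this
      have d2 := hasDerivWithinAt_inner_of_continuous hρt dG d1
      simp only [inner_shift, neg_neg]
      refine d2.congr_deriv ?_
      rw [inner_smul_right]
      ring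
    have hint : ∀ t ∈ timeInterval T, shift (-(σ * t)) (velocity T u t + σ • wd (u t))
        = (velocity T u 0 + σ • wd (u 0))
          + ∫ s in (0 : ℝ)..t, shift (-(σ * s)) (force a p s (u s) (velocity T u s)) := by
      intro t ht
      refine eq_of_inner_test fun φ hφ hs => ?_
      refine eq_of_hasDerivWithinAt_eq
        (f := fun t => inner ℝ (shift (-(σ * t)) (velocity T u t + σ • wd (u t))) (cls φ))
        (g := fun t => inner ℝ ((velocity T u 0 + σ • wd (u 0))
          + ∫ s in (0 : ℝ)..t, shift (-(σ * s)) (force a p s (u s) (velocity T u s))) (cls φ))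
        (hRd φ hφ hs) (fun t ht => ?_) ?_ ht
      · have := ((hasDerivWithinAt_integral_timeInterval hS ht).const_add
          (velocity T u 0 + σ • wd (u 0))).inner ℝ (hasDerivWithinAt_const t (Ici 0) (cls φ))
        simpa using this
      · simp [shift_zero]
    intro t ht
    refine ((hasDerivWithinAt_integral_timeInterval hS ht).const_add
      (velocity T u 0 + σ • wd (u 0))).congr_of_eventuallyEq ?_ (hint t ht)
    filter_upwards [nhdsWithin_timeInterval ht ▸ self_mem_nhdsWithin] with s hs
    exact hint s hs
  refine ⟨fun t ht htT => h.2.1.hasDerivWithinAt ⟨ht, htT⟩, fun t ht htT => ?_, fun t ht htT => ?_⟩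
  · simpa using key 1 (by norm_num) t ⟨ht, htT⟩
  · simpa [sub_eq_add_neg] using key (-1) (by norm_num) t ⟨ht, htT⟩

/-! ### The blow-up alternative -/

theorem conjState_wave (w : ℝ → H1 × L2) (t : ℝ) :
    conjState (fun t => waveFst t (w t)) (fun t => waveSnd t (w t)) t = w t := by
  have hL : waveSnd t (w t) + wd (waveFst t (w t)) = shift t (riemL (w t)) := by
    simp only [waveFst_apply, waveSnd_apply, wd_add, wd_sub, wd_prim, riemL_apply, riemR_apply]
    module
  have hR : waveSnd t (w t) - wd (waveFst t (w t)) = shift (-t) (riemR (w t)) := by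
    simp only [waveFst_apply, waveSnd_apply, wd_add, wd_sub, wd_prim, riemL_apply, riemR_apply]
    module
  simp only [conjState, hL, hR, shift_neg_shift, shift_shift_neg]
  refine Prod.ext ?_ ?_
  · simp only [waveFst_apply]
    abel
  · simp only [riemL_apply, riemR_apply]
    module

/-- If there is no global solution, the local solution blows up in finite time. -/
theorem blowsUpInFiniteTime_of_no_global {a : ℝ → ℝ → ℝ} {p : ℝ} (ha : IsDamping a) (hp : 1 < p)
    {u₀ : H1} {u₁ : L2} (hno : ∀ u, ¬ IsSolution a p u₀ u₁ ⊤ u) :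
    BlowsUpInFiniteTime a p u₀ u₁ := by
  have hw0 : ∀ w : ℝ → H1 × L2, w 0 = (u₀, u₁) →
      waveFst 0 (w 0) = u₀ ∧ waveSnd 0 (w 0) = u₁ := by
    intro w hw
    rw [hw, waveFst_apply, waveSnd_apply]
    simp only [neg_zero, prim_zero, shift_zero, riemL_apply, riemR_apply]
    constructor
    · abel
    · module
  rcases (isLocLip_field ha hp).exists_maximal (u₀, u₁) with ⟨w, hw, hsol⟩ | ⟨T, hT, w, hw, hsol, hlim, hmax⟩
  · have := (hsol.isMild.isSolution ha hp (by simp)).1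
    rw [(hw0 w hw).1, (hw0 w hw).2] at this
    exact (hno _ this).elim
  have hTpos : (0 : EReal) < T := by exact_mod_cast hT
  obtain ⟨hs, hvel⟩ := hsol.isMild.isSolution ha hp hTpos
  rw [(hw0 w hw).1, (hw0 w hw).2] at hs
  refine ⟨T, hT, fun t => waveFst t (w t), hs, ?_, fun T' v hv => ?_⟩
  -- Before the finite time T the conjugated state is at most 2T + 3 times the norm of the actual
  -- state, by `norm_conjState_le`, so blow-up passes to the latter.
  · have h1 : Tendsto (fun t => (2 * T + 3)⁻¹ * ‖w t‖) (𝓝[<] T) atTop :=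
      hlim.const_mul_atTop (by positivity)
    refine tendsto_atTop_mono' _ ?_ h1
    filter_upwards [self_mem_nhdsWithin, mem_nhdsWithin_of_mem_nhds (Ioi_mem_nhds hT)] with t ht ht'
    have ht0 : 0 < t := ht'
    have htT : t < T := ht
    rw [hvel t ⟨ht0.le, by exact_mod_cast htT⟩, inv_mul_le_iff₀ (by positivity)]
    have h2 := norm_conjState_le (fun t => waveFst t (w t)) (fun t => waveSnd t (w t)) t
    rw [conjState_wave, abs_of_pos ht0] at h2
    refine h2.trans ?_
    gcongr
  · obtain ⟨hv0, hv1, hm⟩ := hv.isMild ha hp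
    have hode := hm.isODESol
    have hinit : conjState v (velocity T' v) 0 = (u₀, u₁) := by rw [conjState_zero, hv0, hv1]
    have hle : T' ≤ T := by
      by_contra hcon
      obtain ⟨S, h1, h2⟩ := exists_between_time (not_le.1 hcon)
      exact absurd (hmax S _ (hT.trans h1) hinit (hode.mono h2.le)) (not_le.2 h1)
    refine ⟨hle, fun t ht => ?_⟩
    have := hode.unique (isLocLip_field ha hp) (hsol.mono hle) (by rw [hinit, hw]) ht.1 ht.2
    change v t = waveFst t (w t)
    rw [← this, waveFst_conjState]

/-! ### Integrals along rays -/

/-- The weight `1 + max(t,0)`. -/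
def wt (t : ℝ) : ℝ := 1 + max t 0

theorem one_le_wt (t : ℝ) : 1 ≤ wt t := by simp [wt]
theorem wt_pos (t : ℝ) : 0 < wt t := zero_lt_one.trans_le (one_le_wt t)
theorem wt_of_nonneg {t : ℝ} (ht : 0 ≤ t) : wt t = 1 + t := by simp [wt, ht]
theorem wt_max (t : ℝ) : wt (max t 0) = wt t := by simp [wt]
theorem continuous_wt : Continuous wt := by unfold wt; fun_prop
theorem continuous_wt_rpow (s : ℝ) : Continuous fun t => wt t ^ s :=
  continuous_wt.rpow_const fun t => Or.inl (wt_pos t).ne'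

theorem wt_rpow_mul_neg (t s : ℝ) : wt t ^ s * wt t ^ (-s) = 1 := by
  rw [← Real.rpow_add (wt_pos t), add_neg_cancel, Real.rpow_zero]

/-- The weight along a ray is compared with wt t + σ, whose powers integrate explicitly. The factor
pays for the frozen part t < 0 and equals 1 at t₀ = 0, so no constant is lost where the contraction
needs sharpness. -/
theorem wt_add_le {t₀ t : ℝ} (ht : t₀ ≤ t) (σ : ℝ) :
    wt t + σ ≤ (1 + |t₀|) * wt (t + σ) := by
  have h1 := neg_abs_le t₀
  have h2 := abs_nonneg t₀
  have h3 : 0 ≤ |t₀| * max (t + σ) 0 := mul_nonneg h2 (le_max_right _ _)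
  have h4 : t + σ ≤ max (t + σ) 0 := le_max_left _ _
  have h5 : 0 ≤ max (t + σ) 0 := le_max_right _ _
  unfold wt
  rcases le_total 0 t with h | h
  · rw [max_eq_left h]
    nlinarith
  · rw [max_eq_right h]
    nlinarith

/-- `|c(t,x)| ≤ C (1+max(t,0))^(-κ)` for `t ≥ t₀`. -/
def DecayFrom (t₀ C κ : ℝ) (c : ℝ → ℝ → ℝ) : Prop := ∀ t x, t₀ ≤ t → |c t x| ≤ C * wt t ^ (-κ)

/-- A continuous function decaying like `t^(-κ)`, uniformly in `x` and on each half-plane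
`t ≥ t₀`. -/
structure Decays (κ : ℝ) (c : ℝ → ℝ → ℝ) : Prop where
  cont : Continuous fun q : ℝ × ℝ => c q.1 q.2
  decay : ∀ t₀, ∃ C, DecayFrom t₀ C κ c

/-- The integral of `c` along the ray starting at `(t,x)` with slope `ε`. -/
def ray (ε : ℝ) (c : ℝ → ℝ → ℝ) (t x : ℝ) : ℝ := ∫ σ in Ioi 0, c (t + σ) (x + ε * σ)

section ray

variable {κ ε t₀ C t x : ℝ} {c d : ℝ → ℝ → ℝ}

theorem DecayFrom.nonneg (hc : DecayFrom t₀ C κ c) : 0 ≤ C := by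
  have := (abs_nonneg _).trans (hc t₀ 0 le_rfl)
  exact nonneg_of_mul_nonneg_left this (Real.rpow_pos_of_pos (wt_pos _) _)

theorem DecayFrom.abs_le (hκ : 0 ≤ κ) (hc : DecayFrom t₀ C κ c) (ht : t₀ ≤ t) {σ : ℝ} (hσ : 0 ≤ σ)
    (y : ℝ) : |c (t + σ) y| ≤ C * (1 + |t₀|) ^ κ * (σ + wt t) ^ (-κ) := by
  have h1 : 0 < 1 + |t₀| := by positivity
  have h2 := wt_pos t
  have h3 := wt_pos (t + σ)
  refine (hc (t + σ) y (by linarith)).trans ?_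
  rw [mul_assoc]
  refine mul_le_mul_of_nonneg_left ?_ hc.nonneg
  have h4 : ((1 + |t₀|) * wt (t + σ)) ^ (-κ) ≤ (σ + wt t) ^ (-κ) :=
    Real.rpow_le_rpow_of_nonpos (by positivity) (by linarith [wt_add_le ht σ]) (by linarith)
  calc wt (t + σ) ^ (-κ) = (1 + |t₀|) ^ κ * ((1 + |t₀|) * wt (t + σ)) ^ (-κ) := by
        rw [Real.mul_rpow h1.le h3.le, ← mul_assoc, ← Real.rpow_add h1, add_neg_cancel,
          Real.rpow_zero, one_mul]
    _ ≤ _ := by gcongr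

theorem setIntegral_Ioi_comp_add (f : ℝ → ℝ) (a : ℝ) :
    ∫ σ in Ioi 0, f (σ + a) = ∫ s in Ioi a, f s := by
  have h := (measurePreserving_add_right volume a).setIntegral_preimage_emb
    (measurableEmbedding_addRight a) f (Ioi a)
  rwa [preimage_add_const_Ioi, sub_self] at h

theorem integrableOn_Ioi_comp_add {f : ℝ → ℝ} {a : ℝ} :
    IntegrableOn (fun σ => f (σ + a)) (Ioi 0) ↔ IntegrableOn f (Ioi a) := by
  have h := (measurePreserving_add_right volume a).integrableOn_comp_preimage
    (measurableEmbedding_addRight a) (f := f) (s := Ioi a)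
  rwa [preimage_add_const_Ioi, sub_self] at h

theorem integrableOn_wt (hκ : 1 < κ) (t C : ℝ) :
    IntegrableOn (fun σ => C * (σ + wt t) ^ (-κ)) (Ioi 0) :=
  (integrableOn_add_rpow_Ioi_of_lt (by linarith) (by linarith [wt_pos t])).const_mul C

theorem integral_wt (hκ : 1 < κ) (t : ℝ) :
    ∫ σ in Ioi 0, (σ + wt t) ^ (-κ) = wt t ^ (-(κ - 1)) / (κ - 1) := by
  rw [setIntegral_Ioi_comp_add (fun σ : ℝ => σ ^ (-κ)), integral_Ioi_rpow_of_lt (by linarith) (wt_pos t),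
    show -κ + 1 = -(κ - 1) by ring, neg_div_neg_eq]

/-- Integration along a ray costs one power of the weight and gains the factor 1/(κ - 1). With κ = k
+ 1 this is the 1/k behind the contraction. -/
theorem DecayFrom.ray (hκ : 1 < κ) (ε : ℝ) (hc : DecayFrom t₀ C κ c) :
    DecayFrom t₀ (C * (1 + |t₀|) ^ κ / (κ - 1)) (κ - 1) (ray ε c) := by
  intro t x ht
  have h := norm_integral_le_of_norm_le (μ := volume.restrict (Ioi 0))
    (f := fun σ => c (t + σ) (x + ε * σ)) (integrableOn_wt hκ t (C * (1 + |t₀|) ^ κ))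
    ((ae_restrict_iff' measurableSet_Ioi).2 (ae_of_all _ fun σ hσ =>
      hc.abs_le (by linarith) ht (le_of_lt hσ) _))
  rw [Real.norm_eq_abs, integral_const_mul, integral_wt hκ] at h
  refine h.trans (le_of_eq ?_)
  ring

theorem DecayFrom.ray_zero (hκ : 1 < κ) (ε : ℝ) (hc : DecayFrom 0 C κ c) :
    DecayFrom 0 (C / (κ - 1)) (κ - 1) (DampedWave.ray ε c) := by
  simpa using hc.ray hκ ε

theorem Decays.continuous_ray_integrand (hc : Decays κ c) (ε t x : ℝ) :
    Continuous fun σ => c (t + σ) (x + ε * σ) :=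
  hc.cont.comp (f := fun σ => (t + σ, x + ε * σ)) (by fun_prop)

theorem Decays.integrableOn (hκ : 1 < κ) (hc : Decays κ c) (ε t x : ℝ) :
    IntegrableOn (fun σ => c (t + σ) (x + ε * σ)) (Ioi 0) := by
  obtain ⟨C, hC⟩ := hc.decay t
  refine (integrableOn_wt hκ t (C * (1 + |t|) ^ κ)).mono'
    (hc.continuous_ray_integrand ε t x).aestronglyMeasurable ?_
  exact (ae_restrict_iff' measurableSet_Ioi).2 (ae_of_all _ fun σ hσ =>
      hC.abs_le (by linarith) le_rfl (le_of_lt hσ) _)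

theorem wt_anti_bound (hκ : 0 ≤ κ) (hC : 0 ≤ C) {σ : ℝ} (hσ : 0 < σ) (t : ℝ) :
    C * (σ + wt t) ^ (-κ) ≤ C * (σ + wt 0) ^ (-κ) := by
  refine mul_le_mul_of_nonneg_left (Real.rpow_le_rpow_of_nonpos ?_ ?_ (by linarith)) hC
  · linarith [wt_pos 0]
  · have := one_le_wt t
    simp [wt] at this ⊢

theorem Decays.continuous_ray (hκ : 1 < κ) (hc : Decays κ c) (ε : ℝ) :
    Continuous fun q : ℝ × ℝ => ray ε c q.1 q.2 := by
  rw [continuous_iff_continuousAt]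
  rintro ⟨t, x⟩
  obtain ⟨C, hC⟩ := hc.decay (t - 1)
  have hC0 : 0 ≤ C * (1 + |t - 1|) ^ κ := mul_nonneg hC.nonneg (by positivity)
  refine continuousAt_of_dominated (bound := fun σ => C * (1 + |t - 1|) ^ κ * (σ + wt 0) ^ (-κ))
    (F := fun (q : ℝ × ℝ) σ => c (q.1 + σ) (q.2 + ε * σ)) ?_ ?_ (integrableOn_wt hκ 0 _) ?_
  · exact Eventually.of_forall fun q => (hc.continuous_ray_integrand ε q.1 q.2).aestronglyMeasurable
  · have : ∀ᶠ q : ℝ × ℝ in 𝓝 (t, x), t - 1 < q.1 :=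
      continuous_fst.continuousAt.eventually (lt_mem_nhds (by simp))
    filter_upwards [this] with q hq
    refine (ae_restrict_iff' measurableSet_Ioi).2 (ae_of_all _ fun σ hσ => ?_)
    exact (hC.abs_le (by linarith) hq.le (le_of_lt hσ) _).trans
      (wt_anti_bound (by linarith) hC0 hσ _)
  · refine ae_of_all _ fun σ => ?_
    exact (hc.cont.comp (f := fun q : ℝ × ℝ => (q.1 + σ, q.2 + ε * σ)) (by fun_prop)).continuousAt

theorem Decays.ray (hκ : 1 < κ) (hc : Decays κ c) (ε : ℝ) : Decays (κ - 1) (ray ε c) := by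
  refine ⟨hc.continuous_ray hκ ε, fun t₀ => ?_⟩
  obtain ⟨C, hC⟩ := hc.decay t₀
  exact ⟨_, hC.ray hκ ε⟩

theorem Decays.hasDerivAt_ray (hκ : 1 < κ) (hc : Decays κ c) (hd : Decays κ d)
    (hcd : ∀ t x, HasDerivAt (fun y => c t y) (d t x) x) (ε t x : ℝ) :
    HasDerivAt (fun y => DampedWave.ray ε c t y) (DampedWave.ray ε d t x) x := by
  obtain ⟨C, hC⟩ := hd.decay t
  refine (hasDerivAt_integral_of_dominated_loc_of_deriv_le (μ := volume.restrict (Ioi 0))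
    (F := fun y σ => c (t + σ) (y + ε * σ)) (F' := fun y σ => d (t + σ) (y + ε * σ)) (s := univ)
    (bound := fun σ => C * (1 + |t|) ^ κ * (σ + wt t) ^ (-κ)) univ_mem
    (Eventually.of_forall fun y => (hc.continuous_ray_integrand ε t y).aestronglyMeasurable)
    (hc.integrableOn hκ ε t x) (hd.continuous_ray_integrand ε t x).aestronglyMeasurable
    ?_ (integrableOn_wt hκ t _) ?_).2
  · exact (ae_restrict_iff' measurableSet_Ioi).2 (ae_of_all _ fun σ hσ y _ =>
      hC.abs_le (by linarith) le_rfl (le_of_lt hσ) _)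
  · exact ae_of_all _ fun σ y _ => (hcd (t + σ) (y + ε * σ)).comp_add_const y (ε * σ)

theorem hasDerivAt_integral_Ioi {φ : ℝ → ℝ} (hφ : Continuous φ)
    (hi : ∀ a, IntegrableOn φ (Ioi a)) (τ : ℝ) :
    HasDerivAt (fun τ => ∫ s in Ioi τ, φ s) (-φ τ) τ := by
  have h : (fun τ => ∫ s in Ioi τ, φ s) = fun τ => (∫ s in Ioi 0, φ s) - ∫ s in (0 : ℝ)..τ, φ s := by
    funext τ
    rw [← intervalIntegral.integral_interval_add_Ioi (hi 0) (hi τ)]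
    ring
  rw [h]
  exact (intervalIntegral.integral_hasDerivAt_right (hφ.intervalIntegrable _ _)
    (hφ.stronglyMeasurableAtFilter _ _) hφ.continuousAt).const_sub _

/-- Along its own line the ray integral is the tail integral of a single function of one variable.
-/
theorem Decays.hasDerivAt_ray_along (hκ : 1 < κ) (hc : Decays κ c) (ε τ y : ℝ) :
    HasDerivAt (fun τ => DampedWave.ray ε c τ (y + ε * τ)) (-c τ (y + ε * τ)) τ := by
  have hcont : Continuous fun s => c s (y + ε * s) :=
    hc.cont.comp (f := fun s => (s, y + ε * s)) (by fun_prop)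
  have e : ∀ τ, (fun σ => c (τ + σ) (y + ε * τ + ε * σ)) = fun σ => (fun s => c s (y + ε * s)) (σ + τ) := by
    intro τ
    funext σ
    ring_nf
  have hi : ∀ a, IntegrableOn (fun s => c s (y + ε * s)) (Ioi a) := by
    intro a
    have := hc.integrableOn hκ ε a (y + ε * a)
    rw [e a] at this
    exact integrableOn_Ioi_comp_add.1 this
  have h : (fun τ => DampedWave.ray ε c τ (y + ε * τ)) = fun τ => ∫ s in Ioi τ, c s (y + ε * s) := by
    funext τ
    rw [DampedWave.ray, e τ, setIntegral_Ioi_comp_add (fun s => c s (y + ε * s))]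
  rw [h]
  exact hasDerivAt_integral_Ioi hcont hi τ

end ray

/-- `f` has the continuous partial derivatives `ft` and `fx`. -/
structure HasGrad (f ft fx : ℝ → ℝ → ℝ) : Prop where
  hasFDerivAt : ∀ t x, HasFDerivAt (fun q : ℝ × ℝ => f q.1 q.2)
    (ft t x • ContinuousLinearMap.fst ℝ ℝ ℝ + fx t x • ContinuousLinearMap.snd ℝ ℝ ℝ) (t, x)
  cont_t : Continuous fun q : ℝ × ℝ => ft q.1 q.2
  cont_x : Continuous fun q : ℝ × ℝ => fx q.1 q.2

namespace HasGrad

variable {f ft fx g gt gx : ℝ → ℝ → ℝ} {t x : ℝ}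

theorem of_partials (hft : ∀ t x, HasDerivAt (fun s => f s x) (ft t x) t)
    (hfx : ∀ t x, HasDerivAt (fun y => f t y) (fx t x) x)
    (ht : Continuous fun q : ℝ × ℝ => ft q.1 q.2) (hx : Continuous fun q : ℝ × ℝ => fx q.1 q.2) :
    HasGrad f ft fx := by
  refine ⟨fun t x => ?_, ht, hx⟩
  have h := hasStrictFDerivAt_uncurry_coprod (𝕜 := ℝ) (u := (t, x)) (f := f)
    (f₁ := fun t x => ContinuousLinearMap.toSpanSingleton ℝ (ft t x))
    (f₂ := fun t x => ContinuousLinearMap.toSpanSingleton ℝ (fx t x))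
    (Eventually.of_forall fun v => (hft v.1 v.2).hasFDerivAt)
    (Eventually.of_forall fun v => (hfx v.1 v.2).hasFDerivAt)
    ((ContinuousLinearMap.toSpanSingletonCLE (𝕜 := ℝ) (E := ℝ)).continuous.comp ht).continuousAt
    ((ContinuousLinearMap.toSpanSingletonCLE (𝕜 := ℝ) (E := ℝ)).continuous.comp hx).continuousAt
  refine h.hasFDerivAt.congr_fderiv ?_
  ext <;> simp [Function.HasUncurry.uncurry]

theorem hasDerivAt_left (h : HasGrad f ft fx) (t x : ℝ) :
    HasDerivAt (fun s => f s x) (ft t x) t := by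
  have h1 : HasDerivAt (fun s : ℝ => (s, x)) ((1 : ℝ), (0 : ℝ)) t :=
    (hasDerivAt_id t).prodMk (hasDerivAt_const t x)
  have h2 := (h.hasFDerivAt t x).comp_hasDerivAt t h1
  simpa [Function.comp_def] using h2

theorem hasDerivAt_right (h : HasGrad f ft fx) (t x : ℝ) :
    HasDerivAt (fun y => f t y) (fx t x) x := by
  have h1 : HasDerivAt (fun y : ℝ => (t, y)) ((0 : ℝ), (1 : ℝ)) x :=
    (hasDerivAt_const x t).prodMk (hasDerivAt_id x)
  have h2 := (h.hasFDerivAt t x).comp_hasDerivAt x h1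
  simpa [Function.comp_def] using h2

theorem contDiff_succ {n : ℕ} (h : HasGrad f ft fx) (ht : ContDiff ℝ n fun q : ℝ × ℝ => ft q.1 q.2)
    (hx : ContDiff ℝ n fun q : ℝ × ℝ => fx q.1 q.2) :
    ContDiff ℝ (n + 1) fun q : ℝ × ℝ => f q.1 q.2 :=
  contDiff_succ_iff_hasFDerivAt.2 ⟨fun q => ft q.1 q.2 • ContinuousLinearMap.fst ℝ ℝ ℝ
    + fx q.1 q.2 • ContinuousLinearMap.snd ℝ ℝ ℝ,
    (ht.smul contDiff_const).add (hx.smul contDiff_const), fun q => h.hasFDerivAt q.1 q.2⟩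

theorem contDiff_one (h : HasGrad f ft fx) : ContDiff ℝ 1 fun q : ℝ × ℝ => f q.1 q.2 := by
  have := h.contDiff_succ (n := 0) (by simpa using h.cont_t) (by simpa using h.cont_x)
  simpa using this

end HasGrad

/-- In the coordinates τ = t, y = x - εt both partial derivatives are explicit, with no
differentiability of c in time. A linear change of variables returns to (t, x). -/
theorem Decays.hasGrad_ray {κ : ℝ} {c d : ℝ → ℝ → ℝ} (hκ : 1 < κ) (hc : Decays κ c)
    (hd : Decays κ d) (hcd : ∀ t x, HasDerivAt (fun y => c t y) (d t x) x) (ε : ℝ) :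
    HasGrad (DampedWave.ray ε c) (fun t x => -c t x - ε * DampedWave.ray ε d t x)
      (DampedWave.ray ε d) := by
  have hs : Continuous fun q : ℝ × ℝ => (q.1, q.2 + ε * q.1) := by fun_prop
  have hdr := hd.continuous_ray hκ ε
  have h1 : HasGrad (fun τ y => DampedWave.ray ε c τ (y + ε * τ)) (fun τ y => -c τ (y + ε * τ))
      (fun τ y => DampedWave.ray ε d τ (y + ε * τ)) := by
    refine .of_partials (hc.hasDerivAt_ray_along hκ ε) ?_ (hc.cont.comp hs).neg (hdr.comp hs)
    exact fun τ y => (hc.hasDerivAt_ray hκ hd hcd ε τ (y + ε * τ)).comp_add_const y (ε * τ)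
  refine ⟨fun t x => ?_, hc.cont.neg.sub (hdr.const_mul ε), hdr⟩
  have hA : HasFDerivAt (fun q : ℝ × ℝ => (q.1, q.2 - ε * q.1))
      ((ContinuousLinearMap.fst ℝ ℝ ℝ).prod (ContinuousLinearMap.snd ℝ ℝ ℝ
        - ε • ContinuousLinearMap.fst ℝ ℝ ℝ)) (t, x) :=
    ((ContinuousLinearMap.fst ℝ ℝ ℝ).prod (ContinuousLinearMap.snd ℝ ℝ ℝ
        - ε • ContinuousLinearMap.fst ℝ ℝ ℝ)).hasFDerivAt
  have h2 := (h1.hasFDerivAt t (x - ε * t)).comp (t, x) hA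
  have e : ((fun q : ℝ × ℝ => DampedWave.ray ε c q.1 (q.2 + ε * q.1)) ∘
      fun q : ℝ × ℝ => (q.1, q.2 - ε * q.1)) = fun q => DampedWave.ray ε c q.1 q.2 := by
    funext q
    simp
  rw [e] at h2
  refine h2.congr_fderiv ?_
  ext
  · simp
    ring
  · simp

/-! ### The integral equation for the time derivative of the corrector -/

section corrector

open scoped BoundedContinuousFunction

variable {k κ C C' A β η s N M : ℝ} {c c' d q q' p p' F Fx B Bx : ℝ → ℝ → ℝ}

/-- `c` is continuous and `|c(t,x)| ≤ C (1+max(t,0))^(-κ)` on the whole plane. -/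
structure ContDecay (C κ : ℝ) (c : ℝ → ℝ → ℝ) : Prop where
  cont : Continuous fun q : ℝ × ℝ => c q.1 q.2
  bound : ∀ t x, |c t x| ≤ C * wt t ^ (-κ)

namespace ContDecay

theorem decayFrom (hc : ContDecay C κ c) (t₀ : ℝ) : DecayFrom t₀ C κ c := fun t x _ => hc.bound t x

theorem nonneg (hc : ContDecay C κ c) : 0 ≤ C := (hc.decayFrom 0).nonneg

theorem decays (hc : ContDecay C κ c) : Decays κ c := ⟨hc.cont, fun t₀ => ⟨C, hc.decayFrom t₀⟩⟩

theorem mono (hc : ContDecay C κ c) (h : C ≤ C') : ContDecay C' κ c :=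
  ⟨hc.cont, fun t x => (hc.bound t x).trans
    (mul_le_mul_of_nonneg_right h (Real.rpow_nonneg (wt_pos t).le _))⟩

theorem mul {κ' : ℝ} (hc : ContDecay C κ c) (hd : ContDecay C' κ' d) :
    ContDecay (C * C') (κ + κ') fun t x => c t x * d t x := by
  refine ⟨hc.cont.mul hd.cont, fun t x => ?_⟩
  rw [abs_mul, neg_add, Real.rpow_add (wt_pos t)]
  calc |c t x| * |d t x| ≤ (C * wt t ^ (-κ)) * (C' * wt t ^ (-κ')) :=
        mul_le_mul (hc.bound t x) (hd.bound t x) (abs_nonneg _) ((abs_nonneg _).trans (hc.bound t x))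
    _ = _ := by ring

theorem add (hc : ContDecay C κ c) (hd : ContDecay C' κ d) :
    ContDecay (C + C') κ fun t x => c t x + d t x := by
  refine ⟨hc.cont.add hd.cont, fun t x => (abs_add_le _ _).trans ?_⟩
  rw [add_mul]
  exact add_le_add (hc.bound t x) (hd.bound t x)

theorem neg (hc : ContDecay C κ c) : ContDecay C κ fun t x => -c t x :=
  ⟨hc.cont.neg, fun t x => by simpa using hc.bound t x⟩

theorem sub (hc : ContDecay C κ c) (hd : ContDecay C' κ d) :
    ContDecay (C + C') κ fun t x => c t x - d t x := by
  simpa [sub_eq_add_neg] using hc.add hd.neg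

theorem le_exponent {κ' : ℝ} (hc : ContDecay C κ c) (h : κ' ≤ κ) : ContDecay C κ' c :=
  ⟨hc.cont, fun t x => (hc.bound t x).trans (mul_le_mul_of_nonneg_left
    (Real.rpow_le_rpow_of_exponent_le (one_le_wt t) (by linarith)) hc.nonneg)⟩

theorem const (hC : 0 ≤ C) : ContDecay C 0 fun _ _ => C :=
  ⟨continuous_const, fun t x => by simp [abs_of_nonneg hC]⟩

end ContDecay

/-- The primitive in time, vanishing at infinity, extended by a constant to `t ≤ 0`. -/
def tprim (q : ℝ → ℝ → ℝ) (t x : ℝ) : ℝ := -ray 0 q (max t 0) x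

theorem ContDecay.tprim (hκ : 1 < κ) (hq : ContDecay C κ q) :
    ContDecay (C / (κ - 1)) (κ - 1) (tprim q) := by
  constructor
  · exact ((hq.decays.continuous_ray hκ 0).comp
      (f := fun q : ℝ × ℝ => (max q.1 0, q.2)) (by fun_prop)).neg
  · intro t x
    have := (hq.decayFrom 0).ray_zero hκ 0 (max t 0) x (le_max_right _ _)
    rwa [wt_max, ← abs_neg] at this

/-- Half the sum of the integrals of `-c` along the two characteristics. -/
def dal (c : ℝ → ℝ → ℝ) (t x : ℝ) : ℝ := -(ray (-1) c t x + ray 1 c t x) / 2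

theorem DecayFrom.dal (hκ : 1 < κ) (hc : DecayFrom 0 C κ c) :
    DecayFrom 0 (C / (κ - 1)) (κ - 1) (dal c) := by
  intro t x ht
  have h1 := _root_.abs_le.1 (hc.ray_zero hκ (-1) t x ht)
  have h2 := _root_.abs_le.1 (hc.ray_zero hκ 1 t x ht)
  rw [DampedWave.dal, _root_.abs_le]
  constructor <;> linarith [h1.1, h1.2, h2.1, h2.2]

theorem ray_sub (hκ : 1 < κ) (hc : Decays κ c) (hd : Decays κ d) (ε t x : ℝ) :
    ray ε (fun t x => c t x - d t x) t x = ray ε c t x - ray ε d t x :=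
  integral_sub (hc.integrableOn hκ ε t x) (hd.integrableOn hκ ε t x)

theorem dal_sub (hκ : 1 < κ) (hc : Decays κ c) (hd : Decays κ d) (t x : ℝ) :
    dal (fun t x => c t x - d t x) t x = dal c t x - dal d t x := by
  rw [dal, ray_sub hκ hc hd, ray_sub hκ hc hd, dal, dal]
  ring

theorem hasDerivAt_dal (hκ : 1 < κ) (hc : Decays κ c) (hd : Decays κ d)
    (h : ∀ t x, HasDerivAt (fun y => c t y) (d t x) x) (t x : ℝ) :
    HasDerivAt (fun y => dal c t y) (dal d t x) x :=
  (((hc.hasDerivAt_ray hκ hd h (-1) t x).fun_add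
    (hc.hasDerivAt_ray hκ hd h 1 t x)).fun_neg).div_const 2

/-- The right-hand side `F (s + ∂ₜ⁻¹ q) - B q`. -/
def src (F B : ℝ → ℝ → ℝ) (s : ℝ) (q : ℝ → ℝ → ℝ) (t x : ℝ) : ℝ :=
  F t x * (s + tprim q t x) - B t x * q t x

/-- The space derivative of `src F B s q`, where `p` is that of `q`. -/
def srcx (F Fx B Bx : ℝ → ℝ → ℝ) (s : ℝ) (q p : ℝ → ℝ → ℝ) (t x : ℝ) : ℝ :=
  src Fx Bx s q t x + src F B 0 p t x

/-- The source decays one power faster than q: F brings the exponent k + 1 by itself, and in B q the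
exponents 1 and k add up. The integration along characteristics uses up this power. -/
theorem ContDecay.src (hk : 1 < k) (hF : ContDecay A (k + 1) F) (hB : ContDecay β 1 B)
    (hs : 0 ≤ s) (hq : ContDecay N k q) :
    ContDecay (A * (s + N / (k - 1)) + β * N) (k + 1) (src F B s q) := by
  have h1 := hF.mul ((ContDecay.const hs).add ((hq.tprim hk).le_exponent (κ' := 0) (by linarith)))
  have h2 := hB.mul hq
  rw [add_zero] at h1
  rw [add_comm 1 k] at h2
  exact h1.sub h2

theorem ContDecay.srcx (hk : 1 < k) (hF : ContDecay A (k + 1) F) (hFx : ContDecay A (k + 1) Fx)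
    (hB : ContDecay β 1 B) (hBx : ContDecay η 1 Bx) (hs : 0 ≤ s) (hq : ContDecay N k q)
    (hp : ContDecay N k p) :
    ContDecay (A * (s + N / (k - 1)) + η * N + (A * (0 + N / (k - 1)) + β * N)) (k + 1)
      (srcx F Fx B Bx s q p) :=
  (hFx.src hk hBx hs hq).add (hF.src hk hB le_rfl hp)

/-- The map is affine: the constant s cancels in differences, which are therefore estimated by the
same bounds with s = 0. -/
theorem src_sub (hk : 1 < k) (hq : Decays k q) (hq' : Decays k q') (t x : ℝ) :
    src F B s q t x - src F B s q' t x = src F B 0 (fun t x => q t x - q' t x) t x := by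
  rw [src, src, src, tprim, tprim, tprim, ray_sub hk hq hq']
  ring

theorem hasDerivAt_src (hk : 1 < k) (hq : Decays k q) (hp : Decays k p)
    (h : ∀ t x, HasDerivAt (fun y => q t y) (p t x) x)
    (hF : ∀ t x, HasDerivAt (fun y => F t y) (Fx t x) x)
    (hB : ∀ t x, HasDerivAt (fun y => B t y) (Bx t x) x) (t x : ℝ) :
    HasDerivAt (fun y => src F B s q t y) (srcx F Fx B Bx s q p t x) x := by
  have h1 : HasDerivAt (fun y => tprim q t y) (tprim p t x) x :=
    (hq.hasDerivAt_ray hk hp h 0 (max t 0) x).fun_neg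
  refine (((hF t x).mul (h1.const_add s)).sub ((hB t x).mul (h t x))).congr_deriv ?_
  rw [srcx, src, src]
  ring

/-- A bounded continuous function, divided by the weight. -/
def unwt (k : ℝ) (z : ℝ × ℝ →ᵇ ℝ) (t x : ℝ) : ℝ := wt t ^ (-k) * z (t, x)

theorem contDecay_unwt (k : ℝ) (z : ℝ × ℝ →ᵇ ℝ) : ContDecay ‖z‖ k (unwt k z) := by
  constructor
  · exact ((continuous_wt_rpow (-k)).comp continuous_fst).mul z.continuous
  · intro t x
    have h := Real.rpow_pos_of_pos (wt_pos t) (-k)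
    rw [unwt, abs_mul, abs_of_pos h, mul_comm]
    exact mul_le_mul_of_nonneg_right (z.norm_coe_le_norm (t, x)) h.le

theorem unwt_sub (k : ℝ) (z z' : ℝ × ℝ →ᵇ ℝ) :
    (fun t x => unwt k z t x - unwt k z' t x) = unwt k (z - z') := by
  funext t x
  simp only [unwt, BoundedContinuousFunction.coe_sub, Pi.sub_apply]
  ring

/-- `wt ^ k • dal c`, frozen for `t ≤ 0`. -/
def wdal (k : ℝ) (c : ℝ → ℝ → ℝ) (v : ℝ × ℝ) : ℝ := wt v.1 ^ k * dal c (max v.1 0) v.2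

theorem abs_wdal_le (hk : 0 < k) (hc : ContDecay C (k + 1) c) (v : ℝ × ℝ) :
    |wdal k c v| ≤ C / k := by
  have h := (hc.decayFrom 0).dal (by linarith) (max v.1 0) v.2 (le_max_right _ _)
  rw [wt_max, add_sub_cancel_right] at h
  have h1 := Real.rpow_pos_of_pos (wt_pos v.1) k
  rw [wdal, abs_mul, abs_of_pos h1]
  calc wt v.1 ^ k * |dal c (max v.1 0) v.2| ≤ wt v.1 ^ k * (C / k * wt v.1 ^ (-k)) := by gcongr
    _ = C / k * (wt v.1 ^ k * wt v.1 ^ (-k)) := by ring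
    _ = C / k := by rw [wt_rpow_mul_neg, mul_one]

theorem continuous_dal (hκ : 1 < κ) (hc : Decays κ c) :
    Continuous fun v : ℝ × ℝ => dal c v.1 v.2 :=
  ((hc.continuous_ray hκ (-1)).add (hc.continuous_ray hκ 1)).neg.div_const 2

theorem continuous_wdal (hk : 0 < k) (hc : ContDecay C (k + 1) c) : Continuous (wdal k c) :=
  ((continuous_wt_rpow k).comp continuous_fst).mul
    ((continuous_dal (by linarith) hc.decays).comp (f := fun q : ℝ × ℝ => (max q.1 0, q.2))
      (by fun_prop))

/-- `wdal` as a bounded continuous function. -/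
def bdal (hk : 0 < k) (hc : ContDecay C (k + 1) c) : ℝ × ℝ →ᵇ ℝ :=
  BoundedContinuousFunction.ofNormedAddCommGroup (wdal k c) (continuous_wdal hk hc) (C / k)
    (abs_wdal_le hk hc)

theorem bdal_apply (hk : 0 < k) (hc : ContDecay C (k + 1) c) (v : ℝ × ℝ) :
    bdal hk hc v = wdal k c v := rfl

theorem norm_bdal_le (hk : 0 < k) (hc : ContDecay C (k + 1) c) : ‖bdal hk hc‖ ≤ C / k :=
  (BoundedContinuousFunction.norm_le (div_nonneg hc.nonneg hk.le)).2 (abs_wdal_le hk hc)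

theorem dist_bdal_le (hk : 0 < k) (hc : ContDecay C (k + 1) c) (hd : ContDecay C' (k + 1) d)
    (h : ContDecay M (k + 1) fun t x => c t x - d t x) :
    dist (bdal hk hc) (bdal hk hd) ≤ M / k := by
  refine (BoundedContinuousFunction.dist_le (div_nonneg h.nonneg hk.le)).2 fun v => ?_
  have h1 := abs_wdal_le hk h v
  rwa [wdal, dal_sub (by linarith) hc.decays hd.decays, mul_sub] at h1

/-- The coefficients of the integral equation. -/
structure Coeffs (k A β η : ℝ) (F Fx B Bx : ℝ → ℝ → ℝ) : Prop where
  one_lt : 1 < k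
  decF : ContDecay A (k + 1) F
  decFx : ContDecay A (k + 1) Fx
  decB : ContDecay β 1 B
  decBx : ContDecay η 1 Bx
  derivF : ∀ t x, HasDerivAt (fun y => F t y) (Fx t x) x
  derivB : ∀ t x, HasDerivAt (fun y => B t y) (Bx t x) x

namespace Coeffs

theorem pos (h : Coeffs k A β η F Fx B Bx) : 0 < k := zero_lt_one.trans h.one_lt

theorem decay_src (h : Coeffs k A β η F Fx B Bx) (z : (ℝ × ℝ →ᵇ ℝ) × (ℝ × ℝ →ᵇ ℝ)) :
    ContDecay (A * (1 + ‖z.1‖ / (k - 1)) + β * ‖z.1‖) (k + 1) (src F B 1 (unwt k z.1)) :=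
  h.decF.src h.one_lt h.decB zero_le_one (contDecay_unwt k z.1)

theorem decay_srcx (h : Coeffs k A β η F Fx B Bx) (z : (ℝ × ℝ →ᵇ ℝ) × (ℝ × ℝ →ᵇ ℝ)) :
    ContDecay (A * (1 + ‖z‖ / (k - 1)) + η * ‖z‖ + (A * (0 + ‖z‖ / (k - 1)) + β * ‖z‖)) (k + 1)
      (srcx F Fx B Bx 1 (unwt k z.1) (unwt k z.2)) :=
  h.decF.srcx h.one_lt h.decFx h.decB h.decBx zero_le_one
    ((contDecay_unwt k z.1).mono (norm_fst_le z)) ((contDecay_unwt k z.2).mono (norm_snd_le z))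

/-- The map whose fixed point is sought. -/
def map (h : Coeffs k A β η F Fx B Bx) (z : (ℝ × ℝ →ᵇ ℝ) × (ℝ × ℝ →ᵇ ℝ)) :
    (ℝ × ℝ →ᵇ ℝ) × (ℝ × ℝ →ᵇ ℝ) :=
  (bdal h.pos (h.decay_src z), bdal h.pos (h.decay_srcx z))

/-- The second component is the worse one: F and Fx each contribute A/(k-1), B contributes β and Bx
contributes η, and the integration divides by k. Only β is not small; it is close to μ. -/
theorem dist_map_le (h : Coeffs k A β η F Fx B Bx) (z z' : (ℝ × ℝ →ᵇ ℝ) × (ℝ × ℝ →ᵇ ℝ)) :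
    dist (h.map z) (h.map z') ≤ (2 * A / (k - 1) + β + η) / k * dist z z' := by
  have hk := h.one_lt
  have hk' := h.pos
  have d1 := (contDecay_unwt k z.1).decays
  have d1' := (contDecay_unwt k z'.1).decays
  have d2 := (contDecay_unwt k z.2).decays
  have d2' := (contDecay_unwt k z'.2).decays
  have b1 := (contDecay_unwt k (z - z').1).mono (norm_fst_le (z - z'))
  have b2 := (contDecay_unwt k (z - z').2).mono (norm_snd_le (z - z'))
  rw [Prod.fst_sub, ← unwt_sub] at b1
  rw [Prod.snd_sub, ← unwt_sub] at b2
  have hA := h.decF.nonneg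
  have hη := h.decBx.nonneg
  have hN := norm_nonneg (z - z')
  have hAk : 0 ≤ A * (‖z - z'‖ / (k - 1)) := mul_nonneg hA (div_nonneg hN (by linarith))
  have e : ∀ X : ℝ, X / k * ‖z - z'‖ = X * ‖z - z'‖ / k := fun X => by ring
  rw [dist_eq_norm z z', e]
  refine max_le ?_ ?_
  · refine (dist_bdal_le hk' (h.decay_src z) (h.decay_src z') (M := A * (0 + ‖z - z'‖ / (k - 1)) + β * ‖z - z'‖) ?_).trans ?_
    · simp only [src_sub hk d1 d1']
      exact h.decF.src hk h.decB le_rfl b1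
    · gcongr
      have : 2 * A / (k - 1) * ‖z - z'‖ = 2 * (A * (‖z - z'‖ / (k - 1))) := by ring
      nlinarith [mul_nonneg hη hN]
  · refine (dist_bdal_le hk' (h.decay_srcx z) (h.decay_srcx z') (M := A * (0 + ‖z - z'‖ / (k - 1)) + η * ‖z - z'‖
      + (A * (0 + ‖z - z'‖ / (k - 1)) + β * ‖z - z'‖)) ?_).trans ?_
    · simp only [srcx, add_sub_add_comm, src_sub hk d1 d1', src_sub hk d2 d2']
      exact (h.decFx.src hk h.decBx le_rfl b1).add (h.decF.src hk h.decB le_rfl b2)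
    · gcongr
      have : 2 * A / (k - 1) * ‖z - z'‖ = 2 * (A * (‖z - z'‖ / (k - 1))) := by ring
      nlinarith

/-- The pairs `(z, z_x)`. -/
def derivPairs : Set ((ℝ × ℝ →ᵇ ℝ) × (ℝ × ℝ →ᵇ ℝ)) :=
  {z | ∀ t x, HasDerivAt (fun y => z.1 (t, y)) (z.2 (t, x)) x}

/-- Both components converge uniformly, so derivatives pass to the limit. The fixed point found in
this set comes with its x-derivative. -/
theorem isClosed_derivPairs : IsClosed derivPairs := by
  refine IsSeqClosed.isClosed fun z z₀ hz hlim t x => ?_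
  have h1 := BoundedContinuousFunction.tendsto_iff_tendstoUniformly.1
    ((continuous_fst.tendsto z₀).comp hlim)
  have h2 := BoundedContinuousFunction.tendsto_iff_tendstoUniformly.1
    ((continuous_snd.tendsto z₀).comp hlim)
  exact hasDerivAt_of_tendstoUniformly (h2.comp fun y => (t, y))
    (Eventually.of_forall fun n y => hz n t y) (fun y => h1.tendsto_at (t, y)) x

theorem mapsTo_derivPairs (h : Coeffs k A β η F Fx B Bx) :
    MapsTo h.map derivPairs derivPairs := by
  intro z hz t x
  have hq : ∀ t x, HasDerivAt (fun y => unwt k z.1 t y) (unwt k z.2 t x) x := fun t x =>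
    (hz t x).const_mul _
  have h1 := hasDerivAt_src (s := 1) h.one_lt (contDecay_unwt k z.1).decays
    (contDecay_unwt k z.2).decays hq h.derivF h.derivB
  exact (hasDerivAt_dal (by linarith [h.pos]) (h.decay_src z).decays (h.decay_srcx z).decays h1
    (max t 0) x).const_mul (wt t ^ k)

theorem exists_solution (h : Coeffs k A β η F Fx B Bx)
    (hκ : (2 * A / (k - 1) + β + η) / k ≤ κ) (hκ1 : κ < 1) :
    ∃ q p : ℝ → ℝ → ℝ, ContDecay (A / (k * (1 - κ))) k q ∧ (∃ C, ContDecay C k p) ∧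
      (∀ t x, HasDerivAt (fun y => q t y) (p t x) x) ∧
      ∀ t x, 0 ≤ t → q t x = dal (src F B 1 q) t x := by
  have hk := h.one_lt
  have hk' := h.pos
  have hA := h.decF.nonneg
  have hβ := h.decB.nonneg
  have hη := h.decBx.nonneg
  have hAk : 0 ≤ A / (k - 1) := div_nonneg hA (by linarith)
  have hκ0 : 0 ≤ κ := by
    refine le_trans ?_ hκ
    have : 0 ≤ 2 * A / (k - 1) := div_nonneg (by linarith) (by linarith)
    positivity
  have hcon : ContractingWith (⟨κ, hκ0⟩ : NNReal)
      (h.mapsTo_derivPairs.restrict h.map derivPairs derivPairs) := by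
    refine ⟨by exact_mod_cast hκ1, LipschitzWith.of_dist_le_mul fun z z' => ?_⟩
    exact (h.dist_map_le z z').trans (mul_le_mul_of_nonneg_right hκ dist_nonneg)
  obtain ⟨z, hz, hfix, -⟩ := hcon.exists_fixedPoint' isClosed_derivPairs.isComplete
    h.mapsTo_derivPairs (x := 0) (fun t x => hasDerivAt_const x 0) (edist_ne_top _ _)
  have hz1 : bdal h.pos (h.decay_src z) = z.1 := congrArg Prod.fst hfix
  -- The fixed point equation bounds N = ‖z.1‖ by (A + (A/(k-1) + β) N)/k ≤ A/k + κN; this is solved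
  -- for N.
  have hn : ‖z.1‖ ≤ A / (k * (1 - κ)) := by
    have h1 := norm_bdal_le h.pos (h.decay_src z)
    rw [hz1, le_div_iff₀ hk'] at h1
    rw [div_le_iff₀ hk'] at hκ
    have h2 : A * (1 + ‖z.1‖ / (k - 1)) = A + A / (k - 1) * ‖z.1‖ := by ring
    have h3 : 2 * A / (k - 1) = 2 * (A / (k - 1)) := by ring
    rw [le_div_iff₀ (mul_pos hk' (by linarith))]
    rw [h2] at h1
    rw [h3] at hκ
    have h4 := mul_le_mul_of_nonneg_right hκ (norm_nonneg z.1)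
    nlinarith [mul_nonneg hη (norm_nonneg z.1), mul_nonneg hAk (norm_nonneg z.1)]
  refine ⟨unwt k z.1, unwt k z.2, (contDecay_unwt k z.1).mono hn, ⟨_, contDecay_unwt k z.2⟩,
    fun t x => (hz t x).const_mul _, fun t x ht => ?_⟩
  rw [unwt, ← hz1, bdal_apply, wdal, hz1]
  simp only [max_eq_left ht]
  rw [← mul_assoc, mul_comm (wt t ^ (-k)), wt_rpow_mul_neg, one_mul]

end Coeffs

end corrector

/-! ### The corrector -/

/-- Symmetry of the second derivative, up to the boundary t = 0. It is needed because b is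
controlled through ∂ₜ∂ₓb while the x-derivative of F contains ∂ₓ∂ₜb. -/
theorem IsC2.dx_dt {f : ℝ → ℝ → ℝ} (h : IsC2 f) {t : ℝ} (ht : 0 ≤ t) (x : ℝ) :
    dx (dt f) t x = dt (dx f) t x := by
  have h2 : IsCn 2 f := h
  have h1t := h2.isCn_dt (m := 1) (by norm_num)
  have h1x := h2.isCn_dx (m := 1) (by norm_num)
  have hd : ContDiffOn ℝ 1 (fderivWithin ℝ (fun q : ℝ × ℝ => f q.1 q.2) (Ici 0 ×ˢ univ))
      (Ici 0 ×ˢ univ) := ContDiffOn.fderivWithin h uniqueDiffOn_halfPlane (by norm_num)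
  have hmem : (t, x) ∈ Ici (0 : ℝ) ×ˢ (univ : Set ℝ) := ⟨ht, mem_univ _⟩
  have hdd := hd.differentiableOn one_ne_zero (t, x) hmem
  have huniq := uniqueDiffOn_halfPlane (t, x) hmem
  have key : ∀ v w : ℝ × ℝ, fderivWithin ℝ (fun q => fderivWithin ℝ (fun q : ℝ × ℝ => f q.1 q.2)
      (Ici 0 ×ˢ univ) q w) (Ici 0 ×ˢ univ) (t, x) v = fderivWithin ℝ (fderivWithin ℝ
      (fun q : ℝ × ℝ => f q.1 q.2) (Ici 0 ×ˢ univ)) (Ici 0 ×ˢ univ) (t, x) v w := by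
    intro v w
    rw [fderivWithin_clm_apply huniq hdd (differentiableWithinAt_const w)]
    simp
  have hsym := ContDiffWithinAt.isSymmSndFDerivWithinAt (h (t, x) hmem) (by simp)
    uniqueDiffOn_halfPlane (by simp [interior_prod_eq, closure_prod_eq, ht]) hmem
  have et : ∀ q ∈ Ici (0 : ℝ) ×ˢ (univ : Set ℝ), dt f q.1 q.2 =
      fderivWithin ℝ (fun q : ℝ × ℝ => f q.1 q.2) (Ici 0 ×ˢ univ) q (1, 0) :=
    fun q hq => h2.dt_eq two_ne_zero hq.1 q.2
  have ex : ∀ q ∈ Ici (0 : ℝ) ×ˢ (univ : Set ℝ), dx f q.1 q.2 =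
      fderivWithin ℝ (fun q : ℝ × ℝ => f q.1 q.2) (Ici 0 ×ˢ univ) q (0, 1) :=
    fun q hq => h2.dx_eq two_ne_zero hq.1 q.2
  rw [h1t.dx_eq one_ne_zero ht, h1x.dt_eq one_ne_zero ht, fderivWithin_congr et (et _ hmem),
    fderivWithin_congr ex (ex _ hmem), key, key]
  exact hsym (0, 1) (1, 0)

theorem contDecay_freeze {f : ℝ → ℝ → ℝ} {C κ : ℝ} (hf : IsCn 0 f)
    (hb : ∀ t x, 0 ≤ t → |f t x| ≤ C / (1 + t) ^ κ) :
    ContDecay C κ fun t x => f (max t 0) x := by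
  refine ⟨hf.continuousOn.comp_continuous (f := fun q : ℝ × ℝ => (max q.1 0, q.2)) (by fun_prop)
    fun q => ⟨mem_Ici.2 (le_max_right _ _), mem_univ _⟩,
      fun t x => (hb _ x (le_max_right _ _)).trans (le_of_eq ?_)⟩
  rw [Real.rpow_neg (wt_pos t).le, div_eq_mul_inv, wt]

theorem isCn_mu_div {n : WithTop ℕ∞} (μ : ℝ) : IsCn n fun t _ => μ / (1 + t) := by
  refine IsCn.of_time (f := fun t => μ / (1 + t)) (contDiffOn_const.div (by fun_prop) fun t ht => ?_)
  have : (0 : ℝ) ≤ t := ht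
  positivity

namespace HasGrad

variable {f ft fx g gt gx : ℝ → ℝ → ℝ} {t x : ℝ}

theorem linComb (hf : HasGrad f ft fx) (hg : HasGrad g gt gx) (a b : ℝ) :
    HasGrad (fun t x => a * f t x + b * g t x) (fun t x => a * ft t x + b * gt t x)
      (fun t x => a * fx t x + b * gx t x) := by
  refine ⟨fun t x => ?_, (hf.cont_t.const_mul a).add (hg.cont_t.const_mul b),
    (hf.cont_x.const_mul a).add (hg.cont_x.const_mul b)⟩
  refine (((hf.hasFDerivAt t x).const_mul a).add ((hg.hasFDerivAt t x).const_mul b)).congr_fderiv ?_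
  ext <;> simp

theorem congr (hf : HasGrad f ft fx) (h : ∀ t x, g t x = f t x) (ht : ∀ t x, gt t x = ft t x)
    (hx : ∀ t x, gx t x = fx t x) : HasGrad g gt gx := by
  obtain rfl : g = f := funext₂ h
  obtain rfl : gt = ft := funext₂ ht
  obtain rfl : gx = fx := funext₂ hx
  exact hf

theorem dt_eq (hf : HasGrad f ft fx) (ht : 0 ≤ t) (x : ℝ) : dt f t x = ft t x :=
  (hf.hasDerivAt_left t x).hasDerivWithinAt.derivWithin (uniqueDiffOn_Ici 0 t ht)

theorem dx_eq (hf : HasGrad f ft fx) (t x : ℝ) : dx f t x = fx t x :=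
  (hf.hasDerivAt_right t x).deriv

end HasGrad

/-! ### Gradients of the d'Alembert integrals -/

theorem Decays.tendsto {κ : ℝ} (hκ : 0 < κ) {c : ℝ → ℝ → ℝ} (hc : Decays κ c) (x : ℝ) :
    Tendsto (fun t => c t x) atTop (𝓝 0) := by
  obtain ⟨C, hC⟩ := hc.decay 0
  have h1 : Tendsto wt atTop atTop := by
    refine tendsto_atTop_mono (fun t => ?_) tendsto_id
    have := le_max_left t 0
    simp only [id, wt]
    linarith
  have h2 := ((tendsto_rpow_neg_atTop hκ).comp h1).const_mul C
  rw [mul_zero] at h2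
  exact squeeze_zero_norm' ((eventually_ge_atTop 0).mono fun t ht => hC t x ht) h2

/-- Half the difference of the integrals of `c` along the two characteristics. -/
def dam (c : ℝ → ℝ → ℝ) (t x : ℝ) : ℝ := (ray 1 c t x - ray (-1) c t x) / 2

theorem DecayFrom.dam {κ C : ℝ} {c : ℝ → ℝ → ℝ} (hκ : 1 < κ) (hc : DecayFrom 0 C κ c) :
    DecayFrom 0 (C / (κ - 1)) (κ - 1) (dam c) := by
  intro t x ht
  have h1 := _root_.abs_le.1 (hc.ray_zero hκ (-1) t x ht)
  have h2 := _root_.abs_le.1 (hc.ray_zero hκ 1 t x ht)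
  rw [DampedWave.dam, _root_.abs_le]
  constructor <;> linarith [h1.1, h1.2, h2.1, h2.2]

theorem Decays.linComb {κ : ℝ} {c d : ℝ → ℝ → ℝ} (hc : Decays κ c) (hd : Decays κ d) (a b : ℝ) :
    Decays κ fun t x => a * c t x + b * d t x := by
  refine ⟨(hc.cont.const_mul a).add (hd.cont.const_mul b), fun t₀ => ?_⟩
  obtain ⟨C, hC⟩ := hc.decay t₀
  obtain ⟨C', hC'⟩ := hd.decay t₀
  refine ⟨|a| * C + |b| * C', fun t x ht => (abs_add_le _ _).trans ?_⟩
  rw [abs_mul, abs_mul, add_mul, mul_assoc, mul_assoc]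
  exact add_le_add (mul_le_mul_of_nonneg_left (hC t x ht) (abs_nonneg a))
    (mul_le_mul_of_nonneg_left (hC' t x ht) (abs_nonneg b))

theorem dal_eq (c : ℝ → ℝ → ℝ) :
    dal c = fun t x => -1 / 2 * ray (-1) c t x + -1 / 2 * ray 1 c t x := by
  funext t x
  rw [dal]
  ring

theorem dam_eq (c : ℝ → ℝ → ℝ) :
    dam c = fun t x => -1 / 2 * ray (-1) c t x + 1 / 2 * ray 1 c t x := by
  funext t x
  rw [dam]
  ring

section

variable {κ : ℝ} {G Gx : ℝ → ℝ → ℝ}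

theorem Decays.dal (hκ : 1 < κ) (hG : Decays κ G) : Decays (κ - 1) (dal G) := by
  rw [dal_eq]
  exact (hG.ray hκ _).linComb (hG.ray hκ _) _ _

theorem Decays.dam (hκ : 1 < κ) (hG : Decays κ G) : Decays (κ - 1) (dam G) := by
  rw [dam_eq]
  exact (hG.ray hκ _).linComb (hG.ray hκ _) _ _

/-- The operator ∂ₜ + ε∂ₓ sends a ray integral to minus its integrand, so the two copies of G add up
here; in `dam` they cancel. -/
theorem Decays.hasGrad_dal (hκ : 1 < κ) (hG : Decays κ G) (hGx : Decays κ Gx)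
    (h : ∀ t x, HasDerivAt (fun y => G t y) (Gx t x) x) :
    HasGrad (DampedWave.dal G) (fun t x => G t x + DampedWave.dam Gx t x) (DampedWave.dal Gx) := by
  refine ((hG.hasGrad_ray hκ hGx h (-1)).linComb (hG.hasGrad_ray hκ hGx h 1)
    (-1 / 2) (-1 / 2)).congr ?_ ?_ ?_ <;> intro t x
  · rw [dal_eq]
  · rw [dam_eq]
    ring
  · rw [dal_eq]

theorem Decays.hasGrad_dam (hκ : 1 < κ) (hG : Decays κ G) (hGx : Decays κ Gx)
    (h : ∀ t x, HasDerivAt (fun y => G t y) (Gx t x) x) :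
    HasGrad (DampedWave.dam G) (DampedWave.dal Gx) (DampedWave.dam Gx) := by
  refine ((hG.hasGrad_ray hκ hGx h (-1)).linComb (hG.hasGrad_ray hκ hGx h 1)
    (-1 / 2) (1 / 2)).congr ?_ ?_ ?_ <;> intro t x
  · rw [dam_eq]
  · rw [dal_eq]
    ring
  · rw [dam_eq]

/-- The primitive of `dal G` vanishing at infinity has the gradient `(dal G, dam G)`. -/
theorem Decays.hasGrad_ray_dal (hκ : 1 < κ - 1) (hG : Decays κ G) (hGx : Decays κ Gx)
    (h : ∀ t x, HasDerivAt (fun y => G t y) (Gx t x) x) :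
    HasGrad (fun t x => -DampedWave.ray 0 (DampedWave.dal G) t x) (DampedWave.dal G)
      (DampedWave.dam G) := by
  have hκ' : 1 < κ := by linarith
  have g1 := hG.hasGrad_dal hκ' hGx h
  have d1 := hG.dal hκ'
  have d2 := hGx.dal hκ'
  have g2 := d1.hasGrad_ray hκ d2 g1.hasDerivAt_right 0
  have g3 := hG.hasGrad_dam hκ' hGx h
  -- Only the x-derivative needs an argument. It comes out as -ray 0 (dal Gx), which equals dam G
  -- because dam G + ray 0 (dal Gx) is constant in time and tends to zero.
  refine (g2.linComb g2 (-1) 0).congr (fun t x => by ring) (fun t x => by ring) fun t x => ?_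
  have e : ∀ s, DampedWave.dam G s x + DampedWave.ray 0 (DampedWave.dal Gx) s x
      = DampedWave.dam G t x + DampedWave.ray 0 (DampedWave.dal Gx) t x := by
    have hd : ∀ s, HasDerivAt (fun s => DampedWave.dam G s x
        + DampedWave.ray 0 (DampedWave.dal Gx) s x) 0 s := fun s => by
      have h5 := d2.hasDerivAt_ray_along hκ 0 s x
      simp only [zero_mul, add_zero] at h5
      exact ((g3.hasDerivAt_left s x).fun_add h5).congr_deriv (by ring)
    exact fun s => is_const_of_deriv_eq_zero (fun s => (hd s).differentiableAt)
      (fun s => (hd s).deriv) s t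
  have l1 := ((hG.dam hκ').tendsto (by linarith) x).add ((d2.ray hκ 0).tendsto (by linarith) x)
  simp only [e, add_zero] at l1
  have := tendsto_nhds_unique l1 tendsto_const_nhds
  linarith

end

/-- The coefficients are frozen at t = 0 for negative times. The constant δ(1+μ) collects the
product μ/(1+t) · b and the term b_t, and likewise for their x-derivatives; in B the part μ/(1+t)
gives μ, and b gives δ since k ≥ 1. -/
theorem IsPerturbation.coeffs {μ k δ : ℝ} (hμ : 0 < μ) (hk : 1 < k) {b : ℝ → ℝ → ℝ}
    (hb : IsPerturbation k δ b) : Coeffs k (δ * (1 + μ)) (μ + δ) δ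
      (fun t x => μ / (1 + max t 0) * b (max t 0) x + dt b (max t 0) x)
      (fun t x => μ / (1 + max t 0) * dx b (max t 0) x + dt (dx b) (max t 0) x)
      (fun t x => μ / (1 + max t 0) - b (max t 0) x) (fun t x => -dx b (max t 0) x) := by
  have h2 : IsCn 2 b := hb.contDiff
  have ht := h2.isCn_dt (m := 1) (by norm_num)
  have hx := h2.isCn_dx (m := 1) (by norm_num)
  have htx := hx.isCn_dt (m := 0) (by norm_num)
  have cμ : ContDecay μ 1 fun t _ => μ / (1 + max t 0) := by
    refine contDecay_freeze (isCn_mu_div μ) fun t x ht => ?_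
    rw [Real.rpow_one, abs_of_nonneg (by positivity)]
  have cb := contDecay_freeze (h2.of_le (by norm_num)) hb.bound
  have cbt := contDecay_freeze (ht.of_le (by norm_num)) hb.bound_dt
  have cbx := contDecay_freeze (hx.of_le (by norm_num)) hb.bound_dx
  have cbtx := contDecay_freeze htx hb.bound_dt_dx
  have e : μ * δ + δ = δ * (1 + μ) := by ring
  have e' : 1 + k = k + 1 := add_comm _ _
  have dB : ∀ t x, HasDerivAt (fun y => b (max t 0) y) (dx b (max t 0) x) x := fun t x =>
    h2.hasDerivAt two_ne_zero (le_max_right _ _) x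
  refine ⟨hk, ?_, ?_, cμ.sub (cb.le_exponent hk.le), (cbx.neg).le_exponent hk.le, fun t x => ?_,
    fun t x => (dB t x).const_sub _⟩
  · have h := cμ.mul cb
    rw [e'] at h
    exact e ▸ h.add cbt
  · have h := cμ.mul cbx
    rw [e'] at h
    exact e ▸ h.add cbtx
  · rw [← hb.contDiff.dx_dt (le_max_right _ _)]
    exact ((dB t x).const_mul _).fun_add (ht.hasDerivAt one_ne_zero (le_max_right _ _) x)

/-- The ray integrals defining h are not frozen for t < 0. Since G and Gx are continuous on the
whole plane, h is C² across t = 0; on t ≥ 0 it agrees with the primitive of the fixed point q. -/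
theorem exists_corrector {μ k θ δ κ : ℝ} (hμ : 0 < μ) (hk : 1 < k) {b : ℝ → ℝ → ℝ}
    (hb : IsPerturbation k δ b)
    (hκ : (2 * (δ * (1 + μ)) / (k - 1) + (μ + δ) + δ) / k ≤ κ) (hκ1 : κ < 1)
    (hθ : δ * (1 + μ) / (k * (1 - κ)) / (k - 1) ≤ θ) :
    ∃ h : ℝ → ℝ → ℝ, IsCorrector μ k θ b h := by
  have hC := hb.coeffs hμ hk
  obtain ⟨q, p, hq, ⟨N, hp⟩, hqp, hfix⟩ := hC.exists_solution hκ hκ1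
  set F : ℝ → ℝ → ℝ := fun t x => μ / (1 + max t 0) * b (max t 0) x + dt b (max t 0) x with hF
  set Fx : ℝ → ℝ → ℝ := fun t x => μ / (1 + max t 0) * dx b (max t 0) x + dt (dx b) (max t 0) x
  set B : ℝ → ℝ → ℝ := fun t x => μ / (1 + max t 0) - b (max t 0) x with hB
  set Bx : ℝ → ℝ → ℝ := fun t x => -dx b (max t 0) x
  have cG := hC.decF.src hk hC.decB zero_le_one hq
  have cGx := hC.decF.srcx hk hC.decFx hC.decB hC.decBx zero_le_one
    (hq.mono (le_max_left _ N)) (hp.mono (le_max_right _ N))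
  set G := src F B 1 q with hG
  set Gx := srcx F Fx B Bx 1 q p
  have hGx : ∀ t x, HasDerivAt (fun y => G t y) (Gx t x) x :=
    hasDerivAt_src hk hq.decays hp.decays hqp hC.derivF hC.derivB
  have hk1 : 1 < k + 1 := by linarith
  have hk2 : 1 < k + 1 - 1 := by linarith
  have gQ := cG.decays.hasGrad_dal hk1 cGx.decays hGx
  have gm := cG.decays.hasGrad_dam hk1 cGx.decays hGx
  have gh := cG.decays.hasGrad_ray_dal hk2 cGx.decays hGx
  have hprim : ∀ t x, 0 ≤ t → -ray 0 (dal G) t x = tprim q t x := by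
    intro t x ht
    rw [tprim, max_eq_left ht, ray, ray]
    congr 1
    refine setIntegral_congr_fun measurableSet_Ioi fun σ hσ => ?_
    exact (hfix _ _ (add_nonneg ht (le_of_lt hσ))).symm
  have hdiv : ∀ {C s t : ℝ}, 0 ≤ t → C * wt t ^ (-s) = C / (1 + t) ^ s := fun ht => by
    rw [wt_of_nonneg ht, Real.rpow_neg (by linarith), div_eq_mul_inv]
  refine ⟨fun t x => -ray 0 (dal G) t x, ?_, fun t x ht => ?_, fun t x ht => ?_, ?_⟩
  · have h2 := gh.contDiff_succ (n := 1) (by exact_mod_cast gQ.contDiff_one)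
      (by exact_mod_cast gm.contDiff_one)
    have e : ((1 : ℕ) : WithTop ℕ∞) + 1 = 2 := by norm_num
    rw [e] at h2
    exact h2.contDiffOn
  -- With h_t = dal G and h_x = dam G, one has h_tt - h_xx = (G + dam Gx) - dam Gx = G.
  · rw [dt_congr (fun s y hs => gh.dt_eq hs y) ht, gQ.dt_eq ht,
      dx_congr (fun s y _ => gh.dx_eq s y) ht, gm.dx_eq, gh.dt_eq ht]
    rw [hprim t x ht, hG, src, ← hG, hfix t x ht, hF, hB]
    simp only [max_eq_left ht]
    ring
  · rw [hprim t x ht, ← hdiv ht]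
    exact ((hq.tprim hk).mono hθ).bound t x
  · have b1 := (cG.decayFrom 0).dal hk1
    have b2 := (cG.decayFrom 0).dam hk1
    rw [add_sub_cancel_right] at b1 b2
    set C := (δ * (1 + μ) * (1 + δ * (1 + μ) / (k * (1 - κ)) / (k - 1))
      + (μ + δ) * (δ * (1 + μ) / (k * (1 - κ)))) / k
    have hle : C ≤ |C| + 1 := by linarith [le_abs_self C]
    refine ⟨|C| + 1, by positivity, fun t x ht => ?_⟩
    rw [gh.dt_eq ht, gh.dx_eq, ← hdiv ht]
    have hw := Real.rpow_nonneg (wt_pos t).le (-k)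
    exact ⟨(b1 t x ht).trans (mul_le_mul_of_nonneg_right hle hw),
      (b2 t x ht).trans (mul_le_mul_of_nonneg_right hle hw)⟩

theorem exists_delta {μ k θ : ℝ} (hμ : 0 < μ) (hk : 1 < k) (hkμ : μ < k) (hθ : 0 < θ) :
    ∃ δ₀ : ℝ, 0 < δ₀ ∧ ∀ δ : ℝ, 0 < δ → δ < δ₀ → ∀ b : ℝ → ℝ → ℝ, IsPerturbation k δ b →
      ∃ h : ℝ → ℝ → ℝ, IsCorrector μ k θ b h := by
  have hk0 : 0 < k := by linarith
  have hk1 : 0 < k - 1 := by linarith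
  have hkm : 0 < k - μ := by linarith
  -- The contraction constant will be κ = (k+μ)/(2k), midway between μ/k and 1. The first bound on δ
  -- brings the Lipschitz constant below κ; as k(1-κ) = (k-μ)/2, the second gives |h| ≤ θ
  -- (1+t)^(-(k-1)).
  refine ⟨min ((k - μ) / 2 / (2 * (1 + μ) / (k - 1) + 2)) (θ * (k - 1) * ((k - μ) / 2) / (1 + μ)),
    lt_min (by positivity) (by positivity), fun δ hδ hδ' b hb => ?_⟩
  have h1 := (lt_div_iff₀ (by positivity)).1 (hδ'.trans_le (min_le_left _ _))
  have h2 := (lt_div_iff₀ (by positivity)).1 (hδ'.trans_le (min_le_right _ _))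
  have e : k * (1 - (k + μ) / (2 * k)) = (k - μ) / 2 := by
    field_simp
    ring
  refine exists_corrector (κ := (k + μ) / (2 * k)) hμ hk hb ?_ ?_ ?_
  · rw [div_le_iff₀ hk0]
    have e1 : (k + μ) / (2 * k) * k = (k + μ) / 2 := by
      field_simp
    rw [e1]
    have e2 : 2 * (δ * (1 + μ)) / (k - 1) = δ * (2 * (1 + μ) / (k - 1)) := by ring
    rw [e2]
    linarith
  · rw [div_lt_one (by positivity)]
    linarith
  · rw [e, div_div, div_le_iff₀ (by positivity)]
    linarith

/-! ### Cutoff functions -/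

/-- A `C²` cutoff function between `[-1,1]` and `[-2,2]` with `|χ'|, |χ''| ≤ C χ^(1/p)`. -/
structure IsCutoff (p C : ℝ) (χ : ℝ → ℝ) : Prop where
  contDiff : ContDiff ℝ 2 χ
  nonneg : ∀ x, 0 ≤ χ x
  le_one : ∀ x, χ x ≤ 1
  eq_one : ∀ x, |x| ≤ 1 → χ x = 1
  eq_zero : ∀ x, 2 ≤ |x| → χ x = 0
  even : ∀ x, χ (-x) = χ x
  antitone : AntitoneOn χ (Ici 0)
  deriv_le : ∀ x, |deriv χ x| ≤ C * χ x ^ (1 / p)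
  deriv_deriv_le : ∀ x, |deriv (deriv χ) x| ≤ C * χ x ^ (1 / p)

/-- A high power ζ^(n+2) of a smooth cutoff works: after two derivatives at least ζ^n remains, and
ζ^n ≤ (ζ^(n+2))^(1/p) once n (1 - 1/p) ≥ 2/p, which is possible because p > 1. -/
theorem exists_isCutoff {p : ℝ} (hp : 1 < p) : ∃ C χ, 0 ≤ C ∧ IsCutoff p C χ := by
  set ζ : ℝ → ℝ := fun x => Real.smoothTransition ((4 - x ^ 2) / 3) with hζ
  have hsm : ContDiff ℝ 2 ζ := by
    have h : ContDiff ℝ 2 fun x : ℝ => (4 - x ^ 2) / 3 := by fun_prop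
    exact (Real.smoothTransition.contDiff (n := 2)).comp h
  have h0 : ∀ x, 0 ≤ ζ x := fun x => Real.smoothTransition.nonneg _
  have h1 : ∀ x, ζ x ≤ 1 := fun x => Real.smoothTransition.le_one _
  have hone : ∀ x, |x| ≤ 1 → ζ x = 1 := fun x hx => by
    refine Real.smoothTransition.one_of_one_le ?_
    have := (sq_le_one_iff_abs_le_one x).2 hx
    linarith
  have hzero : ∀ x, 2 ≤ |x| → ζ x = 0 := fun x hx => by
    refine Real.smoothTransition.zero_of_nonpos ?_
    have := sq_abs x
    nlinarith
  have hcs : HasCompactSupport ζ := by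
    refine HasCompactSupport.intro (K := Icc (-2) 2) isCompact_Icc fun x hx => hzero x ?_
    by_contra hcon
    exact hx (abs_le.1 (not_le.1 hcon).le)
  have hd1 : ContDiff ℝ 1 (deriv ζ) := by
    have h : ContDiff ℝ (1 + 1) ζ := by simpa [one_add_one_eq_two] using hsm
    exact (contDiff_succ_iff_deriv.1 h).2.2
  obtain ⟨C₁, hC₁⟩ := hcs.deriv.exists_bound_of_continuous hd1.continuous
  obtain ⟨C₂, hC₂⟩ := hcs.deriv.deriv.exists_bound_of_continuous (hd1.continuous_deriv le_rfl)
  have hC₁0 : 0 ≤ C₁ := (norm_nonneg _).trans (hC₁ 0)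
  have hC₂0 : 0 ≤ C₂ := (norm_nonneg _).trans (hC₂ 0)
  simp only [Real.norm_eq_abs] at hC₁ hC₂
  have hp1 : 1 / p < 1 := by rw [div_lt_one (by linarith)]; exact hp
  obtain ⟨n, hn⟩ := exists_nat_ge (2 * (1 / p) / (1 - 1 / p))
  rw [div_le_iff₀ (by linarith)] at hn
  have hn0 : n ≠ 0 := by
    rintro rfl
    have : 0 < 1 / p := by positivity
    simp at hn
    linarith [inv_pos.2 (show 0 < p by linarith)]
  have hdζ : ∀ x, HasDerivAt ζ (deriv ζ x) x := fun x =>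
    (hsm.differentiable two_ne_zero x).hasDerivAt
  have hdζ' : ∀ x, HasDerivAt (deriv ζ) (deriv (deriv ζ) x) x := fun x =>
    (hd1.differentiable one_ne_zero x).hasDerivAt
  have e1 : deriv (fun x => ζ x ^ (n + 2)) = fun x => (n + 2 : ℝ) * (ζ x ^ (n + 1) * deriv ζ x) := by
    funext x
    rw [((hdζ x).fun_pow (n + 2)).deriv]
    push_cast
    ring
  have e2 : ∀ x, deriv (deriv fun x => ζ x ^ (n + 2)) x = (n + 2 : ℝ) *
      ((n + 1 : ℝ) * ζ x ^ n * deriv ζ x * deriv ζ x + ζ x ^ (n + 1) * deriv (deriv ζ) x) := by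
    intro x
    rw [e1, ((((hdζ x).fun_pow (n + 1)).fun_mul (hdζ' x)).const_mul (n + 2 : ℝ)).deriv]
    push_cast
    simp
  have hpow : ∀ x, ζ x ^ n ≤ (ζ x ^ (n + 2)) ^ (1 / p) := by
    intro x
    rcases (h0 x).eq_or_lt with h | h
    · rw [← h, zero_pow hn0, zero_pow (by omega)]
      exact Real.rpow_nonneg le_rfl _
    · rw [← Real.rpow_natCast, ← Real.rpow_natCast, ← Real.rpow_mul h.le]
      refine Real.rpow_le_rpow_of_exponent_ge h (h1 x) ?_
      push_cast
      linarith
  have hpow' : ∀ x, ζ x ^ (n + 1) ≤ ζ x ^ n := fun x =>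
    pow_le_pow_of_le_one (h0 x) (h1 x) (Nat.le_succ n)
  set C := (n + 2 : ℝ) * ((n + 1) * C₁ * C₁ + C₂ + C₁)
  have hC : 0 ≤ C := by positivity
  refine ⟨C, fun x => ζ x ^ (n + 2), hC, hsm.pow _, fun x => pow_nonneg (h0 x) _,
    fun x => pow_le_one₀ (h0 x) (h1 x), fun x hx => by simp [hone x hx],
    fun x hx => by simp [hzero x hx], fun x => by simp [hζ], ?_, fun x => ?_, fun x => ?_⟩
  · intro x hx y hy hxy
    have hx' : (0 : ℝ) ≤ x := hx
    refine pow_le_pow_left₀ (h0 y) (Real.smoothTransition.monotone ?_) _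
    nlinarith
  · refine le_trans ?_ (mul_le_mul_of_nonneg_left (hpow x) hC)
    rw [e1, abs_mul, abs_mul, abs_of_nonneg (by positivity : (0 : ℝ) ≤ n + 2),
      abs_of_nonneg (pow_nonneg (h0 x) _)]
    have h := pow_nonneg (h0 x) n
    calc (n + 2 : ℝ) * (ζ x ^ (n + 1) * |deriv ζ x|) ≤ (n + 2 : ℝ) * (ζ x ^ n * C₁) := by
          gcongr (n + 2 : ℝ) * (?_ * ?_)
          exacts [hpow' x, hC₁ x]
      _ ≤ (n + 2 : ℝ) * (ζ x ^ n * ((n + 1) * C₁ * C₁ + C₂ + C₁)) := by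
          gcongr
          have : 0 ≤ (n + 1) * C₁ * C₁ := by positivity
          linarith
      _ = _ := by ring
  · refine le_trans ?_ (mul_le_mul_of_nonneg_left (hpow x) hC)
    have h := pow_nonneg (h0 x) n
    have h' := pow_nonneg (h0 x) (n + 1)
    rw [e2, abs_mul, abs_of_nonneg (by positivity : (0 : ℝ) ≤ n + 2)]
    calc (n + 2 : ℝ) * |(n + 1 : ℝ) * ζ x ^ n * deriv ζ x * deriv ζ x
          + ζ x ^ (n + 1) * deriv (deriv ζ) x|
        ≤ (n + 2 : ℝ) * ((n + 1) * ζ x ^ n * C₁ * C₁ + ζ x ^ n * C₂) := by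
          gcongr
          refine (abs_add_le _ _).trans (add_le_add ?_ ?_)
          · rw [abs_mul, abs_mul, abs_mul, abs_of_nonneg h,
              abs_of_nonneg (by positivity : (0 : ℝ) ≤ n + 1)]
            gcongr
            exacts [hC₁ x, hC₁ x]
          · rw [abs_mul, abs_of_nonneg h']
            gcongr ?_ * ?_
            exacts [hpow' x, hC₂ x]
      _ ≤ (n + 2 : ℝ) * ((n + 1) * ζ x ^ n * C₁ * C₁ + ζ x ^ n * C₂ + ζ x ^ n * C₁) := by
          refine mul_le_mul_of_nonneg_left ?_ (by positivity)
          have : 0 ≤ ζ x ^ n * C₁ := by positivity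
          linarith
      _ = _ := by ring

theorem deriv_nonpos_of_antitoneOn {η : ℝ → ℝ} (h : AntitoneOn η (Ici 0)) {x : ℝ} (hx : 0 < x) :
    deriv η x ≤ 0 := by
  rw [← derivWithin_of_mem_nhds (Ici_mem_nhds hx)]
  exact h.derivWithin_nonpos

/-- A positive lower bound for the integrals over large symmetric intervals is inherited by the
integrals against even cutoff functions. -/
theorem le_integral_mul_cutoff {f η : ℝ → ℝ} {c R L : ℝ} (hf : LocallyIntegrable f)
    (hη : ContDiff ℝ 1 η) (heven : ∀ x, η (-x) = η x) (hanti : AntitoneOn η (Ici 0))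
    (h1 : ∀ x, 0 ≤ x → x ≤ R → η x = 1) (hR : 0 ≤ R) (hRL : R ≤ L) (h0 : η L = 0)
    (hc : ∀ s, R ≤ s → c ≤ ∫ x in (-s)..s, f x) : c ≤ ∫ x in (-L)..L, f x * η x := by
  have hL : 0 ≤ L := hR.trans hRL
  have hfi : ∀ a b, IntervalIntegrable f volume a b := fun a b =>
    (hf.integrableOn_isCompact isCompact_uIcc).intervalIntegrable
  have hfi' : ∀ a b, IntervalIntegrable (fun x => f (-x)) volume a b := fun a b => by
    simpa using (IntervalIntegrable.iff_comp_neg (by simp)).1 (hfi (-a) (-b))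
  set e : ℝ → ℝ := fun x => f x + f (-x) with he
  have hei : ∀ a b, IntervalIntegrable e volume a b := fun a b => (hfi a b).add (hfi' a b)
  have split : ∀ (F : ℝ → ℝ) (s : ℝ), (∀ a b, IntervalIntegrable F volume a b) →
      ∫ x in (-s)..s, F x = ∫ x in (0 : ℝ)..s, (F x + F (-x)) := by
    intro F s hF
    have hF' : IntervalIntegrable (fun x => F (-x)) volume 0 s := by
      simpa using (IntervalIntegrable.iff_comp_neg (by simp)).1 (hF (-0) (-s))
    rw [intervalIntegral.integral_add (hF _ _) hF', intervalIntegral.integral_comp_neg, neg_zero,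
      add_comm, intervalIntegral.integral_add_adjacent_intervals (hF _ _) (hF _ _)]
  have hηd : ∀ x, HasDerivAt η (deriv η x) x := fun x =>
    (hη.differentiable one_ne_zero x).hasDerivAt
  have hdc : Continuous (deriv η) := hη.continuous_deriv le_rfl
  -- E(s) is the integral of f over (-s, s). Integration by parts gives ∫ fη = ∫₀ᴸ E · (-η'), where
  -- -η' is nonnegative, has mass 1 and vanishes where E ≥ c is unknown. As f is only locally
  -- integrable, E is absolutely continuous rather than C¹.
  set E : ℝ → ℝ := fun s => ∫ x in (0 : ℝ)..s, e x with hE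
  have hEs : ∀ s, E s = ∫ x in (-s)..s, f x := fun s => (split f s hfi).symm
  have hEac : AbsolutelyContinuousOnInterval E 0 L :=
    (hei 0 L).absolutelyContinuousOnInterval_intervalIntegral (by simp)
  have ibp := hEac.integral_mul_deriv_eq_deriv_mul (g := η)
    hη.contDiffOn.absolutelyContinuousOnInterval
  have hae : ∫ x in (0 : ℝ)..L, deriv E x * η x = ∫ x in (0 : ℝ)..L, e x * η x := by
    refine intervalIntegral.integral_congr_ae ?_
    filter_upwards [(hei 0 L).ae_hasDerivAt_integral] with x hx hx'
    rw [(hx (uIoc_subset_uIcc hx') 0 (by simp)).deriv]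
  have hE0 : E 0 = 0 := by simp [hE]
  rw [hae, h0, hE0] at ibp
  have e1 : ∫ x in (-L)..L, f x * η x = ∫ x in (0 : ℝ)..L, e x * η x := by
    rw [split _ L fun a b => (hfi a b).mul_continuousOn hη.continuous.continuousOn]
    refine intervalIntegral.integral_congr fun x _ => ?_
    simp only [he, heven]
    ring
  have e2 : ∫ x in (0 : ℝ)..L, c * -deriv η x = c := by
    rw [intervalIntegral.integral_const_mul, intervalIntegral.integral_neg,
      intervalIntegral.integral_deriv_eq_sub (fun x _ => hη.differentiable one_ne_zero x)
        (hdc.intervalIntegrable _ _), h0, h1 0 le_rfl hR]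
    ring
  have hEc : ContinuousOn E (uIcc 0 L) := hEac.continuousOn
  have e3 : ∫ x in (0 : ℝ)..L, e x * η x = ∫ x in (0 : ℝ)..L, E x * -deriv η x := by
    simp only [mul_neg, intervalIntegral.integral_neg]
    rw [ibp]
    ring
  rw [e1, e3]
  refine e2.symm.le.trans ?_
  refine intervalIntegral.integral_mono_on_of_le_Ioo hL
    ((hdc.neg.const_mul c).intervalIntegrable _ _)
    ((hEc.mul hdc.neg.continuousOn).intervalIntegrable) fun x hx => ?_
  rcases lt_or_ge x R with h | h
  · have : η =ᶠ[𝓝 x] fun _ => 1 := by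
      filter_upwards [Ioo_mem_nhds hx.1 h] with y hy using h1 y hy.1.le hy.2.le
    rw [this.deriv_eq, deriv_const]
    simp
  · rw [hEs x]
    exact mul_le_mul_of_nonneg_right (hc x h)
      (neg_nonneg.2 (deriv_nonpos_of_antitoneOn hanti hx.1))

/-! ### The weight -/

theorem contDiffOn_one_add_rpow {n : WithTop ℕ∞} (s : ℝ) :
    ContDiffOn ℝ n (fun t : ℝ => (1 + t) ^ s) (Ici 0) := by
  refine ContDiffOn.rpow_const_of_ne (by fun_prop) fun t ht => ?_
  have : (0 : ℝ) ≤ t := ht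
  positivity

theorem dt_time {f : ℝ → ℝ} {f' t : ℝ} (h : HasDerivAt f f' t) (ht : 0 ≤ t) (x : ℝ) :
    dt (fun s _ => f s) t x = f' :=
  h.hasDerivWithinAt.derivWithin (uniqueDiffOn_Ici 0 t ht)

theorem hasDerivAt_one_add_rpow (s : ℝ) {t : ℝ} (ht : 0 ≤ t) :
    HasDerivAt (fun t : ℝ => (1 + t) ^ s) (s * (1 + t) ^ (s - 1)) t := by
  have h1 : (1 + t) ≠ 0 := by positivity
  simpa using ((hasDerivAt_id t).const_add 1).rpow_const (p := s) (Or.inl h1)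

theorem IsPerturbation.isC2_damping {μ k δ : ℝ} {b : ℝ → ℝ → ℝ} (hb : IsPerturbation k δ b) :
    IsC2 (damping μ b) := (isCn_mu_div μ).add (n := 2) hb.contDiff

theorem dt_damping {μ k δ : ℝ} {b : ℝ → ℝ → ℝ} (hb : IsPerturbation k δ b) {t : ℝ} (ht : 0 ≤ t)
    (x : ℝ) : dt (damping μ b) t x = -μ / (1 + t) ^ 2 + dt b t x := by
  have h1 : (1 + t) ≠ 0 := by positivity
  have h2 : IsCn 2 b := hb.contDiff
  have hd : HasDerivAt (fun t : ℝ => μ / (1 + t)) (-μ / (1 + t) ^ 2) t := by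
    have := (hasDerivAt_const t μ).fun_div ((hasDerivAt_id t).const_add 1) h1
    simpa using this
  have h3 := (isCn_mu_div (n := 2) μ).dt_add h2 two_ne_zero ht x
  rw [dt_time hd ht] at h3
  exact h3

theorem div_rpow_le_self {t C s : ℝ} (ht : 0 ≤ t) (hC : 0 ≤ C) (hs : 0 ≤ s) :
    C / (1 + t) ^ s ≤ C :=
  div_le_self hC (Real.one_le_rpow (by linarith) hs)

theorem div_rpow_le_div {t C s : ℝ} (ht : 0 ≤ t) (hC : 0 ≤ C) (hs : 1 ≤ s) :
    C / (1 + t) ^ s ≤ C / (1 + t) := by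
  have : 1 + t ≤ (1 + t) ^ s := Real.self_le_rpow_of_one_le (by linarith) hs
  gcongr

theorem IsPerturbation.delta_nonneg {k δ : ℝ} {b : ℝ → ℝ → ℝ} (hb : IsPerturbation k δ b) :
    0 ≤ δ := by
  have := (abs_nonneg _).trans (hb.bound 0 0 le_rfl)
  simpa using this

theorem IsPerturbation.abs_damping_le {μ k δ : ℝ} (hμ : 0 < μ) (hk : 1 < k) {b : ℝ → ℝ → ℝ}
    (hb : IsPerturbation k δ b) {t : ℝ} (ht : 0 ≤ t) (x : ℝ) :
    |damping μ b t x| ≤ (μ + δ) / (1 + t) := by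
  have h1 : |μ / (1 + t)| = μ / (1 + t) := abs_of_nonneg (by positivity)
  rw [add_div]
  refine (abs_add_le _ _).trans (add_le_add h1.le ?_)
  exact (hb.bound t x ht).trans (div_rpow_le_div ht hb.delta_nonneg hk.le)

theorem IsPerturbation.isDamping {μ k δ : ℝ} (hμ : 0 < μ) (hk : 1 < k) {b : ℝ → ℝ → ℝ}
    (hb : IsPerturbation k δ b) : IsDamping (damping μ b) := by
  have hδ := hb.delta_nonneg
  refine ⟨hb.isC2_damping, μ + δ, fun t x ht => ⟨(hb.abs_damping_le hμ hk ht x).trans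
    (div_le_self (by positivity) (by linarith)), ?_⟩⟩
  rw [dt_damping hb ht]
  refine (abs_add_le _ _).trans (add_le_add ?_ ?_)
  · rw [neg_div, abs_neg, abs_of_nonneg (by positivity)]
    exact div_le_self hμ.le (one_le_pow₀ (by linarith))
  · exact (hb.bound_dt t x ht).trans (div_rpow_le_self ht hδ (by linarith))

section weight

variable {μ k θ δ : ℝ} {b h : ℝ → ℝ → ℝ}

theorem IsCorrector.isC2_weight (hh : IsCorrector μ k θ b h) : IsC2 (weight μ h) := by
  have h1 : IsCn 2 fun t x => 1 + h t x := contDiffOn_const.add hh.contDiff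
  exact (IsCn.of_time (contDiffOn_one_add_rpow μ)).mul h1

theorem dt_one_add (f : ℝ → ℝ → ℝ) (t x : ℝ) : dt (fun t x => 1 + f t x) t x = dt f t x :=
  derivWithin_const_add _

theorem dx_one_add (f : ℝ → ℝ → ℝ) (t x : ℝ) : dx (fun t x => 1 + f t x) t x = dx f t x :=
  deriv_const_add _

theorem IsCorrector.dt_weight (hh : IsCorrector μ k θ b h) {t : ℝ} (ht : 0 ≤ t) (x : ℝ) :
    dt (weight μ h) t x = μ * (1 + t) ^ (μ - 1) * (1 + h t x) + (1 + t) ^ μ * dt h t x := by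
  have h1 : IsCn 2 fun t x => 1 + h t x := contDiffOn_const.add hh.contDiff
  have h2 := (IsCn.of_time (contDiffOn_one_add_rpow (n := 2) μ)).dt_mul h1 two_ne_zero ht x
  rw [dt_time (hasDerivAt_one_add_rpow μ ht) ht, dt_one_add] at h2
  exact h2

theorem dx_weight (t x : ℝ) : dx (weight μ h) t x = (1 + t) ^ μ * dx h t x := by
  rw [← dx_one_add h, dx, dx]
  exact deriv_const_mul_field ((1 + t) ^ μ) (v := fun y => 1 + h t y)

/-- The weight solves the adjoint equation `g_tt - g_xx - (a g)_t = 0`. -/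
theorem IsCorrector.adjoint_weight (hb : IsPerturbation k δ b) (hh : IsCorrector μ k θ b h) {t : ℝ}
    (ht : 0 ≤ t) (x : ℝ) : dt (dt (weight μ h)) t x - dx (dx (weight μ h)) t x
      - dt (fun t x => damping μ b t x * weight μ h t x) t x = 0 := by
  have h2 : IsCn 2 h := hh.contDiff
  have h1 : IsCn 2 fun t x => 1 + h t x := contDiffOn_const.add hh.contDiff
  have hdt : IsCn 1 (dt h) := h2.isCn_dt (by norm_num)
  have hw : 0 < 1 + t := by positivity
  have ett : dt (dt (weight μ h)) t x = μ * ((μ - 1) * (1 + t) ^ (μ - 1 - 1)) * (1 + h t x)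
      + 2 * (μ * (1 + t) ^ (μ - 1)) * dt h t x + (1 + t) ^ μ * dt (dt h) t x := by
    have c1 : IsCn 1 fun t _ => μ * (1 + t) ^ (μ - 1) :=
      IsCn.of_time (contDiffOn_const.mul (contDiffOn_one_add_rpow (μ - 1)))
    have c2 : IsCn 1 fun t (_ : ℝ) => (1 + t) ^ μ := IsCn.of_time (contDiffOn_one_add_rpow μ)
    have h1' := h1.of_le (m := 1) (by norm_num)
    rw [dt_congr (fun s y hs => hh.dt_weight hs y) ht, (c1.mul h1').dt_add (c2.mul hdt) one_ne_zero ht,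
      c1.dt_mul h1' one_ne_zero ht, c2.dt_mul hdt one_ne_zero ht,
      dt_time (hasDerivAt_one_add_rpow μ ht) ht, dt_one_add,
      dt_time ((hasDerivAt_one_add_rpow (μ - 1) ht).const_mul μ) ht]
    ring
  have exx : dx (dx (weight μ h)) t x = (1 + t) ^ μ * dx (dx h) t x := by
    rw [dx_congr (fun s y _ => dx_weight s y) ht, dx, dx]
    exact deriv_const_mul_field ((1 + t) ^ μ) (v := fun y => dx h t y)
  have ea : dt (fun t x => damping μ b t x * weight μ h t x) t x =
      (-μ / (1 + t) ^ 2 + dt b t x) * weight μ h t x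
        + damping μ b t x * (μ * (1 + t) ^ (μ - 1) * (1 + h t x) + (1 + t) ^ μ * dt h t x) := by
    have ca : IsCn 2 (damping μ b) := hb.isC2_damping
    rw [ca.dt_mul (n := 2) hh.isC2_weight two_ne_zero ht, dt_damping hb ht, hh.dt_weight ht]
  have heq := hh.equation t x ht
  have p1 : (1 + t) ^ (μ - 1) = (1 + t) ^ μ / (1 + t) := Real.rpow_sub_one hw.ne' μ
  have p2 : (1 + t) ^ (μ - 1 - 1) = (1 + t) ^ μ / (1 + t) / (1 + t) := by
    rw [Real.rpow_sub_one hw.ne', p1]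
  -- The corrector equation eliminates h_xx; an algebraic identity remains.
  have hxx : dx (dx h) t x = dt (dt h) t x + (μ / (1 + t) - b t x) * dt h t x
      - (μ / (1 + t) * b t x + dt b t x) * (1 + h t x) := by linarith
  rw [ett, exx, ea, p2, p1, hxx, weight, damping]
  field_simp
  ring

/-- The remainder in `L(g φ)`, where `L` is the adjoint operator and `L g = 0`. -/
def remainder (a g φ : ℝ → ℝ → ℝ) (t x : ℝ) : ℝ :=
  2 * dt g t x * dt φ t x + g t x * dt (dt φ) t x - 2 * dx g t x * dx φ t x
    - g t x * dx (dx φ) t x - a t x * g t x * dt φ t x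

/-- By the Leibniz rule the terms with φ undifferentiated add up to φ L g, which vanishes. -/
theorem adjoint_mul {a g φ : ℝ → ℝ → ℝ} (ha : IsC2 a) (hg : IsC2 g) (hφ : IsC2 φ)
    {t : ℝ} (ht : 0 ≤ t) (x : ℝ)
    (hLg : dt (dt g) t x - dx (dx g) t x - dt (fun t x => a t x * g t x) t x = 0) :
    dt (dt fun t x => g t x * φ t x) t x - dx (dx fun t x => g t x * φ t x) t x
      - dt (fun s y => a s y * (g s y * φ s y)) t x = remainder a g φ t x := by
  have ha2 : IsCn 2 a := ha
  have hg2 : IsCn 2 g := hg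
  have hφ2 : IsCn 2 φ := hφ
  have hg1 := hg2.of_le (m := 1) (by norm_num)
  have hφ1 := hφ2.of_le (m := 1) (by norm_num)
  have gt := hg2.isCn_dt (m := 1) (by norm_num)
  have gx := hg2.isCn_dx (m := 1) (by norm_num)
  have φt := hφ2.isCn_dt (m := 1) (by norm_num)
  have φx := hφ2.isCn_dx (m := 1) (by norm_num)
  have e3 : (fun s y => a s y * (g s y * φ s y)) = fun s y => a s y * g s y * φ s y := by
    funext s y
    ring
  rw [dt_congr (fun s y hs => hg2.dt_mul hφ2 two_ne_zero hs y) ht,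
    dx_congr (fun s y hs => hg2.dx_mul hφ2 two_ne_zero hs y) ht,
    (gt.mul hφ1).dt_add (hg1.mul φt) one_ne_zero ht, (gx.mul hφ1).dx_add (hg1.mul φx) one_ne_zero ht,
    gt.dt_mul hφ1 one_ne_zero ht, hg1.dt_mul φt one_ne_zero ht,
    gx.dx_mul hφ1 one_ne_zero ht, hg1.dx_mul φx one_ne_zero ht, e3,
    (ha2.mul hg2).dt_mul hφ2 two_ne_zero ht, remainder]
  linear_combination φ t x * hLg

theorem IsCorrector.abs_le (hk : 1 < k) (hθ : 0 ≤ θ) (hh : IsCorrector μ k θ b h) {t : ℝ}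
    (ht : 0 ≤ t) (x : ℝ) : |h t x| ≤ θ :=
  (hh.bound t x ht).trans (div_rpow_le_self ht hθ (by linarith))

theorem IsCorrector.le_weight (hk : 1 < k) (hθ : 0 ≤ θ) (hh : IsCorrector μ k θ b h)
    {t : ℝ} (ht : 0 ≤ t) (x : ℝ) : (1 - θ) * (1 + t) ^ μ ≤ weight μ h t x := by
  have h1 := (_root_.abs_le.1 (hh.abs_le hk hθ ht x)).1
  rw [weight, mul_comm]
  gcongr
  linarith

/-- A derivative of g, or multiplication by a, costs a factor 1/(1+t). For h_t and h_x this uses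
their decay of order k ≥ 1. -/
theorem IsCorrector.weight_bounds (hμ : 0 < μ) (hk : 1 < k) (hθ : 0 ≤ θ) (hθ1 : θ < 1)
    (hb : IsPerturbation k δ b) (hh : IsCorrector μ k θ b h) :
    ∃ C, 0 ≤ C ∧ ∀ t x, 0 ≤ t → |weight μ h t x| ≤ 2 * (1 + t) ^ μ ∧
      |dt (weight μ h) t x| ≤ C * ((1 + t) ^ μ / (1 + t)) ∧
      |dx (weight μ h) t x| ≤ C * ((1 + t) ^ μ / (1 + t)) ∧
      |damping μ b t x * weight μ h t x| ≤ C * ((1 + t) ^ μ / (1 + t)) := by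
  obtain ⟨C, hC, hCb⟩ := hh.bound_deriv
  have hδ := hb.delta_nonneg
  refine ⟨2 * μ + C + 2 * (μ + δ), by positivity, fun t x ht => ?_⟩
  have hw : 0 < 1 + t := by positivity
  have hP : 0 ≤ (1 + t) ^ μ := by positivity
  have hPw : 0 ≤ (1 + t) ^ μ / (1 + t) := by positivity
  have h1 : |1 + h t x| ≤ 2 := by
    have := _root_.abs_le.1 (hh.abs_le hk hθ ht x)
    exact _root_.abs_le.2 ⟨by linarith, by linarith⟩
  have hg : |weight μ h t x| ≤ 2 * (1 + t) ^ μ := by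
    rw [weight, abs_mul, abs_of_nonneg hP, mul_comm]
    gcongr
  obtain ⟨d1, d2⟩ := hCb t x ht
  have hkk := div_rpow_le_div ht hC.le hk.le
  have key : ∀ d : ℝ, |d| ≤ C / (1 + t) ^ k → |(1 + t) ^ μ * d| ≤ C * ((1 + t) ^ μ / (1 + t)) := by
    intro d hd
    rw [abs_mul, abs_of_nonneg hP]
    calc (1 + t) ^ μ * |d| ≤ (1 + t) ^ μ * (C / (1 + t)) := by gcongr; exact hd.trans hkk
      _ = _ := by ring
  have mono : ∀ C' : ℝ, C' ≤ 2 * μ + C + 2 * (μ + δ) → C' * ((1 + t) ^ μ / (1 + t)) ≤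
      (2 * μ + C + 2 * (μ + δ)) * ((1 + t) ^ μ / (1 + t)) := fun C' h => by gcongr
  refine ⟨hg, ?_, ?_, ?_⟩
  · refine le_trans ?_ (mono (2 * μ + C) (by linarith))
    rw [hh.dt_weight ht, Real.rpow_sub_one hw.ne', add_mul]
    refine (abs_add_le _ _).trans (add_le_add ?_ (key _ d1))
    rw [abs_mul, abs_of_nonneg (by positivity)]
    calc μ * ((1 + t) ^ μ / (1 + t)) * |1 + h t x| ≤ μ * ((1 + t) ^ μ / (1 + t)) * 2 := by gcongr
      _ = _ := by ring
  · refine le_trans ?_ (mono C (by linarith))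
    rw [dx_weight]
    exact key _ d2
  · refine le_trans ?_ (mono (2 * (μ + δ)) (by linarith))
    rw [abs_mul]
    calc |damping μ b t x| * |weight μ h t x| ≤ (μ + δ) / (1 + t) * (2 * (1 + t) ^ μ) :=
          mul_le_mul (hb.abs_damping_le hμ hk ht x) hg (abs_nonneg _) (by positivity)
      _ = _ := by ring

end weight

/-! ### Scaled cutoffs on the half-plane -/

/-- The space-time cutoff at scale `R`. -/
def bump (χ : ℝ → ℝ) (R t x : ℝ) : ℝ := χ (t / R) * χ (x / R)

namespace IsCutoff

variable {p C R t x : ℝ} {χ : ℝ → ℝ}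

theorem hasDerivAt (hχ : IsCutoff p C χ) (y : ℝ) : HasDerivAt χ (deriv χ y) y :=
  (hχ.contDiff.differentiable two_ne_zero y).hasDerivAt

theorem contDiff_deriv (hχ : IsCutoff p C χ) : ContDiff ℝ 1 (deriv χ) := by
  have h : ContDiff ℝ (1 + 1) χ := by simpa [one_add_one_eq_two] using hχ.contDiff
  exact (contDiff_succ_iff_deriv.1 h).2.2

theorem hasDerivAt_deriv (hχ : IsCutoff p C χ) (y : ℝ) :
    HasDerivAt (deriv χ) (deriv (deriv χ) y) y :=
  (hχ.contDiff_deriv.differentiable one_ne_zero y).hasDerivAt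

theorem isC2_bump (hχ : IsCutoff p C χ) (R : ℝ) : IsC2 (bump χ R) := by
  refine IsCn.of_contDiff ?_
  have h1 : ContDiff ℝ 2 fun q : ℝ × ℝ => q.1 / R := by fun_prop
  have h2 : ContDiff ℝ 2 fun q : ℝ × ℝ => q.2 / R := by fun_prop
  exact (hχ.contDiff.comp h1).mul (hχ.contDiff.comp h2)

theorem hasDerivAt_scale {f : ℝ → ℝ} {f' : ℝ} (h : HasDerivAt f f' (t / R)) :
    HasDerivAt (fun t => f (t / R)) (f' / R) t :=
  (h.comp t ((hasDerivAt_id t).div_const R)).congr_deriv (by ring)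

theorem dt_bump (hχ : IsCutoff p C χ) (ht : 0 ≤ t) (x : ℝ) :
    dt (bump χ R) t x = deriv χ (t / R) / R * χ (x / R) :=
  ((hasDerivAt_scale (hχ.hasDerivAt _)).mul_const _).hasDerivWithinAt.derivWithin
    (uniqueDiffOn_Ici 0 t ht)

theorem dt_dt_bump (hχ : IsCutoff p C χ) (ht : 0 ≤ t) (x : ℝ) :
    dt (dt (bump χ R)) t x = deriv (deriv χ) (t / R) / R / R * χ (x / R) := by
  rw [dt_congr (fun s y hs => hχ.dt_bump (R := R) hs y) ht]
  exact (((hasDerivAt_scale (hχ.hasDerivAt_deriv _)).div_const R).mul_const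
    _).hasDerivWithinAt.derivWithin (uniqueDiffOn_Ici 0 t ht)

theorem dx_bump (hχ : IsCutoff p C χ) (t x : ℝ) :
    dx (bump χ R) t x = χ (t / R) * (deriv χ (x / R) / R) :=
  ((hasDerivAt_scale (hχ.hasDerivAt _)).const_mul _).deriv

theorem dx_dx_bump (hχ : IsCutoff p C χ) (ht : 0 ≤ t) (x : ℝ) :
    dx (dx (bump χ R)) t x = χ (t / R) * (deriv (deriv χ) (x / R) / R / R) := by
  rw [dx_congr (fun s y _ => hχ.dx_bump (R := R) s y) ht]
  exact (((hasDerivAt_scale (hχ.hasDerivAt_deriv _)).div_const R).const_mul _).deriv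

theorem bump_nonneg (hχ : IsCutoff p C χ) (R t x : ℝ) : 0 ≤ bump χ R t x :=
  mul_nonneg (hχ.nonneg _) (hχ.nonneg _)

theorem bump_le_one (hχ : IsCutoff p C χ) (R t x : ℝ) : bump χ R t x ≤ 1 :=
  mul_le_one₀ (hχ.le_one _) (hχ.nonneg _) (hχ.le_one _)

theorem two_le_abs_div (hR : 0 < R) (h : 2 * R ≤ |x|) : 2 ≤ |x / R| := by
  rwa [abs_div, abs_of_pos hR, le_div_iff₀ hR]

theorem abs_div_le_one (hR : 0 < R) (h : |x| ≤ R) : |x / R| ≤ 1 := by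
  rwa [abs_div, abs_of_pos hR, div_le_one hR]

theorem abs_div_lt_one (hR : 0 < R) (h : |x| < R) : |x / R| < 1 := by
  rwa [abs_div, abs_of_pos hR, div_lt_one hR]

theorem bump_eq_zero (hχ : IsCutoff p C χ) (hR : 0 < R) (h : 2 * R ≤ |t| ∨ 2 * R ≤ |x|) :
    bump χ R t x = 0 := by
  rcases h with h | h
  · rw [bump, hχ.eq_zero _ (two_le_abs_div hR h), zero_mul]
  · rw [bump, hχ.eq_zero _ (two_le_abs_div hR h), mul_zero]

theorem bump_eq_one (hχ : IsCutoff p C χ) (hR : 0 < R) (ht : |t| ≤ R) (hx : |x| ≤ R) :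
    bump χ R t x = 1 := by
  rw [bump, hχ.eq_one _ (abs_div_le_one hR ht), hχ.eq_one _ (abs_div_le_one hR hx), one_mul]

theorem suppIn_bump (hχ : IsCutoff p C χ) (hR : 0 < R) : SuppIn (2 * R) (2 * R) (bump χ R) := by
  intro t x ht hx
  refine hχ.bump_eq_zero hR ?_
  rcases hx with hx | hx
  · exact Or.inl (hx.le.trans (le_abs_self t))
  · refine Or.inr ?_
    by_contra hcon
    exact hx (abs_le.1 (not_le.1 hcon).le)

theorem deriv_eq_zero (hχ : IsCutoff p C χ) {y : ℝ} (hy : |y| < 1) : deriv χ y = 0 := by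
  have : χ =ᶠ[𝓝 y] fun _ => 1 := by
    filter_upwards [(continuous_abs.isOpen_preimage _ isOpen_Iio).mem_nhds hy] with z hz
    exact hχ.eq_one z (le_of_lt hz)
  rw [this.deriv_eq, deriv_const]

theorem deriv_deriv_eq_zero (hχ : IsCutoff p C χ) {y : ℝ} (hy : |y| < 1) :
    deriv (deriv χ) y = 0 := by
  have : deriv χ =ᶠ[𝓝 y] fun _ => 0 := by
    filter_upwards [(continuous_abs.isOpen_preimage _ isOpen_Iio).mem_nhds hy] with z hz
    exact hχ.deriv_eq_zero hz
  rw [this.deriv_eq, deriv_const]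

theorem remainder_eq_zero (hχ : IsCutoff p C χ) (hR : 0 < R) (ht : 0 ≤ t) (htR : t < R)
    (hx : |x| < R) (a g : ℝ → ℝ → ℝ) : remainder a g (bump χ R) t x = 0 := by
  have h1 := abs_div_lt_one hR (show |t| < R by rwa [abs_of_nonneg ht])
  have h2 := abs_div_lt_one hR hx
  rw [remainder, hχ.dt_bump ht, hχ.dt_dt_bump ht, hχ.dx_bump, hχ.dx_dx_bump ht,
    hχ.deriv_eq_zero h1, hχ.deriv_eq_zero h2, hχ.deriv_deriv_eq_zero h1,
    hχ.deriv_deriv_eq_zero h2]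
  ring

theorem abs_bump_le (hχ : IsCutoff p C χ) (hp : 1 < p) (hC : 0 ≤ C) {d : ℝ} (t x : ℝ)
    (hd : |d| ≤ C * χ t ^ (1 / p)) : |d * χ x| ≤ C * (χ t * χ x) ^ (1 / p) := by
  have hp1 : 1 / p ≤ 1 := by
    rw [div_le_one (by linarith)]
    exact hp.le
  rw [abs_mul, abs_of_nonneg (hχ.nonneg x), Real.mul_rpow (hχ.nonneg t) (hχ.nonneg x), ← mul_assoc]
  exact mul_le_mul hd (Real.self_le_rpow_of_le_one (hχ.nonneg x) (hχ.le_one x) hp1) (hχ.nonneg x)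
    (mul_nonneg hC (Real.rpow_nonneg (hχ.nonneg t) _))

/-- The first-order terms enter with total multiplicity 2 + 2 + 1 = 5 and constant C'. Each of the
two second-order terms carries |g| ≤ 2P and R^(-2), of which one factor 1/R is traded for 3/(1+t);
this gives 2 · 6 = 12. -/
theorem abs_remainder_le (hχ : IsCutoff p C χ) (hp : 1 < p) (hC : 0 ≤ C) {a g : ℝ → ℝ → ℝ}
    {P C' : ℝ} (hC' : 0 ≤ C') (hR : 1 ≤ R) (ht : 0 ≤ t) (hg : |g t x| ≤ 2 * P)
    (hgt : |dt g t x| ≤ C' * (P / (1 + t))) (hgx : |dx g t x| ≤ C' * (P / (1 + t)))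
    (hag : |a t x * g t x| ≤ C' * (P / (1 + t))) :
    |remainder a g (bump χ R) t x| ≤
      (5 * C' + 12) * C * (P / ((1 + t) * R)) * bump χ R t x ^ (1 / p) := by
  have hR0 : 0 < R := by linarith
  have hw : 0 < 1 + t := by positivity
  have hP : 0 ≤ P := by linarith [(abs_nonneg _).trans hg]
  set B := bump χ R t x ^ (1 / p) with hB
  have hB0 : 0 ≤ B := Real.rpow_nonneg (hχ.bump_nonneg R t x) _
  have b1 : |deriv χ (t / R) * χ (x / R)| ≤ C * B := hχ.abs_bump_le hp hC _ _ (hχ.deriv_le _)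
  have b2 : |deriv (deriv χ) (t / R) * χ (x / R)| ≤ C * B :=
    hχ.abs_bump_le hp hC _ _ (hχ.deriv_deriv_le _)
  have b3 : |deriv χ (x / R) * χ (t / R)| ≤ C * B := by
    have := hχ.abs_bump_le hp hC (x / R) (t / R) (hχ.deriv_le _)
    rwa [mul_comm (χ (x / R))] at this
  have b4 : |deriv (deriv χ) (x / R) * χ (t / R)| ≤ C * B := by
    have := hχ.abs_bump_le hp hC (x / R) (t / R) (hχ.deriv_deriv_le _)
    rwa [mul_comm (χ (x / R))] at this
  -- On the support t ≤ 2R, so 1 + t ≤ 3R because R ≥ 1.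
  have hBR : B / R ≤ 3 * B / (1 + t) := by
    rcases le_or_gt t (2 * R) with h | h
    · rw [div_le_div_iff₀ hR0 hw]
      nlinarith
    · have : B = 0 := by
        rw [hB, hχ.bump_eq_zero hR0 (Or.inl (h.le.trans (le_abs_self t))),
          Real.zero_rpow (by positivity)]
      simp [this]
  have k1 : ∀ f d : ℝ, |f| ≤ C' * (P / (1 + t)) → |d| ≤ C * B →
      |f * (d / R)| ≤ C' * C * (P / ((1 + t) * R)) * B := by
    intro f d hf hd
    rw [abs_mul, abs_div, abs_of_pos hR0]
    calc |f| * (|d| / R) ≤ C' * (P / (1 + t)) * (C * B / R) := by gcongr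
      _ = _ := by field_simp
  have k2 : ∀ d : ℝ, |d| ≤ C * B → |g t x * (d / R / R)| ≤ 6 * C * (P / ((1 + t) * R)) * B := by
    intro d hd
    rw [abs_mul, abs_div, abs_div, abs_of_pos hR0]
    calc |g t x| * (|d| / R / R) ≤ 2 * P * (C * B / R / R) := by gcongr
      _ = 2 * P * C / R * (B / R) := by ring
      _ ≤ 2 * P * C / R * (3 * B / (1 + t)) := by gcongr
      _ = _ := by field_simp; ring
  have e : remainder a g (bump χ R) t x =
      2 * (dt g t x * (deriv χ (t / R) * χ (x / R) / R))
      + g t x * (deriv (deriv χ) (t / R) * χ (x / R) / R / R)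
      - 2 * (dx g t x * (deriv χ (x / R) * χ (t / R) / R))
      - g t x * (deriv (deriv χ) (x / R) * χ (t / R) / R / R)
      - a t x * g t x * (deriv χ (t / R) * χ (x / R) / R) := by
    rw [remainder, hχ.dt_bump ht, hχ.dt_dt_bump ht, hχ.dx_bump, hχ.dx_dx_bump ht]
    ring
  rw [e]
  have a1 := abs_le.1 (k1 _ _ hgt b1)
  have a2 := abs_le.1 (k2 _ b2)
  have a3 := abs_le.1 (k1 _ _ hgx b3)
  have a4 := abs_le.1 (k2 _ b4)
  have a5 := abs_le.1 (k1 _ _ hag b1)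
  have hsum : (5 * C' + 12) * C * (P / ((1 + t) * R)) * B =
      5 * (C' * C * (P / ((1 + t) * R)) * B) + 2 * (6 * C * (P / ((1 + t) * R)) * B) := by ring
  rw [hsum, abs_le]
  constructor <;> linarith [a1.1, a1.2, a2.1, a2.2, a3.1, a3.2, a4.1, a4.2, a5.1, a5.2]

end IsCutoff

/-! ### Young's inequality -/

/-- The exponents p and s + 1 are conjugate. The parameter is split as K^(1/p) · K^(-1/p) = 1
between the factors, and the divisors p and s + 1 are dropped. -/
theorem young_with_parameter {p s a b K : ℝ} (hs : 0 < s) (hp : p = 1 + 1 / s) (ha : 0 ≤ a)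
    (hb : 0 ≤ b) (hK : 0 < K) : a * b ≤ K * a ^ p + K ^ (-s) * b ^ (s + 1) := by
  have hp1 : 1 < p := by
    rw [hp]
    have : 0 < 1 / s := by positivity
    linarith
  have hp0 : p ≠ 0 := by linarith
  have hpq : p.HolderConjugate (s + 1) := by
    rw [Real.holderConjugate_iff_eq_conjExponent hp1, hp]
    field_simp
    ring
  have hK1 : 0 ≤ K ^ (1 / p) := Real.rpow_nonneg hK.le _
  have hK2 : 0 ≤ K ^ (-(1 / p)) := Real.rpow_nonneg hK.le _
  have h := Real.young_inequality_of_nonneg (mul_nonneg hK1 ha) (mul_nonneg hK2 hb) hpq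
  have e1 : K ^ (1 / p) * K ^ (-(1 / p)) = 1 := by
    rw [← Real.rpow_add hK, add_neg_cancel, Real.rpow_zero]
  have e2 : (K ^ (1 / p) * a) ^ p = K * a ^ p := by
    rw [Real.mul_rpow hK1 ha, ← Real.rpow_mul hK.le, one_div_mul_cancel hp0, Real.rpow_one]
  have e3 : (K ^ (-(1 / p)) * b) ^ (s + 1) = K ^ (-s) * b ^ (s + 1) := by
    rw [Real.mul_rpow hK2 hb, ← Real.rpow_mul hK.le]
    congr 2
    rw [hp]
    field_simp
  rw [e2, e3] at h
  have n1 : 0 ≤ K * a ^ p := mul_nonneg hK.le (Real.rpow_nonneg ha _)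
  have n2 : 0 ≤ K ^ (-s) * b ^ (s + 1) := mul_nonneg (Real.rpow_nonneg hK.le _) (Real.rpow_nonneg hb _)
  calc a * b = K ^ (1 / p) * K ^ (-(1 / p)) * (a * b) := by rw [e1, one_mul]
    _ = K ^ (1 / p) * a * (K ^ (-(1 / p)) * b) := by ring
    _ ≤ _ := h
    _ ≤ _ := add_le_add (div_le_self n1 hp1.le) (div_le_self n2 (by linarith))

/-- The nonlinear term absorbs the remainder: pointwise form. -/
theorem mul_le_of_remainder_le {p s μ K R t D y Z g φ ν : ℝ} (hs : 0 < s) (hp : p = 1 + 1 / s)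
    (hμs : μ ≤ 2 * s) (hK : 0 < K) (hR : 0 < R) (ht : 0 ≤ t) (hD : 0 ≤ D) (hν : 0 < ν)
    (hg : ν * (1 + t) ^ μ ≤ g) (hφ : 0 ≤ φ)
    (hZ : |Z| ≤ D * ((1 + t) ^ μ / ((1 + t) * R)) * φ ^ (1 / p)) :
    y * Z ≤ K * (|y| ^ p * (g * φ))
      + K ^ (-s) * (D ^ (s + 1) * ν ^ (-s) * R ^ (-(s + 1)) * (1 + t) ^ (s - 1)) := by
  have hw : 0 < 1 + t := by positivity
  have hP : 0 < (1 + t) ^ μ := Real.rpow_pos_of_pos hw _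
  have hg0 : 0 < g := (mul_pos hν hP).trans_le hg
  have hp0 : p ≠ 0 := by
    rw [hp]
    positivity
  -- Inserting g^(1/p) g^(-1/p) = 1 makes the p-th power of the first factor exactly |y|^p g φ.
  set b := D * ((1 + t) ^ μ / ((1 + t) * R)) * g ^ (-(1 / p)) with hb
  have hb0 : 0 ≤ b := by positivity
  have ha0 : 0 ≤ |y| * (g * φ) ^ (1 / p) := by positivity
  have h1 : y * Z ≤ |y| * (g * φ) ^ (1 / p) * b := by
    calc y * Z ≤ |y| * |Z| := (le_abs_self _).trans (abs_mul y Z).le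
      _ ≤ |y| * (D * ((1 + t) ^ μ / ((1 + t) * R)) * φ ^ (1 / p)) := by gcongr
      _ = |y| * (D * ((1 + t) ^ μ / ((1 + t) * R)) * φ ^ (1 / p))
          * (g ^ (1 / p) * g ^ (-(1 / p))) := by
          rw [← Real.rpow_add hg0, add_neg_cancel, Real.rpow_zero, mul_one]
      _ = _ := by
          rw [hb, Real.mul_rpow hg0.le hφ]
          ring
  refine h1.trans ((young_with_parameter hs hp ha0 hb0 hK).trans (add_le_add (le_of_eq ?_) ?_))
  · rw [Real.mul_rpow (abs_nonneg y) (by positivity), ← Real.rpow_mul (by positivity),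
      one_div_mul_cancel hp0, Real.rpow_one]
  · refine mul_le_mul_of_nonneg_left ?_ (Real.rpow_nonneg hK.le _)
    have e1 : (g ^ (-(1 / p))) ^ (s + 1) = g ^ (-s) := by
      rw [← Real.rpow_mul hg0.le]
      congr 1
      rw [hp]
      field_simp
    have e2 : ((1 + t) ^ μ / ((1 + t) * R)) ^ (s + 1) =
        ((1 + t) ^ μ) ^ (s + 1) * (1 + t) ^ (-(s + 1)) * R ^ (-(s + 1)) := by
      rw [Real.div_rpow hP.le (by positivity), Real.mul_rpow hw.le hR.le, Real.rpow_neg hw.le,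
        Real.rpow_neg hR.le]
      field_simp
    have e3 : g ^ (-s) ≤ (ν * (1 + t) ^ μ) ^ (-s) :=
      Real.rpow_le_rpow_of_nonpos (by positivity) hg (by linarith)
    rw [Real.mul_rpow hν.le hP.le] at e3
    have e4 : ((1 + t) ^ μ) ^ (s + 1) * ((1 + t) ^ μ) ^ (-s) = (1 + t) ^ μ := by
      rw [← Real.rpow_add hP, show s + 1 + -s = 1 by ring, Real.rpow_one]
    -- The restriction p ≤ 1 + 2/μ enters here, in the form μ ≤ 2s.
    have e5 : (1 + t) ^ μ * (1 + t) ^ (-(s + 1)) ≤ (1 + t) ^ (s - 1) := by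
      rw [← Real.rpow_add hw]
      exact Real.rpow_le_rpow_of_exponent_le (by linarith) (by linarith)
    rw [hb, Real.mul_rpow (by positivity) (by positivity), Real.mul_rpow hD (by positivity), e1, e2]
    calc D ^ (s + 1) * (((1 + t) ^ μ) ^ (s + 1) * (1 + t) ^ (-(s + 1)) * R ^ (-(s + 1))) * g ^ (-s)
        ≤ D ^ (s + 1) * (((1 + t) ^ μ) ^ (s + 1) * (1 + t) ^ (-(s + 1)) * R ^ (-(s + 1)))
          * (ν ^ (-s) * ((1 + t) ^ μ) ^ (-s)) := by gcongr
      _ = D ^ (s + 1) * ν ^ (-s) * R ^ (-(s + 1)) * ((((1 + t) ^ μ) ^ (s + 1)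
          * ((1 + t) ^ μ) ^ (-s)) * (1 + t) ^ (-(s + 1))) := by ring
      _ ≤ _ := by
          rw [e4]
          gcongr

/-! ### Nonexistence of global solutions -/

theorem integrable_mul_memLp (v : L2) {f : ℝ → ℝ} (hf : MemLp f 2 volume) :
    Integrable fun x => v x * f x := (Lp.memLp v).integrable_mul (q := 2) hf

theorem integrable_rpow_mul_memLp {p : ℝ} (hp : 1 < p) (u : H1) {f : ℝ → ℝ}
    (hf : MemLp f 2 volume) : Integrable fun x => |toL2 u x| ^ p * f x :=
  (memLp_nonlin hp u).integrable_mul (q := 2) hf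

theorem integral_rpow_mul_eq_inner {p : ℝ} (hp : 1 < p) (u : H1) {f : ℝ → ℝ}
    (hf : MemLp f 2 volume) : ∫ x, |toL2 u x| ^ p * f x = inner ℝ (nonlin p u) (cls f) := by
  rw [inner_cls _ hf]
  apply integral_congr_ae
  filter_upwards [coe_nonlin hp u] with x hx
  rw [hx]

theorem suppIn_remainder {T₁ M : ℝ} {φ : ℝ → ℝ → ℝ} (hφ : SuppIn T₁ M φ) (a g : ℝ → ℝ → ℝ) :
    SuppIn T₁ M (remainder a g φ) := by
  intro t x ht hx
  rw [remainder, hφ.dt t x ht hx, hφ.dt.dt t x ht hx, hφ.dx t x ht hx, hφ.dx.dx t x ht hx]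
  ring

theorem isCn_remainder {a g φ : ℝ → ℝ → ℝ} (ha : IsC2 a) (hg : IsC2 g) (hφ : IsC2 φ) :
    IsCn 0 (remainder a g φ) := by
  have ha0 : IsCn 0 a := IsCn.of_le (n := 2) ha (by norm_num)
  have hg0 : IsCn 0 g := IsCn.of_le (n := 2) hg (by norm_num)
  have gt : IsCn 0 (dt g) := IsCn.isCn_dt (n := 2) hg (by norm_num)
  have gx : IsCn 0 (dx g) := IsCn.isCn_dx (n := 2) hg (by norm_num)
  have φt : IsCn 1 (dt φ) := IsCn.isCn_dt (n := 2) hφ (by norm_num)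
  have φx : IsCn 1 (dx φ) := IsCn.isCn_dx (n := 2) hφ (by norm_num)
  have φt0 := φt.of_le (m := 0) (by norm_num)
  have φx0 := φx.of_le (m := 0) (by norm_num)
  have h2 : IsCn 0 fun _ _ => (2 : ℝ) := IsCn.of_contDiff contDiff_const
  exact (((((h2.mul gt).mul φt0).add (hg0.mul (φt.isCn_dt (by simp)))).sub
    ((h2.mul gx).mul φx0)).sub (hg0.mul (φx.isCn_dx (by simp)))).sub ((ha0.mul hg0).mul φt0)

/-- A nonnegative sequence cannot satisfy the inequalities to which a global solution leads. -/
theorem false_of_absorption {I : ℕ → ℝ} {c D s : ℝ} {N : ℕ} (hc : 0 < c) (hs : 0 < s)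
    (hI : ∀ n, 0 ≤ I n)
    (h : ∀ n, N ≤ n → ∀ K : ℝ, 0 < K → c + I (n + 1) ≤ K * (I (n + 1) - I n) + D * K ^ (-s)) :
    False := by
  -- With K = 1/2 half of I (n+1) is absorbed, and c and I n only help: the sequence is bounded.
  have hbd : ∀ n, N ≤ n → I (n + 1) ≤ 2 * (D * (1 / 2 : ℝ) ^ (-s)) := fun n hn => by
    have := h n hn (1 / 2) (by norm_num)
    linarith [hI n]
  have hlim : Tendsto (fun K : ℝ => D * K ^ (-s)) atTop (𝓝 0) := by
    simpa using (tendsto_rpow_neg_atTop hs).const_mul D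
  -- With K so large that the error is below c/2, each step raises I by at least c/(2K), against the
  -- bound.
  obtain ⟨K, hK, hK0⟩ := ((hlim.eventually (gt_mem_nhds (half_pos hc))).and
    (eventually_gt_atTop 0)).exists
  have hstep : ∀ n, N ≤ n → I n + c / (2 * K) ≤ I (n + 1) := fun n hn => by
    have h1 := h n hn K hK0
    have h2 : c / 2 ≤ K * (I (n + 1) - I n) := by linarith [hI (n + 1)]
    have h3 : c / (2 * K) ≤ I (n + 1) - I n := by
      rw [div_le_iff₀ (by positivity)]
      linarith
    linarith
  have hgrow : ∀ j : ℕ, j * (c / (2 * K)) ≤ I (N + j) := by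
    intro j
    induction j with
    | zero => simpa using hI N
    | succ j ih =>
      have := hstep (N + j) (Nat.le_add_right _ _)
      push_cast
      rw [← add_assoc]
      linarith
  obtain ⟨j, hj⟩ := exists_nat_gt (2 * (D * (1 / 2 : ℝ) ^ (-s)) / (c / (2 * K)))
  rw [div_lt_iff₀ (by positivity)] at hj
  have h1 := hgrow (j + 1)
  have h2 := hbd (N + j) (Nat.le_add_right _ _)
  rw [← add_assoc] at h1
  push_cast at h1
  have : 0 < c / (2 * K) := by positivity
  nlinarith

/-! ### The tested identity and the absorption of its remainder -/

section

variable {p s μ k θ δ C R : ℝ} {χ : ℝ → ℝ} {b h : ℝ → ℝ → ℝ}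

theorem IsCutoff.isC2_weight_bump (hχ : IsCutoff p C χ) (hh : IsCorrector μ k θ b h) (R : ℝ) :
    IsC2 fun t x => weight μ h t x * bump χ R t x :=
  IsCn.mul (n := 2) hh.isC2_weight (hχ.isC2_bump R)

/-- The weak formulation tested with `g` times a cutoff. -/
theorem IsSolution.weight_identity (hχ : IsCutoff p C χ) (hb : IsPerturbation k δ b)
    (hh : IsCorrector μ k θ b h) {u₀ : H1} {u₁ : L2} {u : ℝ → H1}
    (hu : IsSolution (damping μ b) p u₀ u₁ ⊤ u) (hR : 0 < R) :
    ∫ t in (0 : ℝ)..(2 * R + 1), ∫ x, toL2 (u t) x *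
        remainder (damping μ b) (weight μ h) (bump χ R) t x
      = (∫ x, ((-dt (weight μ h) 0 x + weight μ h 0 x * damping μ b 0 x) * toL2 u₀ x
          + weight μ h 0 x * u₁ x) * χ (x / R))
        + ∫ t in timeInterval ⊤, ∫ x, |toL2 (u t) x| ^ p * (weight μ h t x * bump χ R t x) := by
  have hs := hχ.suppIn_bump hR
  have hψ := hχ.isC2_weight_bump hh R
  have key := hu.2.2 _ (isTest_of_suppIn (T := ⊤) (EReal.coe_lt_top _) hψ (hs.mul_left _))
  have e : ∀ t ∈ timeInterval ⊤, ∫ x, toL2 (u t) x *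
        (dt (dt fun t x => weight μ h t x * bump χ R t x) t x
          - dx (dx fun t x => weight μ h t x * bump χ R t x) t x
          - dt (fun s y => damping μ b s y * (weight μ h s y * bump χ R s y)) t x)
      = ∫ x, toL2 (u t) x * remainder (damping μ b) (weight μ h) (bump χ R) t x := by
    intro t ht
    simp only [adjoint_mul hb.isC2_damping hh.isC2_weight (hχ.isC2_bump R) ht.1 _
      (hh.adjoint_weight hb ht.1 _)]
  rw [setIntegral_congr_fun (measurableSet_timeInterval ⊤) e, setIntegral_timeInterval
    (T₁ := 2 * R) (T₂ := 2 * R + 1) (by positivity) (by linarith) (EReal.coe_lt_top _)] at key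
  · rw [key]
    congr 1
    refine integral_congr_ae (Eventually.of_forall fun x => ?_)
    have hg2 : IsCn 2 (weight μ h) := hh.isC2_weight
    beta_reduce
    -- The time cutoff is identically 1 near t = 0, so its derivative does not enter the data term.
    rw [hg2.dt_mul (n := 2) (hχ.isC2_bump R) two_ne_zero le_rfl, hχ.dt_bump le_rfl, bump, zero_div,
      hχ.deriv_eq_zero (by simp), hχ.eq_one 0 (by simp)]
    ring
  · intro t ht ht'
    simp [suppIn_remainder hs _ _ t _ ht (Or.inl ht')]

/-- The data term is bounded below for large cutoffs. -/
theorem IsCutoff.le_integral_data (hχ : IsCutoff p C χ) (hR : 0 < R) {f : ℝ → ℝ} {c : ℝ}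
    (hf : LocallyIntegrable f) (hc : ∀ s, R ≤ s → c ≤ ∫ x in (-s)..s, f x) :
    c ≤ ∫ x, f x * χ (x / R) := by
  have hη : ContDiff ℝ 1 fun x => χ (x / R) := by
    have h1 : ContDiff ℝ 1 fun x : ℝ => x / R := by fun_prop
    exact (hχ.contDiff.of_le (by norm_num)).comp h1
  have h := le_integral_mul_cutoff (L := 2 * R) hf hη (fun x => by rw [neg_div, hχ.even])
    (fun x hx y hy hxy => hχ.antitone (div_nonneg hx hR.le) (div_nonneg hy hR.le) (by gcongr))
    (fun x hx hxR => hχ.eq_one _ (abs_div_le_one hR (by rwa [abs_of_nonneg hx]))) hR.le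
    (by linarith) (hχ.eq_zero _ (two_le_abs_div hR (le_abs_self _))) hc
  refine h.trans (le_of_eq ?_)
  rw [intervalIntegral.integral_of_le (by linarith), ← integral_Icc_eq_integral_Ioc]
  refine setIntegral_eq_integral_of_forall_compl_eq_zero fun x hx => ?_
  rw [hχ.eq_zero _ (two_le_abs_div hR ?_), mul_zero]
  by_contra hcon
  exact hx (abs_le.1 (not_le.1 hcon).le)

theorem integral_one_add_rpow_le (hs : 0 < s) (hR : 1 ≤ R) :
    ∫ t in (0 : ℝ)..(2 * R + 1), (1 + t) ^ (s - 1) ≤ (4 * R) ^ s / s := by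
  rw [intervalIntegral.integral_comp_add_left (fun t : ℝ => t ^ (s - 1)),
    integral_rpow (Or.inl (by linarith)), sub_add_cancel]
  have h1 : (1 + (2 * R + 1)) ^ s ≤ (4 * R) ^ s :=
    Real.rpow_le_rpow (by positivity) (by linarith) hs.le
  have h2 : (0 : ℝ) ≤ (1 + 0) ^ s := by positivity
  gcongr
  linarith

/-- The space integral of the remainder is absorbed by the nonlinear term. -/
theorem integral_remainder_le {D ν K t : ℝ} {g Z : ℝ → ℝ → ℝ} (hχ : IsCutoff p C χ) (hs : 0 < s)
    (hp : p = 1 + 1 / s) (hμs : μ ≤ 2 * s) (hK : 0 < K) (hR : 0 < R) (ht : 0 ≤ t) (hD : 0 ≤ D)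
    (hν : 0 < ν) (hg : ∀ x, ν * (1 + t) ^ μ ≤ g t x) (hgc : Continuous (g t))
    (hZc : Continuous (Z t))
    (hZ : ∀ x, |Z t x| ≤ D * ((1 + t) ^ μ / ((1 + t) * R)) * bump χ R t x ^ (1 / p))
    (hZ0 : ∀ x, t < R → |x| < R → Z t x = 0) (u : H1) :
    ∫ x, toL2 u x * Z t x ≤ K * ((∫ x, |toL2 u x| ^ p * (g t x * bump χ R t x))
        - ∫ x, |toL2 u x| ^ p * (g t x * bump χ (R / 2) t x))
      + K ^ (-s) * (D ^ (s + 1) * ν ^ (-s) * R ^ (-(s + 1)) * (1 + t) ^ (s - 1)) * (4 * R) := by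
  have hp1 : 1 < p := by
    rw [hp]
    have : 0 < 1 / s := by positivity
    linarith
  have hR2 : 0 < R / 2 := by positivity
  have hbc : ∀ R, Continuous (bump χ R t) := fun R =>
    IsC2.continuous_right (hχ.isC2_bump R) ht
  have hout : ∀ x, x ∉ Icc (-(2 * R)) (2 * R) → 2 * R ≤ |x| := by
    intro x hx
    by_contra hcon
    exact hx (abs_le.1 (not_le.1 hcon).le)
  have z1 : ∀ x, x ∉ Icc (-(2 * R)) (2 * R) → bump χ R t x = 0 := fun x hx =>
    hχ.bump_eq_zero hR (Or.inr (hout x hx))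
  have z2 : ∀ x, x ∉ Icc (-(2 * R)) (2 * R) → bump χ (R / 2) t x = 0 := fun x hx =>
    hχ.bump_eq_zero hR2 (Or.inr (by linarith [hout x hx]))
  have z3 : ∀ x, x ∉ Icc (-(2 * R)) (2 * R) → Z t x = 0 := fun x hx => by
    have := hZ x
    rwa [z1 x hx, Real.zero_rpow (by positivity), mul_zero, abs_nonpos_iff] at this
  have m1 : MemLp (fun x => g t x * bump χ R t x) 2 volume :=
    memLp_of_support (hgc.mul (hbc R)) fun x hx => by rw [z1 x hx, mul_zero]
  have m2 : MemLp (fun x => g t x * bump χ (R / 2) t x) 2 volume :=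
    memLp_of_support (hgc.mul (hbc _)) fun x hx => by rw [z2 x hx, mul_zero]
  have m3 : MemLp (Z t) 2 volume := memLp_of_support hZc z3
  have i1 := integrable_rpow_mul_memLp hp1 u m1
  have i2 := integrable_rpow_mul_memLp hp1 u m2
  have i3 := integrable_mul_memLp (toL2 u) m3
  set E := K ^ (-s) * (D ^ (s + 1) * ν ^ (-s) * R ^ (-(s + 1)) * (1 + t) ^ (s - 1)) with hE
  have hE0 : 0 ≤ E := by positivity
  have hpt : ∀ x, toL2 u x * Z t x ≤ K * (|toL2 u x| ^ p * (g t x * bump χ R t x)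
      - |toL2 u x| ^ p * (g t x * bump χ (R / 2) t x)) + E := by
    intro x
    -- Inside, Z = 0 and the cutoff at scale R equals 1, which dominates the one at scale R/2.
    -- Outside, the latter vanishes and Young's inequality applies. Hence only the difference of the
    -- two integrals is charged.
    by_cases hin : t < R ∧ |x| < R
    · rw [hZ0 x hin.1 hin.2, mul_zero,
        hχ.bump_eq_one hR (by rw [abs_of_nonneg ht]; exact hin.1.le) hin.2.le, ← mul_sub, ← mul_sub]
      have hg0 : 0 ≤ g t x := le_trans (by positivity) (hg x)
      have := hχ.bump_le_one (R / 2) t x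
      have h1 : 0 ≤ 1 - bump χ (R / 2) t x := by linarith
      positivity
    · have : bump χ (R / 2) t x = 0 := by
        refine hχ.bump_eq_zero hR2 ?_
        rw [mul_div_cancel₀ R two_ne_zero, abs_of_nonneg ht]
        by_contra hcon
        push Not at hcon
        exact hin hcon
      rw [this, mul_zero, mul_zero, sub_zero]
      exact mul_le_of_remainder_le hs hp hμs hK hR ht hD hν (hg x) (hχ.bump_nonneg R t x) (hZ x)
  rw [← setIntegral_eq_integral_of_forall_compl_eq_zero (s := Icc (-(2 * R)) (2 * R))
    (f := fun x => toL2 u x * Z t x) fun x hx => by rw [z3 x hx, mul_zero]]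
  have iE : IntegrableOn (fun _ : ℝ => E) (Icc (-(2 * R)) (2 * R)) :=
    integrableOn_const (by simp)
  have i12 := (i1.sub i2).const_mul K
  have hmono := setIntegral_mono_on (μ := volume) (s := Icc (-(2 * R)) (2 * R)) i3.integrableOn
    (i12.integrableOn.add iE) measurableSet_Icc fun x _ => hpt x
  refine hmono.trans (le_of_eq ?_)
  have hadd := integral_add (μ := volume.restrict (Icc (-(2 * R)) (2 * R))) i12.integrableOn iE
  refine hadd.trans ?_
  congr 1
  · rw [setIntegral_eq_integral_of_forall_compl_eq_zero, integral_const_mul]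
    · congr 1
      exact integral_sub i1 i2
    · intro x hx
      simp [z1 x hx, z2 x hx]
  · rw [setIntegral_const, smul_eq_mul, mul_comm, Measure.real, Real.volume_Icc,
      ENNReal.toReal_ofReal (by linarith)]
    ring

end

/-! ### The absorption inequality and nonexistence -/

section

variable {p s μ k θ δ C R : ℝ} {χ : ℝ → ℝ} {b h : ℝ → ℝ → ℝ}

/-- The space-time integral of `|u|^p` against the weighted cutoff. -/
def mass (p μ : ℝ) (h : ℝ → ℝ → ℝ) (χ : ℝ → ℝ) (u : ℝ → H1) (R : ℝ) : ℝ :=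
  ∫ t in timeInterval ⊤, ∫ x, |toL2 (u t) x| ^ p * (weight μ h t x * bump χ R t x)

theorem mass_nonneg (hχ : IsCutoff p C χ) (hh : IsCorrector μ k θ b h) (hk : 1 < k) (hθ : 0 < θ)
    (hθ1 : θ < 1) (u : ℝ → H1) (R : ℝ) : 0 ≤ mass p μ h χ u R := by
  refine setIntegral_nonneg (measurableSet_timeInterval ⊤) fun t ht => integral_nonneg fun x => ?_
  have h1 := hh.le_weight hk hθ.le ht.1 x
  have h2 : 0 ≤ (1 - θ) * (1 + t) ^ μ :=
    mul_nonneg (by linarith) (Real.rpow_nonneg (by linarith [ht.1]) _)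
  exact mul_nonneg (Real.rpow_nonneg (abs_nonneg _) _)
    (mul_nonneg (h2.trans h1) (hχ.bump_nonneg R t x))

theorem mass_integrand (hχ : IsCutoff p C χ) (hh : IsCorrector μ k θ b h) (hp : 1 < p)
    (u : ℝ → H1) (hu : ContinuousOn u (timeInterval ⊤)) (hR : 0 < R) {T₂ : ℝ} (hT : 2 * R < T₂) :
    IntervalIntegrable (fun t => ∫ x, |toL2 (u t) x| ^ p * (weight μ h t x * bump χ R t x))
      volume 0 T₂ ∧ mass p μ h χ u R =
        ∫ t in (0 : ℝ)..T₂, ∫ x, |toL2 (u t) x| ^ p * (weight μ h t x * bump χ R t x) := by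
  have hs := (hχ.suppIn_bump hR).mul_left (weight μ h)
  have hψ : IsCn 2 fun t x => weight μ h t x * bump χ R t x := hχ.isC2_weight_bump hh R
  have hT0 : 0 ≤ T₂ := by linarith
  have hsub : Icc 0 T₂ ⊆ timeInterval ⊤ := Icc_subset_timeInterval (EReal.coe_lt_top _)
  refine ⟨ContinuousOn.intervalIntegrable ?_, setIntegral_timeInterval (T₁ := 2 * R)
    (by positivity) hT (EReal.coe_lt_top _) fun t ht ht' => ?_⟩
  · rw [uIcc_of_le hT0]
    have hc : ContinuousOn (fun t => inner ℝ (nonlin p (u t))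
        (cls fun x => weight μ h t x * bump χ R t x)) (Icc 0 T₂) :=
      ((continuous_nonlin hp).comp_continuousOn (hu.mono hsub)).inner
        ((hs.continuousOn_cls (by positivity) hψ).mono fun t ht => ht.1)
    exact hc.congr fun t ht => integral_rpow_mul_eq_inner hp _ (hs.memLp hψ ht.1)
  · simp [hχ.bump_eq_zero hR (Or.inl (ht'.le.trans (le_abs_self t)))]

/-- The error of the pointwise Young inequality is integrated over |x| ≤ 2R and 0 ≤ t ≤ 2R + 1. It
is a constant times K^(-s) R^(-(s+1)) · 4R · (4R)^s / s, where the powers of R cancel exactly; so D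
depends on neither R nor K. -/
theorem exists_absorption (hμ : 0 < μ) (hk : 1 < k) (hθ : 0 < θ) (hθ1 : θ < 1) (hs : 0 < s)
    (hp : p = 1 + 1 / s) (hμs : μ ≤ 2 * s) (hC : 0 ≤ C) (hχ : IsCutoff p C χ)
    (hb : IsPerturbation k δ b) (hh : IsCorrector μ k θ b h) {u₀ : H1} {u₁ : L2} {u : ℝ → H1}
    (hu : IsSolution (damping μ b) p u₀ u₁ ⊤ u) :
    ∃ D, ∀ R, 1 ≤ R → ∀ K : ℝ, 0 < K →
      (∫ x, ((-dt (weight μ h) 0 x + weight μ h 0 x * damping μ b 0 x) * toL2 u₀ x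
          + weight μ h 0 x * u₁ x) * χ (x / R)) + mass p μ h χ u R
        ≤ K * (mass p μ h χ u R - mass p μ h χ u (R / 2)) + D * K ^ (-s) := by
  have hp1 : 1 < p := by
    rw [hp]
    have : 0 < 1 / s := by positivity
    linarith
  obtain ⟨C', hC', hbd⟩ := hh.weight_bounds hμ hk hθ.le hθ1 hb
  have hν : 0 < 1 - θ := by linarith
  set D₁ := (5 * C' + 12) * C with hD₁
  have hD₁0 : 0 ≤ D₁ := by positivity
  refine ⟨D₁ ^ (s + 1) * (1 - θ) ^ (-s) * (4 * 4 ^ s / s), fun R hR K hK => ?_⟩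
  have hR0 : 0 < R := by linarith
  have hT0 : 0 ≤ 2 * R + 1 := by positivity
  have hsub : Icc 0 (2 * R + 1) ⊆ timeInterval ⊤ := Icc_subset_timeInterval (EReal.coe_lt_top _)
  have hid := hu.weight_identity hχ hb hh hR0
  obtain ⟨j1, e1⟩ := mass_integrand hχ hh hp1 u hu.2.1.1 hR0 (T₂ := 2 * R + 1) (by linarith)
  obtain ⟨j2, e2⟩ := mass_integrand hχ hh hp1 u hu.2.1.1 (half_pos hR0) (T₂ := 2 * R + 1)
    (by linarith)
  set Z := remainder (damping μ b) (weight μ h) (bump χ R) with hZ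
  have hZs : SuppIn (2 * R) (2 * R) Z := suppIn_remainder (hχ.suppIn_bump hR0) _ _
  have hZc : IsCn 0 Z := isCn_remainder hb.isC2_damping hh.isC2_weight (hχ.isC2_bump R)
  have j3 : IntervalIntegrable (fun t => ∫ x, toL2 (u t) x * Z t x) volume 0 (2 * R + 1) := by
    refine ContinuousOn.intervalIntegrable ?_
    rw [uIcc_of_le hT0]
    have hc : ContinuousOn (fun t => inner ℝ (toL2 (u t)) (cls (Z t))) (Icc 0 (2 * R + 1)) :=
      (continuous_toL2.comp_continuousOn (hu.2.1.1.mono hsub)).inner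
        ((hZs.continuousOn_cls (by positivity) hZc).mono fun t ht => ht.1)
    exact hc.congr fun t ht => (inner_cls _ (hZs.memLp hZc ht.1)).symm
  have j4 : IntervalIntegrable (fun t : ℝ => (1 + t) ^ (s - 1)) volume 0 (2 * R + 1) := by
    refine ContinuousOn.intervalIntegrable ?_
    rw [uIcc_of_le hT0]
    exact (contDiffOn_one_add_rpow (n := 0) (s - 1)).continuousOn.mono fun t ht => ht.1
  set A := K ^ (-s) * (D₁ ^ (s + 1) * (1 - θ) ^ (-s) * R ^ (-(s + 1))) * (4 * R) with hA
  have hA0 : 0 ≤ A := by positivity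
  have hmono := intervalIntegral.integral_mono_on hT0 j3
    (((j1.sub j2).const_mul K).add (j4.const_mul A)) fun t ht => by
      have hw := fun x => hbd t x ht.1
      have := integral_remainder_le (g := weight μ h) (Z := Z) hχ hs hp hμs hK hR0 ht.1 hD₁0 hν
        (fun x => hh.le_weight hk hθ.le ht.1 x) (IsC2.continuous_right hh.isC2_weight ht.1)
        (hZc.continuous_right ht.1)
        (fun x => hχ.abs_remainder_le hp1 hC hC' hR ht.1 (hw x).1 (hw x).2.1 (hw x).2.2.1
          (hw x).2.2.2)
        (fun x htR hx => hχ.remainder_eq_zero hR0 ht.1 htR hx _ _) (u t)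
      refine this.trans (le_of_eq ?_)
      rw [hA]
      ring
  rw [intervalIntegral.integral_add ((j1.sub j2).const_mul K) (j4.const_mul A),
    intervalIntegral.integral_const_mul, intervalIntegral.integral_const_mul,
    intervalIntegral.integral_sub j1 j2, ← e1, ← e2, hid] at hmono
  refine hmono.trans (add_le_add_right ?_ _)
  calc A * ∫ t in (0 : ℝ)..(2 * R + 1), (1 + t) ^ (s - 1) ≤ A * ((4 * R) ^ s / s) := by
        gcongr
        exact integral_one_add_rpow_le hs hR
    _ = D₁ ^ (s + 1) * (1 - θ) ^ (-s) * (4 * 4 ^ s / s) * K ^ (-s)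
        * (R ^ (-(s + 1)) * (R * R ^ s)) := by
        rw [hA, Real.mul_rpow (by norm_num) hR0.le]
        ring
    _ = _ := by
        rw [← Real.rpow_one_add' hR0.le (by linarith), ← Real.rpow_add hR0,
          show -(s + 1) + (1 + s) = 0 by ring, Real.rpow_zero, mul_one]

theorem no_global_solution (hμ : 0 < μ) (hk : 1 < k) (hθ : 0 < θ) (hθ1 : θ < 1) (hp : 1 < p)
    (hpμ : p ≤ 1 + 2 / μ) (hb : IsPerturbation k δ b) (hh : IsCorrector μ k θ b h)
    {u₀ : H1} {u₁ : L2} (hdata : DataCondition (damping μ b) (weight μ h) u₀ u₁) (u : ℝ → H1) :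
    ¬ IsSolution (damping μ b) p u₀ u₁ ⊤ u := by
  intro hu
  obtain ⟨C, χ, hC, hχ⟩ := exists_isCutoff hp
  have hs : 0 < 1 / (p - 1) := by
    have : 0 < p - 1 := by linarith
    positivity
  have hps : p = 1 + 1 / (1 / (p - 1)) := by simp
  have hμs : μ ≤ 2 * (1 / (p - 1)) := by
    have h1 : p - 1 ≤ 2 / μ := by linarith
    rw [le_div_iff₀ hμ] at h1
    rw [mul_one_div, le_div_iff₀ (by linarith)]
    linarith
  obtain ⟨D, hD⟩ := exists_absorption hμ hk hθ hθ1 hs hps hμs hC hχ hb hh hu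
  -- A real c strictly between 0 and the lower limit bounds the integrals over all large symmetric
  -- intervals from below.
  obtain ⟨c, hc0, hc⟩ := EReal.lt_iff_exists_real_btwn.1 hdata
  have hc0' : 0 < c := by exact_mod_cast hc0
  obtain ⟨R₀, hR₀⟩ := eventually_atTop.1 (eventually_lt_of_lt_liminf hc)
  obtain ⟨N, hN⟩ := exists_nat_ge (max R₀ 1)
  have hg2 : IsCn 2 (weight μ h) := hh.isC2_weight
  have hloc : LocallyIntegrable fun x => (-dt (weight μ h) 0 x
      + weight μ h 0 x * damping μ b 0 x) * toL2 u₀ x + weight μ h 0 x * u₁ x := by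
    have c1 := hg2.continuous_right (le_refl 0)
    have c2 := (hg2.isCn_dt (m := 1) (by norm_num)).continuous_right (le_refl 0)
    have c3 := IsC2.continuous_right (hb.isC2_damping (μ := μ)) (le_refl 0)
    have l0 : LocallyIntegrable (toL2 u₀ : ℝ → ℝ) :=
      (Lp.memLp (toL2 u₀)).locallyIntegrable (by norm_num)
    have l1 : LocallyIntegrable (u₁ : ℝ → ℝ) := (Lp.memLp u₁).locallyIntegrable (by norm_num)
    exact (l0.continuous_mul (c2.neg.add (c1.mul c3))).add (l1.continuous_mul c1)
  -- Along dyadic radii the scale R/2 is that of the preceding term.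
  refine false_of_absorption (I := fun n => mass p μ h χ u (2 ^ n)) (N := N) (c := c) (D := D) hc0'
    hs (fun n => mass_nonneg hχ hh hk hθ hθ1 u _) fun n hn K hK => ?_
  have hRn : max R₀ 1 ≤ (2 : ℝ) ^ (n + 1) := by
    refine hN.trans ?_
    have h1 : n + 1 < 2 ^ (n + 1) := Nat.lt_two_pow_self
    have h2 : N ≤ 2 ^ (n + 1) := by omega
    exact_mod_cast h2
  have h1 := hD (2 ^ (n + 1)) ((le_max_right _ _).trans hRn) K hK
  have h2 : c ≤ _ := hχ.le_integral_data (R := 2 ^ (n + 1)) (by positivity) hloc fun s hs => by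
    exact_mod_cast (hR₀ s ((le_max_left _ _).trans (hRn.trans hs))).le
  have e : (2 : ℝ) ^ (n + 1) / 2 = 2 ^ n := by
    rw [pow_succ]
    ring
  rw [e] at h1
  linarith

end

end DampedWave

end

/-! ### The main theorem -/

theorem theorem1p3 (μ k θ : ℝ) (hμ : 0 < μ) (hk : max 1 μ < k) (hθ : 0 < θ) (hθ' : θ < 1) :
    ∃ δ₀ : ℝ, 0 < δ₀ ∧ ∀ δ : ℝ, 0 < δ → δ < δ₀ →
      ∀ b : ℝ → ℝ → ℝ, DampedWave.IsPerturbation k δ b →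
        (∃ h : ℝ → ℝ → ℝ, DampedWave.IsCorrector μ k θ b h) ∧
        ∀ h : ℝ → ℝ → ℝ, DampedWave.IsCorrector μ k θ b h →
          ∀ p : ℝ, 1 < p → p ≤ 1 + 2 / μ →
            ∀ (u₀ : DampedWave.H1) (u₁ : DampedWave.L2),
              DampedWave.DataCondition (DampedWave.damping μ b) (DampedWave.weight μ h) u₀ u₁ →
                DampedWave.BlowsUpInFiniteTime (DampedWave.damping μ b) p u₀ u₁ := by
  have hk1 : 1 < k := (le_max_left 1 μ).trans_lt hk
  have hkμ : μ < k := (le_max_right 1 μ).trans_lt hk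
  obtain ⟨δ₀, hδ₀, H⟩ := DampedWave.exists_delta hμ hk1 hkμ hθ
  refine ⟨δ₀, hδ₀, fun δ hδ hδ' b hb => ⟨H δ hδ hδ' b hb, fun h hh p hp hpμ u₀ u₁ hdata => ?_⟩⟩
  exact DampedWave.blowsUpInFiniteTime_of_no_global (hb.isDamping hμ hk1) hp
    (DampedWave.no_global_solution hμ hk1 hθ hθ' hp hpμ hb hh hdata)
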